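/- Theorem 3.1 (logarithmic Sobolev inequality). Let $\mathcal H$ be the Hilbert space of one bosonic mode, with Fock basis $\{|n\rangle\}_{n\in\mathbb N}$ and ladder operator $\hat a|n\rangle=\sqrt n\,|n-1\rangle$, and let $e^{t\mathcal L}$, $t\ge 0$, be the semigroup of the quantum-limited attenuator, with generator $$\mathcal L(X)=\hat a X\hat a^\dagger-\tfrac12\{\hat a^\dagger \hat a,X\},$$ that is, on trace-class $X$, $e^{t\mathcal L}(X)=\lim_{N\to\infty}e^{t\mathcal L}(P_NXP_N)$ with $P_N=\sum_{n\le N}|n\rangle\langle n|$, where $\mathcal L$ is bounded on the invariant space of operators $Y=P_NYP_N$. Let $\|X\|_p=\big(\mathrm{Tr}\,(X^\dagger X)^{p/2}\big)^{1/p}$ be the Schatten norm, $S(\rho)=-\mathrm{Tr}\,\rho\ln\rho$ the von Neumann entropy, and $\omega_z=\sum_{n\ge0}(1-z)z^n|n\rangle\langle n|$ the thermal state. For $0<a<1$ and $0<z<1$ put $$F_a(X)=\frac{d}{dt}\ln\|e^{t\mathcal L}(X)\|_{1/a}\Big|_{t=0^+},\qquad S_a(X)=S\!\left(\frac{X^{1/a}}{\mathrm{Tr}\,X^{1/a}}\right),\qquad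 \mathcal F_{z,a}(X)=F_a(X)+\mu(z,a)\,S_a(X),$$ $$\mu(z,a)=\frac{a\,z^{\frac{a-1}{a}}-1+(1-a)z}{\ln z^{1/a}}.$$ Then $F_a(\omega_z)$ exists and is a real number, and for every nonzero positive operator $X$ of finite rank: 1. the limit defining the right derivative $F_a(X)$ exists in $[-\infty,+\infty]$, and it is a real number if $\sum_n n\,\langle n|X|n\rangle<\infty$; 2. $\mathcal F_{z,a}(X)\le\mathcal F_{z,a}(\omega_z)$; 3. $F_a(X)\le 1-a$. -/

import Mathlib

open Filter Topology InnerProductSpace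
open scoped ENNReal

/-!
One bosonic mode.  `H` is a complex Hilbert space and `e` is its Fock basis, `e n = |n⟩`.  The ladder
operator is `a |n⟩ = √n |n-1⟩`; every irreducible representation of `[a, a†] = 1` has this form.
-/
namespace OneMode

variable {H : Type*} [NormedAddCommGroup H] [InnerProductSpace ℂ H] [CompleteSpace H]

/-- The projection `P_N = ∑_{n ≤ N} |n⟩⟨n|` onto the first `N + 1` Fock states. -/
noncomputable def fockProj (e : HilbertBasis ℕ ℂ H) (N : ℕ) : H →L[ℂ] H :=
  ∑ n ∈ Finset.range (N + 1), rankOne ℂ (e n) (e n)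

/-- The ladder operator on states with at most `N` photons:
`a P_N = ∑_{n < N} √(n+1) |n⟩⟨n+1|`, a bounded operator. -/
noncomputable def ladder (e : HilbertBasis ℕ ℂ H) (N : ℕ) : H →L[ℂ] H :=
  ∑ n ∈ Finset.range N, ((Real.sqrt (n + 1) : ℝ) : ℂ) • rankOne ℂ (e n) (e (n + 1))

/-- The map `Y ↦ c Y c† - ½ (c† c Y + Y c† c)` for a bounded operator `c`. -/
noncomputable def lindblad (c : H →L[ℂ] H) : (H →L[ℂ] H) →L[ℂ] (H →L[ℂ] H) :=
  ContinuousLinearMap.mulLeftRight ℂ (H →L[ℂ] H) c (star c)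
    - (1 / 2 : ℂ) • (ContinuousLinearMap.mul ℂ (H →L[ℂ] H) (star c * c)
        + (ContinuousLinearMap.mul ℂ (H →L[ℂ] H)).flip (star c * c))

/-- The generator `ℒ(Y) = a Y a† - ½ {a† a, Y}` of the quantum-limited attenuator on the operators
`Y = P_N Y P_N`.  These form an `ℒ`-invariant space, on which `a Y a† = (a P_N) Y (a P_N)†` and
`a† a Y = (a P_N)† (a P_N) Y`, `Y a† a = Y (a P_N)† (a P_N)`. -/
noncomputable def generator (e : HilbertBasis ℕ ℂ H) (N : ℕ) :
    (H →L[ℂ] H) →L[ℂ] (H →L[ℂ] H) :=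
  lindblad (ladder e N)

/-- The attenuator semigroup `e^{tℒ}`, `t ≥ 0`.  On `Y = P_N Y P_N` it is the exponential of the
bounded operator `t ℒ`; it is extended to trace-class `X` by continuity,
`e^{tℒ}(X) = lim_N e^{tℒ}(P_N X P_N)`. -/
noncomputable def attenuator (e : HilbertBasis ℕ ℂ H) (t : ℝ) (X : H →L[ℂ] H) : H →L[ℂ] H :=
  limUnder atTop (fun N : ℕ =>
    NormedSpace.exp ((t : ℂ) • generator e N) (fockProj e N * X * fockProj e N))

/-- The trace of a positive operator, with values in `[0, ∞]`. -/
noncomputable def trace (e : HilbertBasis ℕ ℂ H) (A : H →L[ℂ] H) : ℝ≥0∞ :=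
  ∑' n, ENNReal.ofReal (inner ℂ (e n) (A (e n))).re

/-- The power `A ^ s` (`s > 0`) of a positive operator, by functional calculus. -/
noncomputable def power (A : H →L[ℂ] H) (s : ℝ) : H →L[ℂ] H :=
  cfc (fun x : ℝ => x ^ s) A

/-- The Schatten norm `‖X‖_p = (Tr (X† X)^{p/2})^{1/p}`, equal to `∞` outside the Schatten class. -/
noncomputable def schattenNorm (e : HilbertBasis ℕ ℂ H) (p : ℝ) (X : H →L[ℂ] H) : ℝ≥0∞ :=
  trace e (power (star X * X) (p / 2)) ^ (1 / p)

/-- The von Neumann entropy `S(ρ) = - Tr ρ ln ρ` of a state, where `0 ln 0 = 0`. -/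
noncomputable def entropy (e : HilbertBasis ℕ ℂ H) (ρ : H →L[ℂ] H) : ℝ≥0∞ :=
  trace e (cfc Real.negMulLog ρ)

/-- `S_a(X) = S(X^{1/a} / Tr X^{1/a})`. -/
noncomputable def Sa (e : HilbertBasis ℕ ℂ H) (a : ℝ) (X : H →L[ℂ] H) : ℝ :=
  (entropy e
    ((((trace e (power X (1 / a))).toReal⁻¹ : ℝ) : ℂ) • power X (1 / a))).toReal

/-- `t ↦ ln ‖e^{tℒ}(X)‖_{1/a}`. -/
noncomputable def logNorm (e : HilbertBasis ℕ ℂ H) (a : ℝ) (X : H →L[ℂ] H) (t : ℝ) : ℝ :=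
  Real.log (schattenNorm e (1 / a) (attenuator e t X)).toReal

/-- The difference quotient of `t ↦ ln ‖e^{tℒ}(X)‖_{1/a}` at `0`. -/
noncomputable def logNormSlope (e : HilbertBasis ℕ ℂ H) (a : ℝ) (X : H →L[ℂ] H) (t : ℝ) : ℝ :=
  (logNorm e a X t - logNorm e a X 0) / t

/-- `F_a(X) = d/dt ln ‖e^{tℒ}(X)‖_{1/a}` at `t = 0`: the right derivative, since `e^{tℒ}` is defined
for `t ≥ 0`, as an extended real number.  That the upper limit is a limit is asserted
wherever `Fa` is used. -/
noncomputable def Fa (e : HilbertBasis ℕ ℂ H) (a : ℝ) (X : H →L[ℂ] H) : EReal :=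
  limsup (fun t : ℝ => ((logNormSlope e a X t : ℝ) : EReal)) (𝓝[>] 0)

/-- `μ(z, a) = (a z^{(a-1)/a} - 1 + (1 - a) z) / ln z^{1/a}`. -/
noncomputable def mu (z a : ℝ) : ℝ :=
  (a * z ^ ((a - 1) / a) - 1 + (1 - a) * z) / Real.log (z ^ (1 / a))

/-- `ℱ_{z,a}(X) = F_a(X) + μ(z, a) S_a(X)`. -/
noncomputable def calF (e : HilbertBasis ℕ ℂ H) (z a : ℝ) (X : H →L[ℂ] H) : EReal :=
  Fa e a X + ((mu z a * Sa e a X : ℝ) : EReal)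

/-- The thermal state `ω_z = ∑_n (1 - z) z^n |n⟩⟨n|`. -/
noncomputable def thermal (e : HilbertBasis ℕ ℂ H) (z : ℝ) : H →L[ℂ] H :=
  ∑' n : ℕ, (((1 - z) * z ^ n : ℝ) : ℂ) • rankOne ℂ (e n) (e n)

/-- `Tr [N X] < ∞`, where `N = a† a` is the photon number. -/
def FiniteEnergy (e : HilbertBasis ℕ ℂ H) (X : H →L[ℂ] H) : Prop :=
  Summable fun n : ℕ => (n : ℝ) * (inner ℂ (e n) (X (e n))).re

end OneMode

set_option linter.unusedSectionVars false

/-! Put `p = 1/a` and write a finite-rank `X = ∑ c_i |φ_i⟩⟨φ_i|` with `c` decreasing. Since `ln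
‖e^{tℒ} X‖_p = a ln Tr (e^{tℒ} X)^p`, the derivative at finite energy is `Tr [X^{p-1} ℒ(X)] / Tr
X^p`, with numerator `∑ c_i^{p-1} c_j M_ij - ∑ c_j^p E_j`, where `M_ij = |⟨φ_i, a φ_j⟩|²` and `E_j =
⟨φ_j, a† a φ_j⟩`.

Bessel's inequality gives `∑_i M_ij ≤ E_j` and, because `a a† = a† a + 1`, also `∑_j M_ij ≤ E_i +
1`. These two bounds and the monotonicity of `c` force the numerator below its value at `φ_k = |k⟩`
(`sum_rearrangement_le`), which is `diagFlux` of `y_k = c_k^p`. So only sequences remain.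

The bound `1 - a` then follows from weighted AM-GM and summation by parts (`diagFlux_le`). The
entropic bound (`diagFlux_add_entropy_le`) is an induction that strips `y_0`: by Hölder the flux
lost depends only on `y_0` and the tail sum `s`, and the chain rule for the entropy leaves an
inequality in the single ratio `r = s / (y_0 + s)`, whose extremal point is `w = z^{1/a}`
(`geomRatio_le`). The normalised `ω_z^{1/a}` is geometric with exactly this ratio, so its value is
the maximum.

The analytic work is the derivative itself. With the Kraus form `e^{tℒ}(X) = ∑ K_k X K_k†`, the
output trace is bounded below by convexity of `y^p`, tested in the eigenbasis of `X`, and above by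
Hölder for the no-loss term `k = 0` and by norm continuity of the power `p - 1` for `k ≥ 1`. If
every `φ_j` has finite energy, both bounds have the same slope. Otherwise the upper bound alone
gives slope `-∞`, and the inequalities are trivial. The rearrangement is done at `t > 0`, with `e^t
- 1` in place of the commutator `1`, and divided by `t` afterwards; this avoids the unbounded
operator `a`. -/

namespace OneMode

/-! ### Functional calculus: intertwining, powers and scalar inequalities -/

section FunctionalCalculus

variable {H : Type*} [NormedAddCommGroup H] [InnerProductSpace ℂ H] [CompleteSpace H]

/-- The expectation value `Re ⟨x, V x⟩`. -/
noncomputable def expect (V : H →L[ℂ] H) (x : H) : ℝ := (inner ℂ x (V x)).re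

theorem aeval_intertwine {S T C : H →L[ℂ] H} (h : C * S = T * C) (q : Polynomial ℝ) :
    C * Polynomial.aeval S q = Polynomial.aeval T q * C := by
  induction q using Polynomial.induction_on' with
  | add p q hp hq => simp [mul_add, add_mul, hp, hq]
  | monomial n c =>
    have hn : C * S ^ n = T ^ n * C := by
      induction n with
      | zero => simp
      | succ n ih => rw [pow_succ, ← mul_assoc, ih, mul_assoc, h, ← mul_assoc, ← pow_succ]
    rw [Polynomial.aeval_monomial, Polynomial.aeval_monomial, ← mul_assoc, ← Algebra.commutes,
      mul_assoc, hn, mul_assoc]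

/-- Weierstrass on `[-M, M]`, which contains all the spectra concerned. One polynomial serves every
`S`, hence two operators at once. -/
theorem exists_polynomial_norm_cfc_sub_le {f : ℝ → ℝ} (hf : Continuous f) (M : ℝ) {ε : ℝ}
    (hε : 0 < ε) : ∃ q : Polynomial ℝ, ∀ S : H →L[ℂ] H, IsSelfAdjoint S → ‖S‖ ≤ M →
      ‖cfc f S - Polynomial.aeval S q‖ ≤ ε := by
  obtain ⟨q, hq⟩ := exists_polynomial_near_of_continuousOn (-M) M f hf.continuousOn ε hε
  refine ⟨q, fun S hS hM => ?_⟩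
  rw [← cfc_polynomial q S hS, ← cfc_sub f (fun x => q.eval x) S hf.continuousOn
    q.continuous.continuousOn]
  refine norm_cfc_le hε.le fun x hx => ?_
  have hx' : ‖x‖ ≤ ‖S‖ := by
    rcases subsingleton_or_nontrivial (H →L[ℂ] H) with hs | hn
    · rw [spectrum.of_subsingleton] at hx
      exact hx.elim
    · exact spectrum.norm_le_norm_of_mem hx
  have := hq x (abs_le.1 (hx'.trans hM))
  rw [Real.norm_eq_abs, abs_sub_comm]
  exact this.le

/-- Polynomials inherit the intertwining, and one polynomial approximates `f` on both spectra. With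
`C = |x⟩⟨x|` this gives the action on eigenvectors; it also transfers powers from `C† C` to `C C†`.
-/
theorem cfc_intertwine {f : ℝ → ℝ} (hf : Continuous f) {S T C : H →L[ℂ] H} (hS : IsSelfAdjoint S)
    (hT : IsSelfAdjoint T) (h : C * S = T * C) : C * cfc f S = cfc f T * C := by
  rw [← sub_eq_zero, ← norm_le_zero_iff]
  refine le_of_forall_pos_le_add fun ε hε => ?_
  have hC : 0 < 2 * ‖C‖ + 1 := by positivity
  obtain ⟨q, hq⟩ := exists_polynomial_norm_cfc_sub_le (H := H) hf (max ‖S‖ ‖T‖) (div_pos hε hC)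
  have h1 := hq S hS (le_max_left _ _)
  have h2 := hq T hT (le_max_right _ _)
  have key : C * cfc f S - cfc f T * C =
      C * (cfc f S - Polynomial.aeval S q) - (cfc f T - Polynomial.aeval T q) * C := by
    rw [mul_sub, sub_mul, aeval_intertwine h]; abel
  rw [key, zero_add]
  calc _ ≤ ‖C‖ * ‖cfc f S - Polynomial.aeval S q‖ + ‖cfc f T - Polynomial.aeval T q‖ * ‖C‖ :=
        (norm_sub_le _ _).trans (add_le_add (norm_mul_le _ _) (norm_mul_le _ _))
    _ ≤ ‖C‖ * (ε / (2 * ‖C‖ + 1)) + (ε / (2 * ‖C‖ + 1)) * ‖C‖ := by gcongr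
    _ = ε * (2 * ‖C‖ / (2 * ‖C‖ + 1)) := by ring
    _ ≤ ε * 1 := by
        gcongr
        rw [div_le_one hC]; linarith
    _ = ε := mul_one ε

/-- For an eigenvector `x`, the operator `|x⟩⟨x|` intertwines the scalar `c` with `S`; the
intertwining of `f` is then evaluated at `x`. -/
theorem cfc_apply_of_eigenvector {f : ℝ → ℝ} (hf : Continuous f) {S : H →L[ℂ] H}
    (hS : IsSelfAdjoint S) {x : H} {c : ℝ} (h : S x = (c : ℂ) • x) :
    cfc f S x = (f c : ℂ) • x := by
  have hc : algebraMap ℝ (H →L[ℂ] H) c = (c : ℂ) • (1 : H →L[ℂ] H) := by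
    rw [Algebra.algebraMap_eq_smul_one]; rfl
  have hfc : algebraMap ℝ (H →L[ℂ] H) (f c) = (f c : ℂ) • (1 : H →L[ℂ] H) := by
    rw [Algebra.algebraMap_eq_smul_one]; rfl
  have key := cfc_intertwine hf (C := rankOne ℂ x x)
    (IsSelfAdjoint.algebraMap (H →L[ℂ] H) (IsSelfAdjoint.all c)) hS (by
      rw [hc]
      ext y
      simp only [mul_apply_eq_comp, smul_apply, one_apply_eq_self, rankOne_apply, map_smul, h]
      exact smul_comm _ _ _)
  rw [cfc_algebraMap, hfc] at key
  rcases eq_or_ne x 0 with rfl | hx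
  · simp
  have h2 := congrArg (fun Z : H →L[ℂ] H => Z x) key
  simp only [mul_apply_eq_comp, smul_apply,
    one_apply_eq_self, rankOne_apply, map_smul, inner_self_eq_norm_sq_to_K] at h2
  have hn : ((‖x‖ : ℂ)) ^ 2 ≠ 0 := by simpa using hx
  rw [smul_comm] at h2
  exact (smul_right_injective H hn h2).symm

theorem expect_mono {V W : H →L[ℂ] H} (h : V ≤ W) (x : H) : expect V x ≤ expect W x := by
  have := (ContinuousLinearMap.le_def V W).1 h
  have h2 := this.re_inner_nonneg_right x
  simp only [sub_apply, inner_sub_right, map_sub] at h2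
  exact sub_nonneg.1 h2

theorem expect_nonneg {V : H →L[ℂ] H} (h : 0 ≤ V) (x : H) : 0 ≤ expect V x := by
  simpa [expect] using expect_mono h x

theorem expect_le_norm (V : H →L[ℂ] H) (x : H) : expect V x ≤ ‖V‖ * ‖x‖ ^ 2 := by
  calc expect V x ≤ ‖inner ℂ x (V x)‖ := Complex.re_le_norm _
    _ ≤ ‖x‖ * ‖V x‖ := norm_inner_le_norm _ _
    _ ≤ ‖x‖ * (‖V‖ * ‖x‖) := by gcongr; exact V.le_opNorm x
    _ = _ := by ring

theorem expect_sub (V W : H →L[ℂ] H) (x : H) : expect (V - W) x = expect V x - expect W x := by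
  simp [expect]

theorem expect_add (V W : H →L[ℂ] H) (x : H) : expect (V + W) x = expect V x + expect W x := by
  simp [expect]

theorem expect_smul (c : ℝ) (V : H →L[ℂ] H) (x : H) : expect (c • V) x = c * expect V x := by
  rw [expect, smul_apply, ← Complex.coe_smul, inner_smul_right, Complex.re_ofReal_mul, expect]

theorem expect_algebraMap (c : ℝ) (x : H) :
    expect (algebraMap ℝ (H →L[ℂ] H) c) x = c * ‖x‖ ^ 2 := by
  rw [Algebra.algebraMap_eq_smul_one, expect_smul, expect, one_apply_eq_self,
    ← inner_self_eq_norm_sq (𝕜 := ℂ)]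
  rfl

theorem expect_le_add (V W : H →L[ℂ] H) (x : H) :
    expect V x ≤ expect W x + ‖V - W‖ * ‖x‖ ^ 2 := by
  have := expect_le_norm (V - W) x
  rw [expect_sub] at this
  linarith

theorem expect_star_mul (S : H →L[ℂ] H) (x : H) : expect (star S * S) x = ‖S x‖ ^ 2 := by
  rw [expect, mul_apply_eq_comp, ContinuousLinearMap.star_eq_adjoint,
    ContinuousLinearMap.adjoint_inner_right, ← inner_self_eq_norm_sq (𝕜 := ℂ)]
  rfl

theorem continuous_rpow_of_pos {s : ℝ} (hs : 0 < s) : Continuous fun x : ℝ => x ^ s :=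
  Real.continuous_rpow_const hs.le

theorem power_nonneg {Y : H →L[ℂ] H} (hY : 0 ≤ Y) (s : ℝ) : 0 ≤ power Y s :=
  cfc_nonneg fun _ hx => Real.rpow_nonneg (spectrum_nonneg_of_nonneg hY hx) s

theorem power_add {Y : H →L[ℂ] H} (hY : 0 ≤ Y) {s r : ℝ} (hs : 0 < s) (hr : 0 < r) :
    power Y (s + r) = power Y s * power Y r := by
  rw [power, power, power, ← cfc_mul _ _ Y (continuous_rpow_of_pos hs).continuousOn
    (continuous_rpow_of_pos hr).continuousOn]
  refine cfc_congr fun x hx => ?_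
  exact Real.rpow_add_of_nonneg (spectrum_nonneg_of_nonneg hY hx) hs.le hr.le

theorem power_one {Y : H →L[ℂ] H} (hY : 0 ≤ Y) : power Y 1 = Y := by
  have hsa : IsSelfAdjoint Y := IsSelfAdjoint.of_nonneg hY
  conv_rhs => rw [← cfc_id' ℝ Y]
  exact cfc_congr fun x hx => Real.rpow_one x

theorem isSelfAdjoint_power (Y : H →L[ℂ] H) (s : ℝ) : IsSelfAdjoint (power Y s) :=
  cfc_predicate _ _

theorem expect_power {Y : H →L[ℂ] H} (hY : 0 ≤ Y) {s : ℝ} (hs : 0 < s) (x : H) :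
    expect (power Y s) x = ‖power Y (s / 2) x‖ ^ 2 := by
  rw [← expect_star_mul, (isSelfAdjoint_power Y (s / 2)).star_eq,
    ← power_add hY (half_pos hs) (half_pos hs), add_halves]

/-- Removes the modulus from the Schatten norm of a positive operator. -/
theorem power_star_mul_self {Y : H →L[ℂ] H} (hY : 0 ≤ Y) {s : ℝ} (hs : 0 < s) :
    power (star Y * Y) (s / 2) = power Y s := by
  have hsa : IsSelfAdjoint Y := IsSelfAdjoint.of_nonneg hY
  have h2 : star Y * Y = cfc (fun x : ℝ => x ^ 2) Y := by
    rw [hsa.star_eq, ← pow_two, cfc_pow_id Y]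
  rw [h2, power, power, ← cfc_comp' (fun x : ℝ => x ^ (s / 2)) (fun x : ℝ => x ^ 2) Y
    (continuous_rpow_of_pos (half_pos hs)).continuousOn (by fun_prop)]
  refine cfc_congr fun x hx => ?_
  have hx0 : 0 ≤ x := spectrum_nonneg_of_nonneg hY hx
  rw [← Real.rpow_natCast, ← Real.rpow_mul hx0]
  congr 1
  push_cast
  ring

/-- Eventually all spectra lie in one compact ball, where the functional calculus is continuous in
the operator. No derivative of `Y ↦ Y^{p-1}` is needed later, since its variation only multiplies
loss probabilities. -/
theorem tendsto_power {X : Type*} {l : Filter X} {F : X → H →L[ℂ] H} {Y : H →L[ℂ] H} {s : ℝ}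
    (hs : 0 < s) (hF : Tendsto F l (𝓝 Y)) (hF0 : ∀ᶠ x in l, 0 ≤ F x) (hY : 0 ≤ Y) :
    Tendsto (fun x => power (F x) s) l (𝓝 (power Y s)) := by
  have hb : ∀ Z : H →L[ℂ] H, ‖Z‖ ≤ ‖Y‖ + 1 → spectrum ℝ Z ⊆ Metric.closedBall 0 (‖Y‖ + 1) := by
    intro Z hZ x hx
    rw [mem_closedBall_zero_iff]
    rcases subsingleton_or_nontrivial (H →L[ℂ] H) with hs | hn
    · rw [spectrum.of_subsingleton] at hx
      exact hx.elim
    · exact (spectrum.norm_le_norm_of_mem hx).trans hZ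
  refine Filter.Tendsto.cfc (isCompact_closedBall (0 : ℝ) (‖Y‖ + 1)) _ hF ?_ ?_ (hb Y (by simp))
    (IsSelfAdjoint.of_nonneg hY) (continuous_rpow_of_pos hs).continuousOn
  · have : ∀ᶠ x in l, ‖F x‖ < ‖Y‖ + 1 := hF.norm.eventually_lt_const (by simp)
    exact this.mono fun x hx => hb _ hx.le
  · exact hF0.mono fun x hx => IsSelfAdjoint.of_nonneg hx

/-- Young's inequality for a number and a positive operator. -/
theorem expect_power_young {Y : H →L[ℂ] H} (hY : 0 ≤ Y) {p c : ℝ} (hp : 1 < p) (hc : 0 ≤ c)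
    {x : H} (hx : ‖x‖ = 1) :
    p * (c * expect (power Y (p - 1)) x) ≤ c ^ p + (p - 1) * expect (power Y p) x := by
  have hsa : IsSelfAdjoint Y := IsSelfAdjoint.of_nonneg hY
  have h1 : (p * c) • power Y (p - 1) ≤ algebraMap ℝ _ (c ^ p) + (p - 1) • power Y p := by
    have hcont := continuous_rpow_of_pos (sub_pos.2 hp)
    have hcont' := continuous_rpow_of_pos (zero_lt_one.trans hp)
    rw [power, power, ← cfc_smul _ _ _ hcont.continuousOn, ← cfc_smul _ _ _ hcont'.continuousOn,
      ← cfc_const_add _ _ _ (by fun_prop)]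
    refine cfc_mono (fun y hy => ?_) (by fun_prop) (by fun_prop)
    have hy0 : 0 ≤ y := spectrum_nonneg_of_nonneg hY hy
    have hp0 : 0 < p := by linarith
    have hpq : p.HolderConjugate (p / (p - 1)) := Real.HolderConjugate.conjExponent hp
    have := Real.young_inequality_of_nonneg hc (Real.rpow_nonneg hy0 (p - 1)) hpq
    rw [← Real.rpow_mul hy0, mul_div_cancel₀ _ (sub_pos.2 hp).ne'] at this
    simp only [smul_eq_mul]
    calc p * c * y ^ (p - 1) = p * (c * y ^ (p - 1)) := by ring
      _ ≤ p * (c ^ p / p + y ^ p / (p / (p - 1))) := by gcongr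
      _ = c ^ p + (p - 1) * y ^ p := by
        have := (sub_pos.2 hp).ne'
        field_simp
  have h2 := expect_mono h1 x
  rw [expect_add, expect_smul, expect_smul, expect_algebraMap, hx] at h2
  linarith

/-- The tangent line inequality for the convex function `y ↦ y ^ p`. -/
theorem expect_power_tangent {Y : H →L[ℂ] H} (hY : 0 ≤ Y) {p c : ℝ} (hp : 1 < p) (hc : 0 ≤ c)
    {x : H} (hx : ‖x‖ = 1) :
    c ^ p + p * (c ^ (p - 1) * (expect Y x - c)) ≤ expect (power Y p) x := by
  have hsa : IsSelfAdjoint Y := IsSelfAdjoint.of_nonneg hY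
  have h1 : algebraMap ℝ _ (-((p - 1) * c ^ p)) + (p * c ^ (p - 1)) • Y ≤ power Y p := by
    have hcont' := continuous_rpow_of_pos (zero_lt_one.trans hp)
    conv_lhs => rw [← cfc_id' ℝ Y]
    rw [power, ← cfc_smul _ _ _ (by fun_prop), ← cfc_const_add _ _ _ (by fun_prop)]
    refine cfc_mono (fun y hy => ?_) (by fun_prop) (by fun_prop)
    have hy0 : 0 ≤ y := spectrum_nonneg_of_nonneg hY hy
    have hp0 : 0 < p := by linarith
    -- The tangent line is Young's inequality again, now for `y` and `c ^ (p - 1)`.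
    have hpq : p.HolderConjugate (p / (p - 1)) := Real.HolderConjugate.conjExponent hp
    have := Real.young_inequality_of_nonneg hy0 (Real.rpow_nonneg hc (p - 1)) hpq
    rw [← Real.rpow_mul hc, mul_div_cancel₀ _ (sub_pos.2 hp).ne'] at this
    simp only [smul_eq_mul]
    have h5 : p * (y * c ^ (p - 1)) ≤ p * (y ^ p / p + c ^ p / (p / (p - 1))) := by gcongr
    have h6 : p * (y ^ p / p + c ^ p / (p / (p - 1))) = y ^ p + (p - 1) * c ^ p := by
      have := (sub_pos.2 hp).ne'
      field_simp
    linarith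
  have h2 := expect_mono h1 x
  refine le_trans (le_of_eq ?_) h2
  have hcp : c ^ (p - 1) * c = c ^ p := by
    rcases hc.eq_or_lt with rfl | hc
    · simp [Real.zero_rpow (show p ≠ 0 by linarith)]
    · rw [← Real.rpow_add_one hc.ne', sub_add_cancel]
  rw [expect_add, expect_smul, expect_algebraMap, hx]
  linear_combination (-p) * hcp

end FunctionalCalculus

/-! ### Rank-one decompositions, traces and Hölder-type bounds -/

section Frames

variable {H : Type*} [NormedAddCommGroup H] [InnerProductSpace ℂ H] [CompleteSpace H]
  {ι κ : Type*}

/-- `Y = ∑ i, |v i⟩⟨v i|` with `∑ i, ‖v i‖ ^ 2 < ∞`. -/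
structure IsFrame (v : ι → H) (Y : H →L[ℂ] H) : Prop where
  summable : Summable fun i => ‖v i‖ ^ 2
  hasSum : HasSum (fun i => rankOne ℂ (v i) (v i)) Y

theorem summable_rankOne {v : ι → H} (hv : Summable fun i => ‖v i‖ ^ 2) :
    Summable fun i => rankOne ℂ (v i) (v i) := by
  refine Summable.of_norm (hv.congr fun i => ?_)
  rw [norm_rankOne, pow_two]

theorem isFrame_tsum {v : ι → H} (hv : Summable fun i => ‖v i‖ ^ 2) :
    IsFrame v (∑' i, rankOne ℂ (v i) (v i)) :=
  ⟨hv, (summable_rankOne hv).hasSum⟩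

theorem expect_rankOne (v x : H) : expect (rankOne ℂ v v) x = ‖inner ℂ x v‖ ^ 2 := by
  rw [expect, rankOne_apply, inner_smul_right, ← inner_conj_symm x v, mul_comm,
    ← Complex.normSq_eq_conj_mul_self, Complex.ofReal_re, Complex.normSq_eq_norm_sq,
    Complex.norm_conj]

theorem IsFrame.hasSum_expect {v : ι → H} {Y : H →L[ℂ] H} (h : IsFrame v Y) (x : H) :
    HasSum (fun i => ‖inner ℂ x (v i)‖ ^ 2) (expect Y x) := by
  have h1 := h.hasSum.mapL (ContinuousLinearMap.apply ℂ H x)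
  have h2 := (h1.mapL (innerSL ℂ x)).mapL Complex.reCLM
  refine h2.congr_fun fun i => ?_
  exact (expect_rankOne (v i) x).symm

theorem IsFrame.nonneg {v : ι → H} {Y : H →L[ℂ] H} (h : IsFrame v Y) : 0 ≤ Y :=
  h.hasSum.nonneg fun i =>
    (ContinuousLinearMap.nonneg_iff_isPositive _).2 (isPositive_rankOne_self (v i))

theorem hasSum_norm_inner_sq (e : HilbertBasis κ ℂ H) (x : H) :
    HasSum (fun n => ‖inner ℂ (e n) x‖ ^ 2) (‖x‖ ^ 2) := by
  have := (e.hasSum_inner_mul_inner x x).mapL Complex.reCLM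
  convert this using 2 with n
  · rw [← inner_conj_symm x (e n)]
    simp only [Complex.reCLM_apply]
    rw [← Complex.normSq_eq_conj_mul_self, Complex.ofReal_re, Complex.normSq_eq_norm_sq]
  · rw [← inner_self_eq_norm_sq (𝕜 := ℂ)]; rfl

theorem trace_eq_tsum_expect (e : HilbertBasis ℕ ℂ H) (A : H →L[ℂ] H) :
    trace e A = ∑' n, ENNReal.ofReal (expect A (e n)) := rfl

/-- Tonelli and Parseval; the vectors `v i` need not be orthogonal. -/
theorem IsFrame.trace_eq {v : ι → H} {Y : H →L[ℂ] H} (h : IsFrame v Y) (e : HilbertBasis ℕ ℂ H) :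
    trace e Y = ENNReal.ofReal (∑' i, ‖v i‖ ^ 2) := by
  rw [trace_eq_tsum_expect, ENNReal.ofReal_tsum_of_nonneg (fun i => by positivity) h.summable]
  have h1 : ∀ n, ENNReal.ofReal (expect Y (e n)) =
      ∑' i, ENNReal.ofReal (‖inner ℂ (e n) (v i)‖ ^ 2) := fun n => by
    rw [← (h.hasSum_expect (e n)).tsum_eq,
      ENNReal.ofReal_tsum_of_nonneg (fun i => by positivity) (h.hasSum_expect (e n)).summable]
  simp_rw [h1]
  rw [ENNReal.tsum_comm]
  refine tsum_congr fun i => ?_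
  rw [← ENNReal.ofReal_tsum_of_nonneg (fun i => by positivity) (hasSum_norm_inner_sq e _).summable,
    (hasSum_norm_inner_sq e _).tsum_eq]

theorem IsFrame.map {v : ι → H} {Y : H →L[ℂ] H} (h : IsFrame v Y) (S : H →L[ℂ] H) :
    IsFrame (fun i => S (v i)) (S * Y * star S) := by
  constructor
  · refine Summable.of_nonneg_of_le (fun i => by positivity) (fun i => ?_)
      (h.summable.mul_left (‖S‖ ^ 2))
    rw [← mul_pow]
    exact pow_le_pow_left₀ (norm_nonneg _) (S.le_opNorm _) 2
  · have := h.hasSum.mapL (ContinuousLinearMap.mulLeftRight ℂ (H →L[ℂ] H) S (star S))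
    refine this.congr_fun fun i => ?_
    ext x
    simp [ContinuousLinearMap.star_eq_adjoint, ContinuousLinearMap.adjoint_inner_right]

theorem IsFrame.summable_expect {v : ι → H} {Y : H →L[ℂ] H} (h : IsFrame v Y) {V : H →L[ℂ] H}
    (hV : 0 ≤ V) : Summable fun i => expect V (v i) :=
  Summable.of_nonneg_of_le (fun _ => expect_nonneg hV _) (fun _ => expect_le_norm V _)
    (h.summable.mul_left ‖V‖)

/-- Splitting the power symmetrically keeps the operator positive, and its frame is the old one
moved by `Z ^ (s / 2)`. -/
theorem IsFrame.trace_conj_power {v : ι → H} {Y : H →L[ℂ] H} (h : IsFrame v Y)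
    (e : HilbertBasis ℕ ℂ H) {Z : H →L[ℂ] H} (hZ : 0 ≤ Z) {s : ℝ} (hs : 0 < s) :
    trace e (power Z (s / 2) * Y * power Z (s / 2)) =
      ENNReal.ofReal (∑' i, expect (power Z s) (v i)) := by
  have := (h.map (power Z (s / 2))).trace_eq e
  rw [(isSelfAdjoint_power Z (s / 2)).star_eq] at this
  rw [this]
  simp_rw [expect_power hZ hs]

/-- The pairing `Tr [Z ^ s Y]` does not depend on the decomposition of `Y`. -/
theorem IsFrame.tsum_expect_power_eq {v : ι → H} {w : κ → H} {Y : H →L[ℂ] H} (hv : IsFrame v Y)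
    (hw : IsFrame w Y) (e : HilbertBasis ℕ ℂ H) {Z : H →L[ℂ] H} (hZ : 0 ≤ Z) {s : ℝ} (hs : 0 < s) :
    ∑' i, expect (power Z s) (v i) = ∑' i, expect (power Z s) (w i) := by
  have h1 := hv.trace_conj_power e hZ hs
  rw [hw.trace_conj_power e hZ hs] at h1
  exact ((ENNReal.ofReal_eq_ofReal_iff (tsum_nonneg fun i => expect_nonneg (power_nonneg hZ s) _)
    (tsum_nonneg fun i => expect_nonneg (power_nonneg hZ s) _)).1 h1).symm

/-- `Y ^ p` is `Y` between two copies of `Y ^ ((p - 1) / 2)`. The frame need not consist of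
eigenvectors, so the Kraus vectors of an output can be used to compute the trace of its power. -/
theorem IsFrame.trace_power {v : ι → H} {Y : H →L[ℂ] H} (h : IsFrame v Y)
    (e : HilbertBasis ℕ ℂ H) {p : ℝ} (hp : 1 < p) :
    trace e (power Y p) = ENNReal.ofReal (∑' i, expect (power Y (p - 1)) (v i)) := by
  have hY := h.nonneg
  have hp' : 0 < p - 1 := sub_pos.2 hp
  rw [← h.trace_conj_power e hY hp']
  congr 1
  conv_lhs => rw [show p = (p - 1) / 2 + 1 + (p - 1) / 2 by ring]
  rw [power_add hY (by linarith) (by linarith), power_add hY (by linarith) one_pos, power_one hY]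

theorem IsFrame.toReal_trace_power {v : ι → H} {Y : H →L[ℂ] H} (h : IsFrame v Y)
    (e : HilbertBasis ℕ ℂ H) {p : ℝ} (hp : 1 < p) :
    (trace e (power Y p)).toReal = ∑' i, expect (power Y (p - 1)) (v i) := by
  rw [h.trace_power e hp, ENNReal.toReal_ofReal]
  exact tsum_nonneg fun i => expect_nonneg (power_nonneg h.nonneg _) _

theorem IsFrame.trace_power_ne_top {v : ι → H} {Y : H →L[ℂ] H} (h : IsFrame v Y)
    (e : HilbertBasis ℕ ℂ H) {p : ℝ} (hp : 1 < p) : trace e (power Y p) ≠ ⊤ := by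
  rw [h.trace_power e hp]
  exact ENNReal.ofReal_ne_top

/-- A finite orthonormal family sees at most the trace. -/
theorem sum_expect_power_le_trace [Fintype ι] {φ : ι → H} (hφ : Orthonormal ℂ φ)
    (e : HilbertBasis ℕ ℂ H) {Z : H →L[ℂ] H} (hZ : 0 ≤ Z) {s : ℝ} (hs : 0 < s) :
    ENNReal.ofReal (∑ i, expect (power Z s) (φ i)) ≤ trace e (power Z s) := by
  set S := power Z (s / 2) with hS
  have hsymm : ∀ x y : H, inner ℂ x (S y) = inner ℂ (S x) y := fun x y => by
    rw [← ContinuousLinearMap.adjoint_inner_left, ← ContinuousLinearMap.star_eq_adjoint,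
      (isSelfAdjoint_power Z (s / 2)).star_eq]
  rw [trace_eq_tsum_expect, ENNReal.ofReal_sum_of_nonneg
    fun i _ => expect_nonneg (power_nonneg hZ s) _]
  simp_rw [expect_power hZ hs, ← hS]
  have h1 : ∀ i, ENNReal.ofReal (‖S (φ i)‖ ^ 2) =
      ∑' n, ENNReal.ofReal (‖inner ℂ (φ i) (S (e n))‖ ^ 2) := fun i => by
    rw [← (hasSum_norm_inner_sq e _).tsum_eq, ENNReal.ofReal_tsum_of_nonneg
      (fun i => by positivity) (hasSum_norm_inner_sq e _).summable]
    refine tsum_congr fun n => ?_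
    rw [hsymm, norm_inner_symm]
  simp_rw [h1]
  -- Exchanging the sums leaves, at each Fock state, a Bessel sum over `φ`.
  rw [← tsum_fintype (L := .unconditional ι), ENNReal.tsum_comm]
  refine ENNReal.tsum_le_tsum fun n => ?_
  rw [tsum_fintype, ← ENNReal.ofReal_sum_of_nonneg fun i _ => by positivity]
  exact ENNReal.ofReal_le_ofReal (hφ.sum_inner_products_le _)

theorem sum_expect_power_le_toReal_trace [Fintype ι] {φ : ι → H} (hφ : Orthonormal ℂ φ)
    (e : HilbertBasis ℕ ℂ H) {Z : H →L[ℂ] H} (hZ : 0 ≤ Z) {s : ℝ} (hs : 0 < s)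
    (hT : trace e (power Z s) ≠ ⊤) :
    ∑ i, expect (power Z s) (φ i) ≤ (trace e (power Z s)).toReal :=
  (ENNReal.ofReal_le_iff_le_toReal hT).1 (sum_expect_power_le_trace hφ e hZ hs)

/-- Hölder's inequality `Tr [Y ^ (p - 1) A] ≤ Tr [A ^ p] / p + (1 - 1 / p) Tr [Y ^ p]` for
`A = ∑ i, c i |φ i⟩⟨φ i|`. -/
theorem sum_expect_power_sub_one_le [Fintype ι] {φ : ι → H} (hφ : Orthonormal ℂ φ)
    (e : HilbertBasis ℕ ℂ H) {Z : H →L[ℂ] H} (hZ : 0 ≤ Z) {p : ℝ} (hp : 1 < p)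
    (hT : trace e (power Z p) ≠ ⊤) {c : ι → ℝ} (hc : ∀ i, 0 ≤ c i) :
    p * ∑ i, c i * expect (power Z (p - 1)) (φ i) ≤
      ∑ i, c i ^ p + (p - 1) * (trace e (power Z p)).toReal := by
  calc _ = ∑ i, p * (c i * expect (power Z (p - 1)) (φ i)) := Finset.mul_sum _ _ _
    _ ≤ ∑ i, (c i ^ p + (p - 1) * expect (power Z p) (φ i)) :=
        Finset.sum_le_sum fun i _ => expect_power_young hZ hp (hc i) (hφ.1 i)
    _ = ∑ i, c i ^ p + (p - 1) * ∑ i, expect (power Z p) (φ i) := by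
        rw [Finset.sum_add_distrib, Finset.mul_sum]
    _ ≤ _ := by
        have := sum_expect_power_le_toReal_trace hφ e hZ (zero_lt_one.trans hp) hT
        have hp' : 0 ≤ p - 1 := by linarith
        gcongr

/-- Convexity of `y ^ p` tested on a fixed orthonormal family: a lower bound on the trace that only
involves diagonal elements of `Z`. -/
theorem sum_tangent_le_toReal_trace [Fintype ι] {φ : ι → H} (hφ : Orthonormal ℂ φ)
    (e : HilbertBasis ℕ ℂ H) {Z : H →L[ℂ] H} (hZ : 0 ≤ Z) {p : ℝ} (hp : 1 < p)
    (hT : trace e (power Z p) ≠ ⊤) {c : ι → ℝ} (hc : ∀ i, 0 ≤ c i) :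
    ∑ i, c i ^ p + p * ∑ i, c i ^ (p - 1) * (expect Z (φ i) - c i) ≤
      (trace e (power Z p)).toReal := by
  refine le_trans ?_ (sum_expect_power_le_toReal_trace hφ e hZ (zero_lt_one.trans hp) hT)
  rw [Finset.mul_sum, ← Finset.sum_add_distrib]
  exact Finset.sum_le_sum fun i _ => expect_power_tangent hZ hp (hc i) (hφ.1 i)

/-- The operator `∑ i, c i |φ i⟩⟨φ i|`. -/
noncomputable def diagonal [Fintype ι] (φ : ι → H) (c : ι → ℝ) : H →L[ℂ] H :=
  ∑ i, (c i : ℂ) • rankOne ℂ (φ i) (φ i)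

theorem diagonal_apply_self [Fintype ι] {φ : ι → H} (hφ : Orthonormal ℂ φ) (c : ι → ℝ) (i : ι) :
    diagonal φ c (φ i) = (c i : ℂ) • φ i := by
  classical
  simp only [diagonal, sum_apply, smul_apply, rankOne_apply, orthonormal_iff_ite.1 hφ]
  simp

theorem diagonal_apply [Fintype ι] (φ : ι → H) (c : ι → ℝ) (x : H) :
    diagonal φ c x = ∑ i, ((c i : ℂ) * inner ℂ (φ i) x) • φ i := by
  simp only [diagonal, sum_apply, smul_apply, rankOne_apply, smul_smul]

theorem isFrame_diagonal [Fintype ι] (φ : ι → H) {c : ι → ℝ} (hc : ∀ i, 0 ≤ c i) :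
    IsFrame (fun i => (Real.sqrt (c i) : ℂ) • φ i) (diagonal φ c) := by
  refine ⟨Summable.of_finite, (hasSum_fintype _).congr_fun fun i => ?_⟩
  simp only [map_smulₛₗ, smul_apply, smul_smul, Complex.conj_ofReal, RingHom.id_apply]
  rw [← Complex.ofReal_mul, Real.mul_self_sqrt (hc i)]

theorem diagonal_nonneg [Fintype ι] (φ : ι → H) {c : ι → ℝ} (hc : ∀ i, 0 ≤ c i) :
    0 ≤ diagonal φ c := (isFrame_diagonal φ hc).nonneg

theorem isSelfAdjoint_diagonal [Fintype ι] (φ : ι → H) (c : ι → ℝ) :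
    IsSelfAdjoint (diagonal φ c) := by
  rw [isSelfAdjoint_iff, diagonal, star_sum]
  refine Finset.sum_congr rfl fun i _ => ?_
  rw [star_smul, ContinuousLinearMap.star_eq_adjoint, adjoint_rankOne]
  simp

theorem ext_of_orthonormal [Fintype ι] {φ : ι → H} (hφ : Orthonormal ℂ φ) {S T : H →L[ℂ] H}
    (h1 : ∀ i, S (φ i) = T (φ i)) (h2 : ∀ x, (∀ i, inner ℂ (φ i) x = 0) → S x = T x) : S = T := by
  classical
  ext x
  have hx : x = ∑ i, inner ℂ (φ i) x • φ i + (x - ∑ i, inner ℂ (φ i) x • φ i) := by abel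
  have hperp := h2 (x - ∑ i, inner ℂ (φ i) x • φ i) fun i => by
    simp only [inner_sub_right, inner_sum, inner_smul_right, orthonormal_iff_ite.1 hφ]
    simp
  rw [hx, map_add, map_add, hperp, map_sum, map_sum]
  simp only [map_smul, h1]

/-- `diagonal φ c` vanishes on the orthogonal complement of `φ`, hence the condition `f 0 = 0`. -/
theorem cfc_diagonal [Fintype ι] {φ : ι → H} (hφ : Orthonormal ℂ φ) (c : ι → ℝ) {f : ℝ → ℝ}
    (hf : Continuous f) (hf0 : f 0 = 0) :
    cfc f (diagonal φ c) = diagonal φ (fun i => f (c i)) := by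
  refine ext_of_orthonormal hφ (fun i => ?_) fun x hx => ?_
  · rw [cfc_apply_of_eigenvector hf (isSelfAdjoint_diagonal φ c) (diagonal_apply_self hφ c i),
      diagonal_apply_self hφ]
  · rw [cfc_apply_of_eigenvector hf (isSelfAdjoint_diagonal φ c) (c := 0), hf0, diagonal_apply]
    · simp [hx]
    · rw [diagonal_apply]
      simp [hx]

theorem power_diagonal [Fintype ι] {φ : ι → H} (hφ : Orthonormal ℂ φ) (c : ι → ℝ) {s : ℝ}
    (hs : 0 < s) : power (diagonal φ c) s = diagonal φ (fun i => c i ^ s) :=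
  cfc_diagonal hφ c (continuous_rpow_of_pos hs) (Real.zero_rpow hs.ne')

theorem expect_diagonal [Fintype ι] (φ : ι → H) (c : ι → ℝ) (x : H) :
    expect (diagonal φ c) x = ∑ i, c i * ‖inner ℂ (φ i) x‖ ^ 2 := by
  rw [expect, diagonal, sum_apply, inner_sum, Complex.re_sum]
  refine Finset.sum_congr rfl fun i _ => ?_
  rw [smul_apply, inner_smul_right, Complex.re_ofReal_mul]
  congr 1
  rw [norm_inner_symm]
  exact expect_rankOne (φ i) x

theorem trace_diagonal [Fintype ι] {φ : ι → H} (hφ : Orthonormal ℂ φ) {c : ι → ℝ}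
    (hc : ∀ i, 0 ≤ c i) (e : HilbertBasis ℕ ℂ H) :
    trace e (diagonal φ c) = ENNReal.ofReal (∑ i, c i) := by
  rw [(isFrame_diagonal φ hc).trace_eq e, tsum_fintype]
  congr 1
  refine Finset.sum_congr rfl fun i _ => ?_
  rw [norm_smul, hφ.1 i, mul_one, Complex.norm_real, Real.norm_eq_abs, sq_abs, Real.sq_sqrt (hc i)]

/-- A positive operator of finite rank is diagonal in an orthonormal family, with positive
eigenvalues in decreasing order. -/
theorem exists_eq_diagonal {X : H →L[ℂ] H} (hX : 0 ≤ X)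
    [FiniteDimensional ℂ (LinearMap.range X.toLinearMap)] :
    ∃ (r : ℕ) (φ : Fin r → H) (c : Fin r → ℝ), Orthonormal ℂ φ ∧ (∀ i, 0 < c i) ∧ Antitone c ∧
      X = diagonal φ c := by
  set U := LinearMap.range X.toLinearMap with hU
  have hpos := (ContinuousLinearMap.nonneg_iff_isPositive X).1 hX
  have hsymm : X.toLinearMap.IsSymmetric := hpos.isSymmetric
  have hmaps : ∀ v ∈ U, X.toLinearMap v ∈ U := fun v _ => LinearMap.mem_range_self _ v
  have hT := hsymm.restrict_invariant hmaps
  set b := hT.eigenvectorBasis rfl with hb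
  set c := hT.eigenvalues rfl with hcdef
  have horth : Orthonormal ℂ fun i => (b i : H) :=
    b.orthonormal.comp_linearIsometry U.subtypeₗᵢ
  have hXb : ∀ i, X (b i) = (c i : ℂ) • (b i : H) := fun i => by
    have := hT.apply_eigenvectorBasis rfl i
    exact congrArg Subtype.val this
  have hXperp : ∀ x, (∀ i, inner ℂ (b i : H) x = 0) → X x = 0 := by
    intro x hx
    have h1 : ∀ y ∈ U, inner ℂ y x = 0 := by
      intro y hy
      have : y = ∑ i, b.repr ⟨y, hy⟩ i • (b i : H) := by
        have := congrArg Subtype.val (b.sum_repr ⟨y, hy⟩)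
        simpa using this.symm
      rw [this, sum_inner]
      exact Finset.sum_eq_zero fun i _ => by rw [inner_smul_left, hx, mul_zero]
    have h2 : inner ℂ (X x) (X x) = 0 := by
      have : inner ℂ (X x) (X x) = inner ℂ (X (X x)) x := (hsymm _ _).symm
      rw [this]
      exact h1 _ (LinearMap.mem_range_self X.toLinearMap (X x))
    exact inner_self_eq_zero.1 h2
  refine ⟨_, fun i => (b i : H), c, horth, fun i => ?_, hT.eigenvalues_antitone rfl, ?_⟩
  · have h0 : 0 ≤ c i := by
      have := expect_nonneg hX (b i : H)
      rw [expect, hXb, inner_smul_right, inner_self_eq_norm_sq_to_K, horth.1 i] at this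
      simpa using this
    -- Eigenvectors are taken inside the range, so `b i = X y`; a zero eigenvalue would give `⟨b i,
    -- b i⟩ = ⟨y, X (b i)⟩ = 0`.
    refine h0.lt_of_ne fun h => ?_
    obtain ⟨y, hy⟩ := (b i).2
    have hy' : X y = (b i : H) := hy
    have h1 : inner ℂ (b i : H) (b i : H) = 0 := by
      nth_rewrite 1 [← hy']
      have : inner ℂ (X y) (b i : H) = inner ℂ y (X (b i)) := hsymm _ _
      rw [this, hXb, ← h]
      simp
    exact horth.ne_zero i (inner_self_eq_zero.1 h1)
  · refine ext_of_orthonormal horth (fun i => ?_) fun x hx => ?_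
    · rw [hXb, diagonal_apply_self horth]
    · rw [hXperp x hx, diagonal_apply]
      simp [hx]

end Frames

/-! ### Kraus operators of the attenuator and loss probabilities -/

theorem hasSum_swap_of_nonneg {α β : Type*} {f : α → β → ℝ} {s : α → ℝ} (hf : ∀ a b, 0 ≤ f a b)
    (h : ∀ a, HasSum (f a) (s a)) (hs : Summable s) :
    (∀ b, Summable fun a => f a b) ∧ HasSum (fun b => ∑' a, f a b) (∑' a, s a) := by
  have h1 : Summable (fun x : α × β => f x.1 x.2) :=
    (summable_prod_of_nonneg fun x => hf x.1 x.2).2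
      ⟨fun a => (h a).summable, hs.congr fun a => ((h a).tsum_eq).symm⟩
  have h2 : Summable (fun x : β × α => f x.2 x.1) := (Equiv.prodComm β α).summable_iff.2 h1
  refine ⟨fun b => h2.prod_factor b, ?_⟩
  have h3 : ∑' a, s a = ∑' x : β × α, f x.2 x.1 := by
    rw [tsum_congr fun a => ((h a).tsum_eq).symm, ← h1.tsum_prod]
    exact ((Equiv.prodComm β α).tsum_eq (fun x : α × β => f x.1 x.2)).symm
  rw [h3]
  exact h2.hasSum.prod_fiberwise fun b => (h2.prod_factor b).hasSum

section Kraus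

variable {H : Type*} [NormedAddCommGroup H] [InnerProductSpace ℂ H] [CompleteSpace H]

theorem memℓp_weightedShift (e : HilbertBasis ℕ ℂ H) (k : ℕ) {c : ℕ → ℝ} (hc : ∀ m, |c m| ≤ 1)
    (x : H) : Memℓp (fun m => (c m : ℂ) * e.repr x (m + k)) 2 := by
  refine memℓp_gen ?_
  have h1 : Summable fun n => ‖e.repr x n‖ ^ (2 : ℝ) := by
    simpa using (lp.hasSum_norm (by simp) (e.repr x)).summable
  have h2 := (summable_nat_add_iff k).2 h1
  simp only [ENNReal.toReal_ofNat]
  refine Summable.of_nonneg_of_le (fun m => by positivity) (fun m => ?_) h2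
  refine Real.rpow_le_rpow (norm_nonneg _) ?_ (by norm_num)
  rw [norm_mul, Complex.norm_real, Real.norm_eq_abs]
  exact mul_le_of_le_one_left (norm_nonneg _) (hc m)

/-- The operator `∑ m, c m |m⟩⟨m + k|` as a linear map. -/
noncomputable def weightedShiftLinear (e : HilbertBasis ℕ ℂ H) (k : ℕ) (c : ℕ → ℝ)
    (hc : ∀ m, |c m| ≤ 1) : H →ₗ[ℂ] H where
  toFun x := e.repr.symm ⟨fun m => (c m : ℂ) * e.repr x (m + k), memℓp_weightedShift e k hc x⟩
  map_add' x y := by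
    rw [← map_add]
    congr 1
    ext m
    simp only [map_add, lp.coeFn_add, Pi.add_apply, mul_add]
  map_smul' z x := by
    rw [RingHom.id_apply, ← map_smul]
    congr 1
    ext m
    simp
    ring

theorem inner_weightedShiftLinear (e : HilbertBasis ℕ ℂ H) (k : ℕ) {c : ℕ → ℝ}
    (hc : ∀ m, |c m| ≤ 1) (m : ℕ) (x : H) :
    inner ℂ (e m) (weightedShiftLinear e k c hc x) = c m * inner ℂ (e (m + k)) x := by
  rw [← e.repr_apply_apply, ← e.repr_apply_apply]
  simp [weightedShiftLinear]

theorem norm_weightedShiftLinear_le (e : HilbertBasis ℕ ℂ H) (k : ℕ) {c : ℕ → ℝ}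
    (hc : ∀ m, |c m| ≤ 1) (x : H) : ‖weightedShiftLinear e k c hc x‖ ≤ 1 * ‖x‖ := by
  rw [one_mul]
  refine (sq_le_sq₀ (by positivity) (norm_nonneg _)).1 ?_
  have h1 := hasSum_norm_inner_sq e (weightedShiftLinear e k c hc x)
  have h2 := hasSum_norm_inner_sq e x
  have h3 := (summable_nat_add_iff k).2 h2.summable
  rw [← h1.tsum_eq, ← h2.tsum_eq]
  calc _ ≤ ∑' m, ‖inner ℂ (e (m + k)) x‖ ^ 2 := by
        refine h1.summable.tsum_le_tsum (fun m => ?_) h3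
        rw [inner_weightedShiftLinear, norm_mul, Complex.norm_real, Real.norm_eq_abs]
        exact pow_le_pow_left₀ (by positivity) (mul_le_of_le_one_left (norm_nonneg _) (hc m)) 2
    _ ≤ _ := by
        rw [← h2.summable.sum_add_tsum_nat_add k]
        have : 0 ≤ ∑ i ∈ Finset.range k, ‖inner ℂ (e i) x‖ ^ 2 :=
          Finset.sum_nonneg fun i _ => by positivity
        linarith

open Classical in
/-- The operator `∑ m, c m |m⟩⟨m + k|`, for coefficients bounded by `1`. -/
noncomputable def weightedShift (e : HilbertBasis ℕ ℂ H) (k : ℕ) (c : ℕ → ℝ) : H →L[ℂ] H :=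
  if hc : ∀ m, |c m| ≤ 1 then
    (weightedShiftLinear e k c hc).mkContinuous 1 (norm_weightedShiftLinear_le e k hc)
  else 0

theorem inner_weightedShift (e : HilbertBasis ℕ ℂ H) (k : ℕ) {c : ℕ → ℝ} (hc : ∀ m, |c m| ≤ 1)
    (m : ℕ) (x : H) :
    inner ℂ (e m) (weightedShift e k c x) = c m * inner ℂ (e (m + k)) x := by
  rw [weightedShift, dif_pos hc]
  exact inner_weightedShiftLinear e k hc m x

/-- The amplitude for losing `k` of `n` photons, when each is transmitted with amplitude `q`. -/
noncomputable def lossAmp (q : ℝ) (n k : ℕ) : ℝ :=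
  Real.sqrt (n.choose k) * Real.sqrt (1 - q ^ 2) ^ k * q ^ (n - k)

theorem lossAmp_sq {q : ℝ} (hq0 : 0 ≤ q) (hq1 : q ≤ 1) (n k : ℕ) :
    lossAmp q n k ^ 2 = n.choose k * (1 - q ^ 2) ^ k * (q ^ 2) ^ (n - k) := by
  have h : 0 ≤ 1 - q ^ 2 := by nlinarith
  rw [lossAmp, mul_pow, mul_pow, Real.sq_sqrt (Nat.cast_nonneg _), ← pow_mul, mul_comm k 2, pow_mul,
    Real.sq_sqrt h, ← pow_mul, ← pow_mul, mul_comm (n - k) 2]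

theorem lossAmp_of_lt (q : ℝ) {n k : ℕ} (h : n < k) : lossAmp q n k = 0 := by
  simp [lossAmp, Nat.choose_eq_zero_of_lt h]

theorem lossAmp_zero (q : ℝ) (n : ℕ) : lossAmp q n 0 = q ^ n := by simp [lossAmp]

/-- The binomial theorem for `(1 - q²) + q² = 1`; it yields `∑ K_k† K_k = 1`. -/
theorem hasSum_lossAmp_sq {q : ℝ} (hq0 : 0 ≤ q) (hq1 : q ≤ 1) (n : ℕ) :
    HasSum (fun k => lossAmp q n k ^ 2) 1 := by
  have h : ∑ k ∈ Finset.range (n + 1), lossAmp q n k ^ 2 = 1 := by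
    have := add_pow (1 - q ^ 2) (q ^ 2) n
    rw [sub_add_cancel, one_pow] at this
    rw [this]
    refine Finset.sum_congr rfl fun k _ => ?_
    rw [lossAmp_sq hq0 hq1]
    ring
  rw [← h]
  refine hasSum_sum_of_ne_finset_zero fun k hk => ?_
  rw [lossAmp_of_lt q (by simpa [Nat.lt_succ_iff] using hk)]
  simp

theorem lossAmp_le_one {q : ℝ} (hq0 : 0 ≤ q) (hq1 : q ≤ 1) (n k : ℕ) : |lossAmp q n k| ≤ 1 := by
  have := le_hasSum (hasSum_lossAmp_sq hq0 hq1 n) k fun j _ => sq_nonneg _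
  exact (sq_le_one_iff_abs_le_one _).1 this

/-- The negative binomial series: here the number `m` of surviving photons is fixed. It yields `∑
K_k K_k† = q⁻²`, and the excess `q⁻² - 1` plays the part of the commutator of `a` and `a†`. -/
theorem hasSum_lossAmp_add_sq {q : ℝ} (hq0 : 0 < q) (hq1 : q ≤ 1) (m : ℕ) :
    HasSum (fun k => lossAmp q (m + k) k ^ 2) ((q ^ 2)⁻¹) := by
  have hq2 : 0 < q ^ 2 := by positivity
  have hr : ‖1 - q ^ 2‖ < 1 := by
    rw [Real.norm_eq_abs, abs_lt]; constructor <;> nlinarith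
  have h1 := (hasSum_choose_mul_geometric_of_norm_lt_one m hr).mul_right ((q ^ 2) ^ m)
  have h2 : 1 / (1 - (1 - q ^ 2)) ^ (m + 1) * (q ^ 2) ^ m = (q ^ 2)⁻¹ := by
    rw [sub_sub_cancel, pow_succ]
    field_simp
  rw [h2] at h1
  refine h1.congr_fun fun k => ?_
  rw [lossAmp_sq hq0.le hq1, Nat.add_sub_cancel, add_comm m k, Nat.choose_symm_add]

/-- The Kraus operators of the attenuator with transmissivity `q ^ 2`. -/
noncomputable def kraus (e : HilbertBasis ℕ ℂ H) (q : ℝ) (k : ℕ) : H →L[ℂ] H :=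
  weightedShift e k fun m => lossAmp q (m + k) k

theorem inner_kraus (e : HilbertBasis ℕ ℂ H) {q : ℝ} (hq0 : 0 ≤ q) (hq1 : q ≤ 1) (k m : ℕ) (x : H) :
    inner ℂ (e m) (kraus e q k x) = lossAmp q (m + k) k * inner ℂ (e (m + k)) x :=
  inner_weightedShift e k (fun _ => lossAmp_le_one hq0 hq1 _ _) m x

theorem ext_inner_basis (e : HilbertBasis ℕ ℂ H) {x y : H}
    (h : ∀ m, inner ℂ (e m) x = inner ℂ (e m) y) : x = y := by
  refine e.repr.injective ?_
  ext m
  rw [e.repr_apply_apply, e.repr_apply_apply, h]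

theorem inner_basis (e : HilbertBasis ℕ ℂ H) (m n : ℕ) :
    inner ℂ (e m) (e n) = if m = n then (1 : ℂ) else 0 := by
  classical
  exact orthonormal_iff_ite.1 e.orthonormal m n

theorem kraus_basis (e : HilbertBasis ℕ ℂ H) {q : ℝ} (hq0 : 0 ≤ q) (hq1 : q ≤ 1) (k n : ℕ) :
    kraus e q k (e n) = (lossAmp q n k : ℂ) • e (n - k) := by
  refine ext_inner_basis e fun m => ?_
  rw [inner_kraus e hq0 hq1, inner_smul_right, inner_basis, inner_basis]
  by_cases h : m + k = n
  · subst h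
    simp
  · rw [if_neg h]
    rcases lt_or_ge n k with hk | hk
    · rw [lossAmp_of_lt q hk]; simp
    · rw [if_neg (by omega)]; simp

theorem hasSum_norm_kraus_sq (e : HilbertBasis ℕ ℂ H) {q : ℝ} (hq0 : 0 ≤ q) (hq1 : q ≤ 1) (k : ℕ)
    (x : H) : HasSum (fun n => lossAmp q n k ^ 2 * ‖inner ℂ (e n) x‖ ^ 2) (‖kraus e q k x‖ ^ 2) := by
  have h := hasSum_norm_inner_sq e (kraus e q k x)
  rw [← hasSum_nat_add_iff' k]
  rw [Finset.sum_eq_zero, sub_zero]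
  · refine h.congr_fun fun m => ?_
    rw [inner_kraus e hq0 hq1, norm_mul, mul_pow, Complex.norm_real, Real.norm_eq_abs, sq_abs]
  · intro n hn
    rw [lossAmp_of_lt q (Finset.mem_range.1 hn)]
    simp

/-- The attenuator preserves the trace. -/
theorem hasSum_norm_kraus_sq_index (e : HilbertBasis ℕ ℂ H) {q : ℝ} (hq0 : 0 ≤ q) (hq1 : q ≤ 1)
    (x : H) : HasSum (fun k => ‖kraus e q k x‖ ^ 2) (‖x‖ ^ 2) := by
  have hx := hasSum_norm_inner_sq e x
  have h := (hasSum_swap_of_nonneg (f := fun n k => lossAmp q n k ^ 2 * ‖inner ℂ (e n) x‖ ^ 2)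
    (fun n k => by positivity) (fun n => (hasSum_lossAmp_sq hq0 hq1 n).mul_right _)
    (by simpa using hx.summable)).2
  simp only [one_mul, hx.tsum_eq] at h
  exact h.congr_fun fun k => ((hasSum_norm_kraus_sq e hq0 hq1 k x).tsum_eq).symm

theorem hasSum_norm_adjoint_kraus_sq (e : HilbertBasis ℕ ℂ H) {q : ℝ} (hq0 : 0 ≤ q) (hq1 : q ≤ 1)
    (k : ℕ) (x : H) : HasSum (fun m => lossAmp q (m + k) k ^ 2 * ‖inner ℂ (e m) x‖ ^ 2)
      (‖star (kraus e q k) x‖ ^ 2) := by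
  have h := hasSum_norm_inner_sq e (star (kraus e q k) x)
  have h1 : ∀ n, ‖inner ℂ (e n) (star (kraus e q k) x)‖ ^ 2 =
      lossAmp q n k ^ 2 * ‖inner ℂ (e (n - k)) x‖ ^ 2 := fun n => by
    rw [ContinuousLinearMap.star_eq_adjoint, ContinuousLinearMap.adjoint_inner_right,
      kraus_basis e hq0 hq1, inner_smul_left, norm_mul, mul_pow, Complex.norm_conj,
      Complex.norm_real, Real.norm_eq_abs, sq_abs]
  simp_rw [h1] at h
  rw [← hasSum_nat_add_iff' k, Finset.sum_eq_zero, sub_zero] at h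
  · simpa using h
  · intro n hn
    rw [lossAmp_of_lt q (Finset.mem_range.1 hn)]
    simp

theorem hasSum_norm_adjoint_kraus_sq_index (e : HilbertBasis ℕ ℂ H) {q : ℝ} (hq0 : 0 < q)
    (hq1 : q ≤ 1) (x : H) :
    HasSum (fun k => ‖star (kraus e q k) x‖ ^ 2) ((q ^ 2)⁻¹ * ‖x‖ ^ 2) := by
  have hx := hasSum_norm_inner_sq e x
  have h := (hasSum_swap_of_nonneg
    (f := fun m k => lossAmp q (m + k) k ^ 2 * ‖inner ℂ (e m) x‖ ^ 2)
    (fun n k => by positivity) (fun n => (hasSum_lossAmp_add_sq hq0 hq1 n).mul_right _)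
    (hx.summable.mul_left _)).2
  rw [tsum_mul_left, hx.tsum_eq] at h
  exact h.congr_fun fun k => ((hasSum_norm_adjoint_kraus_sq e hq0.le hq1 k x).tsum_eq).symm

/-- The probability that a photon is lost, for a state with transmission amplitude `q`. -/
noncomputable def lossProb (e : HilbertBasis ℕ ℂ H) (q : ℝ) (x : H) : ℝ :=
  ∑' n, (1 - (q ^ 2) ^ n) * ‖inner ℂ (e n) x‖ ^ 2

theorem hasSum_lossProb (e : HilbertBasis ℕ ℂ H) {q : ℝ} (hq0 : 0 ≤ q) (hq1 : q ≤ 1) (x : H) :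
    HasSum (fun n => (1 - (q ^ 2) ^ n) * ‖inner ℂ (e n) x‖ ^ 2) (lossProb e q x) := by
  refine Summable.hasSum (Summable.of_nonneg_of_le (fun n => ?_) (fun n => ?_)
    (hasSum_norm_inner_sq e x).summable)
  · have : (q ^ 2) ^ n ≤ 1 := pow_le_one₀ (by positivity) (pow_le_one₀ hq0 hq1)
    exact mul_nonneg (by linarith) (by positivity)
  · have : 0 ≤ (q ^ 2) ^ n := by positivity
    exact mul_le_of_le_one_left (by positivity) (by linarith)

theorem norm_kraus_zero_sq (e : HilbertBasis ℕ ℂ H) {q : ℝ} (hq0 : 0 ≤ q) (hq1 : q ≤ 1) (x : H) :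
    ‖kraus e q 0 x‖ ^ 2 = ‖x‖ ^ 2 - lossProb e q x := by
  have h := (hasSum_norm_inner_sq e x).sub (hasSum_lossProb e hq0 hq1 x)
  refine (hasSum_norm_kraus_sq e hq0 hq1 0 x).unique (h.congr_fun fun n => ?_)
  rw [lossAmp_zero]
  ring

/-- Trace preservation minus its `k = 0` term. The identity holds at infinite energy too. -/
theorem hasSum_norm_kraus_succ_sq (e : HilbertBasis ℕ ℂ H) {q : ℝ} (hq0 : 0 ≤ q) (hq1 : q ≤ 1)
    (x : H) : HasSum (fun k => ‖kraus e q (k + 1) x‖ ^ 2) (lossProb e q x) := by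
  have := (hasSum_nat_add_iff' 1).2 (hasSum_norm_kraus_sq_index e hq0 hq1 x)
  simpa [norm_kraus_zero_sq e hq0 hq1] using this

theorem inner_kraus_zero (e : HilbertBasis ℕ ℂ H) {q : ℝ} (hq0 : 0 ≤ q) (hq1 : q ≤ 1) (m : ℕ)
    (x : H) : inner ℂ (e m) (kraus e q 0 x) = ((q ^ m : ℝ) : ℂ) * inner ℂ (e m) x := by
  rw [inner_kraus e hq0 hq1, add_zero, lossAmp_zero]

theorem isSelfAdjoint_kraus_zero (e : HilbertBasis ℕ ℂ H) {q : ℝ} (hq0 : 0 ≤ q) (hq1 : q ≤ 1) :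
    IsSelfAdjoint (kraus e q 0) := by
  rw [isSelfAdjoint_iff]
  ext x
  refine ext_inner_basis e fun m => ?_
  rw [inner_kraus_zero e hq0 hq1, ContinuousLinearMap.star_eq_adjoint,
    ContinuousLinearMap.adjoint_inner_right, kraus_basis e hq0 hq1, inner_smul_left, lossAmp_zero,
    Complex.conj_ofReal, Nat.sub_zero]

/-- `K₀` is self-adjoint, so the `k = 0` term is the same as in `∑ K_k† K_k`, and the two tails
differ exactly by `(q⁻² - 1) ‖x‖²`. -/
theorem hasSum_norm_adjoint_kraus_succ_sq (e : HilbertBasis ℕ ℂ H) {q : ℝ} (hq0 : 0 < q)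
    (hq1 : q ≤ 1) (x : H) : HasSum (fun k => ‖star (kraus e q (k + 1)) x‖ ^ 2)
      (((q ^ 2)⁻¹ - 1) * ‖x‖ ^ 2 + lossProb e q x) := by
  have := (hasSum_nat_add_iff' 1).2 (hasSum_norm_adjoint_kraus_sq_index e hq0 hq1 x)
  rw [Finset.sum_range_one, (isSelfAdjoint_kraus_zero e hq0.le hq1).star_eq,
    norm_kraus_zero_sq e hq0.le hq1] at this
  have h2 : (q ^ 2)⁻¹ * ‖x‖ ^ 2 - (‖x‖ ^ 2 - lossProb e q x) =
      ((q ^ 2)⁻¹ - 1) * ‖x‖ ^ 2 + lossProb e q x := by ring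
  rwa [h2] at this

theorem lossProb_nonneg (e : HilbertBasis ℕ ℂ H) {q : ℝ} (hq0 : 0 ≤ q) (hq1 : q ≤ 1) (x : H) :
    0 ≤ lossProb e q x :=
  (hasSum_norm_kraus_succ_sq e hq0 hq1 x).nonneg fun _ => by positivity

/-- Termwise `(1 - q^n)² ≤ 1 - q^{2n}`. -/
theorem norm_sub_kraus_zero_sq_le (e : HilbertBasis ℕ ℂ H) {q : ℝ} (hq0 : 0 ≤ q) (hq1 : q ≤ 1)
    (x : H) : ‖kraus e q 0 x - x‖ ^ 2 ≤ lossProb e q x := by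
  refine hasSum_le (fun n => ?_) (hasSum_norm_inner_sq e _) (hasSum_lossProb e hq0 hq1 x)
  have h1 : inner ℂ (e n) (kraus e q 0 x - x) = ((q ^ n - 1 : ℝ) : ℂ) * inner ℂ (e n) x := by
    rw [inner_sub_right, inner_kraus_zero e hq0 hq1]
    push_cast
    ring
  rw [h1, norm_mul, mul_pow, Complex.norm_real, Real.norm_eq_abs, sq_abs, ← pow_mul, mul_comm 2 n,
    pow_mul]
  have h2 : q ^ n ≤ 1 := pow_le_one₀ hq0 hq1
  have h3 : 0 ≤ q ^ n := by positivity
  gcongr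
  nlinarith

end Kraus

/-! ### The semigroup in Kraus form -/

/-- Uniqueness for a linear differential equation: `e^{-tG} f(t)` has zero derivative. -/
theorem eq_exp_smul_apply {B : Type*} [NormedAddCommGroup B] [NormedSpace ℂ B] [CompleteSpace B]
    (G : B →L[ℂ] B) {f : ℂ → B} (hf : ∀ t, HasDerivAt f (G (f t)) t) (t : ℂ) :
    f t = NormedSpace.exp (t • G) (f 0) := by
  have hneg : ∀ t : ℂ, HasDerivAt (fun u : ℂ => NormedSpace.exp (u • -G) (f u)) 0 t := fun t => by
    have h1 := hasDerivAt_exp_smul_const (𝕂 := ℂ) (-G) t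
    have h2 := h1.clm_apply (hf t)
    convert h2 using 1
    simp
  have hconst := is_const_of_deriv_eq_zero (fun t => (hneg t).differentiableAt)
    (fun t => (hneg t).deriv) t 0
  simp only [zero_smul, NormedSpace.exp_zero, one_apply_eq_self] at hconst
  have hcomm : Commute (t • G) (t • -G) :=
    ((Commute.refl G).neg_right.smul_left t).smul_right t
  have hbound : ∀ A : B →L[ℂ] B, A ∈ Metric.eball (0 : B →L[ℂ] B)
      (NormedSpace.expSeries ℂ (B →L[ℂ] B)).radius := fun A => by
    rw [NormedSpace.expSeries_radius_eq_top]; exact edist_lt_top A 0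
  rw [← hconst, ← mul_apply_eq_comp, ← NormedSpace.exp_add_of_commute_of_mem_ball (𝕂 := ℂ) hcomm
    (hbound _) (hbound _), smul_neg, add_neg_cancel, NormedSpace.exp_zero, one_apply_eq_self]

section Semigroup

variable {H : Type*} [NormedAddCommGroup H] [InnerProductSpace ℂ H] [CompleteSpace H]

theorem fockProj_apply (e : HilbertBasis ℕ ℂ H) (N : ℕ) (x : H) :
    fockProj e N x = ∑ n ∈ Finset.range (N + 1), inner ℂ (e n) x • e n := by
  simp [fockProj]

theorem ladder_basis (e : HilbertBasis ℕ ℂ H) {N n : ℕ} (hn : n ≤ N) :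
    ladder e N (e n) = (Real.sqrt n : ℂ) • e (n - 1) := by
  simp only [ladder, sum_apply, smul_apply, rankOne_apply, inner_basis]
  cases n with
  | zero => simp
  | succ n =>
    rw [Finset.sum_eq_single n]
    · simp
    · intro b _ hb
      rw [if_neg (by omega)]; simp
    · intro h
      exact absurd (Finset.mem_range.2 hn) h

theorem star_ladder_basis (e : HilbertBasis ℕ ℂ H) {N n : ℕ} (hn : n < N) :
    star (ladder e N) (e n) = (Real.sqrt (n + 1) : ℂ) • e (n + 1) := by
  simp only [ladder, star_sum, star_smul, ContinuousLinearMap.star_eq_adjoint, adjoint_rankOne,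
    sum_apply, smul_apply, rankOne_apply, inner_basis]
  rw [Finset.sum_eq_single n]
  · simp
  · intro b _ hb
    rw [if_neg hb]; simp
  · intro h
    exact absurd (Finset.mem_range.2 hn) h

theorem star_ladder_mul_ladder_basis (e : HilbertBasis ℕ ℂ H) {N n : ℕ} (hn : n ≤ N) :
    (star (ladder e N) * ladder e N) (e n) = (n : ℂ) • e n := by
  rw [mul_apply_eq_comp, ladder_basis e hn, map_smul]
  cases n with
  | zero => simp
  | succ n =>
    rw [Nat.add_sub_cancel, star_ladder_basis e (by omega), smul_smul, ← Complex.ofReal_mul]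
    norm_cast
    rw [Nat.cast_succ, Real.mul_self_sqrt (by positivity)]
    norm_cast

theorem mul_rankOne (S : H →L[ℂ] H) (x y : H) : S * rankOne ℂ x y = rankOne ℂ (S x) y := by
  ext z; simp

theorem rankOne_mul (S : H →L[ℂ] H) (x y : H) :
    rankOne ℂ x y * S = rankOne ℂ x (star S y) := by
  ext z; simp [ContinuousLinearMap.star_eq_adjoint, ContinuousLinearMap.adjoint_inner_left]

theorem generator_rankOne (e : HilbertBasis ℕ ℂ H) {N n m : ℕ} (hn : n ≤ N) (hm : m ≤ N) :
    generator e N (rankOne ℂ (e n) (e m)) =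
      ((Real.sqrt n * Real.sqrt m : ℝ) : ℂ) • rankOne ℂ (e (n - 1)) (e (m - 1))
        - ((n + m) / 2 : ℂ) • rankOne ℂ (e n) (e m) := by
  simp only [generator, lindblad, sub_apply, smul_apply, add_apply,
    ContinuousLinearMap.mulLeftRight_apply, ContinuousLinearMap.mul_apply',
    ContinuousLinearMap.flip_apply]
  rw [mul_rankOne, rankOne_mul, mul_rankOne, rankOne_mul, star_star, star_mul, star_star,
    star_ladder_mul_ladder_basis e hn, star_ladder_mul_ladder_basis e hm, ladder_basis e hn,
    ladder_basis e hm]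
  simp only [map_smulₛₗ, smul_apply, smul_smul, Complex.conj_ofReal, RingHom.id_apply,
    Complex.ofReal_mul, map_natCast, ← add_smul]
  congr 2
  · ring
  · ring

/-- The coefficient of `|n - k⟩⟨m - k|` in `e^{tℒ}(|n⟩⟨m|)`. -/
noncomputable def lossCoeff (n m k : ℕ) (t : ℂ) : ℂ :=
  ((Real.sqrt (n.choose k) * Real.sqrt (m.choose k) : ℝ) : ℂ) * (1 - Complex.exp (-t)) ^ k *
    Complex.exp (-t / 2) ^ ((n - k) + (m - k))

/-- In the gain term, `e^{-t}` is absorbed into the exponent as `(e^{-t/2})²`; in this form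
`lossCoeff_succ_mul` recognises it as fed by the previous coefficient. -/
theorem hasDerivAt_lossCoeff (n m k : ℕ) (t : ℂ) :
    HasDerivAt (lossCoeff n m k)
      (((Real.sqrt (n.choose k) * Real.sqrt (m.choose k) : ℝ) : ℂ) *
        (k * (1 - Complex.exp (-t)) ^ (k - 1)) *
          Complex.exp (-t / 2) ^ ((n - k) + (m - k) + 2) -
        ((((n - k : ℕ) + (m - k : ℕ) : ℕ) : ℂ) / 2) * lossCoeff n m k t) t := by
  have h1 : HasDerivAt (fun t : ℂ => 1 - Complex.exp (-t)) (Complex.exp (-t)) t := by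
    simpa using ((hasDerivAt_id t).neg.cexp).const_sub 1
  have h2 : HasDerivAt (fun t : ℂ => Complex.exp (-t / 2)) (Complex.exp (-t / 2) * (-1 / 2)) t :=
    ((hasDerivAt_id t).neg.div_const 2).cexp
  have h3 := ((h1.pow k).const_mul
    ((Real.sqrt (n.choose k) * Real.sqrt (m.choose k) : ℝ) : ℂ)).mul (h2.pow ((n - k) + (m - k)))
  refine HasDerivAt.congr_deriv (f := lossCoeff n m k) h3 ?_
  have hx : Complex.exp (-t) = Complex.exp (-t / 2) ^ 2 := by
    rw [← Complex.exp_nat_mul]; congr 1; push_cast; ring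
  rw [lossCoeff, hx]
  generalize hs : (n - k) + (m - k) = s
  cases s with
  | zero => simp [hx]; ring
  | succ s => simp only [Nat.add_sub_cancel, Pi.pow_apply, hx]; push_cast; ring

theorem sqrt_choose_succ (n k : ℕ) :
    Real.sqrt (n.choose (k + 1)) * Real.sqrt (k + 1) = Real.sqrt (n.choose k) * Real.sqrt (n - k : ℕ) := by
  rw [← Real.sqrt_mul (by positivity), ← Real.sqrt_mul (by positivity)]
  congr 1
  exact_mod_cast Nat.choose_succ_right_eq n k

/-- Matches the gain of the term `k + 1` with what `a · a†` makes of the term `k`. Once `k` reaches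
`n` or `m` the truncated exponents may disagree, but both sides vanish. -/
theorem lossCoeff_succ_mul (n m k : ℕ) (t : ℂ) :
    ((Real.sqrt (n.choose (k + 1)) * Real.sqrt (m.choose (k + 1)) : ℝ) : ℂ) *
        (((k + 1 : ℕ) : ℂ) * (1 - Complex.exp (-t)) ^ k) *
          Complex.exp (-t / 2) ^ ((n - (k + 1)) + (m - (k + 1)) + 2) =
      lossCoeff n m k t * ((Real.sqrt (n - k : ℕ) * Real.sqrt (m - k : ℕ) : ℝ) : ℂ) := by
  have h1 : Real.sqrt (n.choose (k + 1)) * Real.sqrt (m.choose (k + 1)) * ((k + 1 : ℕ) : ℝ) =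
      Real.sqrt (n.choose k) * Real.sqrt (m.choose k) *
        (Real.sqrt (n - k : ℕ) * Real.sqrt (m - k : ℕ)) := by
    have h2 : ((k + 1 : ℕ) : ℝ) = Real.sqrt (k + 1) * Real.sqrt (k + 1) := by
      rw [Real.mul_self_sqrt (by positivity)]; push_cast; ring
    rw [h2]
    linear_combination (Real.sqrt (m.choose (k + 1)) * Real.sqrt (k + 1)) * sqrt_choose_succ n k +
      (Real.sqrt (n.choose k) * Real.sqrt (n - k : ℕ)) * sqrt_choose_succ m k
  have h1' := congrArg (fun x : ℝ => (x : ℂ)) h1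
  rw [lossCoeff]
  by_cases hk : k < n ∧ k < m
  · have hs : (n - (k + 1)) + (m - (k + 1)) + 2 = (n - k) + (m - k) := by omega
    rw [hs]
    push_cast at h1' ⊢
    linear_combination ((1 - Complex.exp (-t)) ^ k * Complex.exp (-t / 2) ^ (n - k + (m - k))) * h1'
  · have h0 : Real.sqrt (n - k : ℕ) * Real.sqrt (m - k : ℕ) = 0 := by
      rcases not_and_or.1 hk with h | h
      · rw [Nat.sub_eq_zero_of_le (not_lt.1 h)]; simp
      · rw [Nat.sub_eq_zero_of_le (not_lt.1 h)]; simp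
    rw [h0, mul_zero] at h1'
    rw [h0]
    push_cast at h1' ⊢
    linear_combination ((1 - Complex.exp (-t)) ^ k *
      Complex.exp (-t / 2) ^ ((n - (k + 1)) + (m - (k + 1)) + 2)) * h1'

/-- The right side solves `f' = ℒ f` with the correct initial value, each coefficient being fed by
the one before it. -/
theorem exp_generator_rankOne_basis (e : HilbertBasis ℕ ℂ H) {N n m : ℕ} (hn : n ≤ N) (hm : m ≤ N)
    (t : ℂ) : NormedSpace.exp (t • generator e N) (rankOne ℂ (e n) (e m)) =
      ∑ k ∈ Finset.range (N + 1), lossCoeff n m k t • rankOne ℂ (e (n - k)) (e (m - k)) := by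
  have h0 : (∑ k ∈ Finset.range (N + 1), lossCoeff n m k 0 • rankOne ℂ (e (n - k)) (e (m - k))) =
      rankOne ℂ (e n) (e m) := by
    rw [Finset.sum_eq_single 0]
    · simp [lossCoeff]
    · intro k _ hk
      simp [lossCoeff, hk]
    · simp
  rw [← h0]
  refine (eq_exp_smul_apply (generator e N) (f := fun t => ∑ k ∈ Finset.range (N + 1),
    lossCoeff n m k t • rankOne ℂ (e (n - k)) (e (m - k))) (fun t => ?_) t).symm
  have hd := HasDerivAt.fun_sum (u := Finset.range (N + 1)) fun k _ =>
    (hasDerivAt_lossCoeff n m k t).smul_const (rankOne ℂ (e (n - k)) (e (m - k)))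
  refine hd.congr_deriv ?_
  rw [map_sum]
  have hG : ∀ k, generator e N (lossCoeff n m k t • rankOne ℂ (e (n - k)) (e (m - k))) =
      (lossCoeff n m k t * ((Real.sqrt (n - k : ℕ) * Real.sqrt (m - k : ℕ) : ℝ) : ℂ)) •
        rankOne ℂ (e (n - (k + 1))) (e (m - (k + 1))) -
      (((((n - k : ℕ) + (m - k : ℕ) : ℕ) : ℂ) / 2) * lossCoeff n m k t) •
        rankOne ℂ (e (n - k)) (e (m - k)) := fun k => by
    rw [map_smul, generator_rankOne e (by omega) (by omega), smul_sub, smul_smul, smul_smul,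
      Nat.sub_sub, Nat.sub_sub]
    congr 2
    push_cast
    ring
  simp_rw [hG, sub_smul]
  rw [Finset.sum_sub_distrib, Finset.sum_sub_distrib]
  congr 1
  -- Shift by one: the dropped gain term has the factor `k = 0`, and the top term of the other sum
  -- has the factor `√(n - N) = 0`.
  rw [Finset.sum_range_succ', Finset.sum_range_succ]
  have hN : Real.sqrt (n - N : ℕ) = 0 := by rw [Nat.sub_eq_zero_of_le hn]; simp
  rw [hN]
  simp only [lossCoeff_succ_mul, Nat.add_sub_cancel]
  simp

theorem lossCoeff_ofReal {t : ℝ} (ht : 0 ≤ t) (n m k : ℕ) :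
    lossCoeff n m k t =
      ((lossAmp (Real.exp (-t / 2)) n k * lossAmp (Real.exp (-t / 2)) m k : ℝ) : ℂ) := by
  have hx : Real.exp (-t) = Real.exp (-t / 2) ^ 2 := by
    rw [← Real.exp_nat_mul]; congr 1; push_cast; ring
  have h1 : 0 ≤ 1 - Real.exp (-t / 2) ^ 2 := by
    rw [← hx, sub_nonneg, Real.exp_le_one_iff]; linarith
  have h2 : Real.sqrt (1 - Real.exp (-t / 2) ^ 2) ^ k * Real.sqrt (1 - Real.exp (-t / 2) ^ 2) ^ k =
      (1 - Real.exp (-t)) ^ k := by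
    rw [← mul_pow, Real.mul_self_sqrt h1, hx]
  have h3 : lossAmp (Real.exp (-t / 2)) n k * lossAmp (Real.exp (-t / 2)) m k =
      Real.sqrt (n.choose k) * Real.sqrt (m.choose k) * (1 - Real.exp (-t)) ^ k *
        Real.exp (-t / 2) ^ ((n - k) + (m - k)) := by
    rw [← h2, lossAmp, lossAmp, pow_add]
    ring
  rw [h3, lossCoeff]
  push_cast
  rfl

theorem fockProj_rankOne_fockProj (e : HilbertBasis ℕ ℂ H) (N : ℕ) (x y : H) :
    fockProj e N * rankOne ℂ x y * fockProj e N = rankOne ℂ (fockProj e N x) (fockProj e N y) := by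
  have hs : star (fockProj e N) = fockProj e N := by
    simp [fockProj, star_sum, ContinuousLinearMap.star_eq_adjoint]
  rw [mul_rankOne, rankOne_mul, hs]

theorem rankOne_fockProj (e : HilbertBasis ℕ ℂ H) (N : ℕ) (S T : H →L[ℂ] H) (x y : H) :
    rankOne ℂ (S (fockProj e N x)) (T (fockProj e N y)) =
      ∑ n ∈ Finset.range (N + 1), ∑ m ∈ Finset.range (N + 1),
        (inner ℂ (e n) x * starRingEnd ℂ (inner ℂ (e m) y)) • rankOne ℂ (S (e n)) (T (e m)) := by
  simp only [fockProj_apply, map_sum, map_smul, map_smulₛₗ, sum_apply, smul_apply]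
  rw [Finset.sum_comm]
  refine Finset.sum_congr rfl fun n _ => ?_
  rw [Finset.smul_sum]
  refine Finset.sum_congr rfl fun m _ => ?_
  rw [smul_smul, mul_comm]

theorem exp_generator_rankOne (e : HilbertBasis ℕ ℂ H) (N : ℕ) {t : ℝ} (ht : 0 ≤ t) (x y : H) :
    NormedSpace.exp ((t : ℂ) • generator e N) (rankOne ℂ (fockProj e N x) (fockProj e N y)) =
      ∑ k ∈ Finset.range (N + 1), rankOne ℂ (kraus e (Real.exp (-t / 2)) k (fockProj e N x))
        (kraus e (Real.exp (-t / 2)) k (fockProj e N y)) := by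
  have hq0 : 0 ≤ Real.exp (-t / 2) := (Real.exp_pos _).le
  have hq1 : Real.exp (-t / 2) ≤ 1 := Real.exp_le_one_iff.2 (by linarith)
  have h1 := rankOne_fockProj e N 1 1 x y
  simp only [one_apply_eq_self] at h1
  simp_rw [rankOne_fockProj]
  rw [h1, map_sum, Finset.sum_comm]
  refine Finset.sum_congr rfl fun n hn => ?_
  rw [map_sum, Finset.sum_comm]
  refine Finset.sum_congr rfl fun m hm => ?_
  rw [map_smul, exp_generator_rankOne_basis e (by simp at hn; omega) (by simp at hm; omega),
    Finset.smul_sum]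
  refine Finset.sum_congr rfl fun k _ => ?_
  rw [lossCoeff_ofReal ht, kraus_basis e hq0 hq1, kraus_basis e hq0 hq1]
  simp only [map_smul, map_smulₛₗ, smul_apply, smul_smul, Complex.conj_ofReal, Complex.ofReal_mul]
  congr 1
  ring

theorem kraus_fockProj_eq_zero (e : HilbertBasis ℕ ℂ H) {q : ℝ} (hq0 : 0 ≤ q) (hq1 : q ≤ 1)
    {N k : ℕ} (hk : N < k) (x : H) : kraus e q k (fockProj e N x) = 0 := by
  rw [fockProj_apply, map_sum]
  refine Finset.sum_eq_zero fun n hn => ?_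
  rw [map_smul, kraus_basis e hq0 hq1, lossAmp_of_lt q (by simp at hn; omega)]
  simp

theorem inner_fockProj (e : HilbertBasis ℕ ℂ H) (N n : ℕ) (x : H) :
    inner ℂ (e n) (fockProj e N x) = if n ≤ N then inner ℂ (e n) x else 0 := by
  rw [fockProj_apply, inner_sum]
  simp only [inner_smul_right, inner_basis]
  by_cases h : n ≤ N
  · rw [if_pos h, Finset.sum_eq_single n]
    · simp
    · intro b _ hb; rw [if_neg hb.symm]; simp
    · intro h'; exact absurd (Finset.mem_range.2 (by omega)) h'
  · rw [if_neg h]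
    refine Finset.sum_eq_zero fun m hm => ?_
    rw [if_neg (by simp at hm; omega)]; simp

theorem norm_kraus_fockProj_le (e : HilbertBasis ℕ ℂ H) {q : ℝ} (hq0 : 0 ≤ q) (hq1 : q ≤ 1)
    (N k : ℕ) (x : H) : ‖kraus e q k (fockProj e N x)‖ ^ 2 ≤ ‖kraus e q k x‖ ^ 2 := by
  refine hasSum_le (fun n => ?_) (hasSum_norm_kraus_sq e hq0 hq1 k _)
    (hasSum_norm_kraus_sq e hq0 hq1 k x)
  rw [inner_fockProj]
  split_ifs
  · rfl
  · simp; positivity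

theorem tendsto_fockProj (e : HilbertBasis ℕ ℂ H) (x : H) :
    Tendsto (fun N => fockProj e N x) atTop (𝓝 x) := by
  have h := ((e.hasSum_repr x).tendsto_sum_nat).comp (tendsto_add_atTop_nat 1)
  refine h.congr fun N => ?_
  rw [fockProj_apply]
  exact Finset.sum_congr rfl fun n _ => by rw [e.repr_apply_apply]

variable {ι : Type*}

theorem tendsto_rankOne_self {l : Filter ι} {f : ι → H} {x : H} (h : Tendsto f l (𝓝 x)) :
    Tendsto (fun i => rankOne ℂ (f i) (f i)) l (𝓝 (rankOne ℂ x x)) := by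
  rw [tendsto_iff_norm_sub_tendsto_zero] at h ⊢
  have hb : Tendsto (fun i => ‖f i - x‖ * (‖f i - x‖ + 2 * ‖x‖)) l (𝓝 0) := by
    simpa using h.mul (h.add_const (2 * ‖x‖))
  refine squeeze_zero (fun _ => norm_nonneg _) (fun i => ?_) hb
  have h1 : rankOne ℂ (f i) (f i) - rankOne ℂ x x =
      rankOne ℂ (f i - x) (f i) + rankOne ℂ x (f i - x) := by
    simp [map_sub]
  have h2 : ‖f i‖ ≤ ‖f i - x‖ + ‖x‖ := by simpa using norm_add_le (f i - x) x
  rw [h1]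
  refine (norm_add_le _ _).trans ?_
  rw [norm_rankOne, norm_rankOne]
  nlinarith [norm_nonneg (f i - x)]

theorem summable_norm_kraus_sq (e : HilbertBasis ℕ ℂ H) {q : ℝ} (hq0 : 0 ≤ q) (hq1 : q ≤ 1)
    {v : ι → H} (hv : Summable fun i => ‖v i‖ ^ 2) :
    Summable fun j : ι × ℕ => ‖kraus e q j.2 (v j.1)‖ ^ 2 :=
  (summable_prod_of_nonneg fun _ => by positivity).2
    ⟨fun i => (hasSum_norm_kraus_sq_index e hq0 hq1 (v i)).summable,
      hv.congr fun i => ((hasSum_norm_kraus_sq_index e hq0 hq1 (v i)).tsum_eq).symm⟩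

/-- The Kraus decomposition of the attenuator. -/
theorem IsFrame.attenuator {e : HilbertBasis ℕ ℂ H} {v : ι → H} {X : H →L[ℂ] H} (h : IsFrame v X)
    {t : ℝ} (ht : 0 ≤ t) :
    IsFrame (fun j : ι × ℕ => kraus e (Real.exp (-t / 2)) j.2 (v j.1))
      (OneMode.attenuator e t X) := by
  set q := Real.exp (-t / 2) with hq
  have hq0 : 0 ≤ q := (Real.exp_pos _).le
  have hq1 : q ≤ 1 := Real.exp_le_one_iff.2 (by linarith)
  have hs := summable_norm_kraus_sq e hq0 hq1 h.summable
  have hlim : Tendsto (fun N : ℕ => NormedSpace.exp ((t : ℂ) • generator e N)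
      (fockProj e N * X * fockProj e N)) atTop
      (𝓝 (∑' j : ι × ℕ, rankOne ℂ (kraus e q j.2 (v j.1)) (kraus e q j.2 (v j.1)))) := by
    -- Dominated convergence over pairs `(i, k)`: truncation only decreases `‖K_k v_i‖²`, and these
    -- are summable by trace preservation.
    have h1 := tendsto_tsum_of_dominated_convergence (𝓕 := atTop)
      (f := fun (N : ℕ) (j : ι × ℕ) =>
        rankOne ℂ (kraus e q j.2 (fockProj e N (v j.1))) (kraus e q j.2 (fockProj e N (v j.1))))
      (g := fun j : ι × ℕ => rankOne ℂ (kraus e q j.2 (v j.1)) (kraus e q j.2 (v j.1))) hs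
      (fun j => by
        have h2 : Tendsto (fun N => kraus e q j.2 (fockProj e N (v j.1))) atTop
            (𝓝 (kraus e q j.2 (v j.1))) :=
          ((kraus e q j.2).continuous.tendsto _).comp (tendsto_fockProj e (v j.1))
        exact tendsto_rankOne_self h2)
      (Eventually.of_forall fun N j => by
        rw [norm_rankOne, ← pow_two]
        exact norm_kraus_fockProj_le e hq0 hq1 N j.2 (v j.1))
    refine h1.congr fun N => ?_
    have h4 : Summable fun j : ι × ℕ => rankOne ℂ (kraus e q j.2 (fockProj e N (v j.1)))
        (kraus e q j.2 (fockProj e N (v j.1))) :=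
      summable_rankOne (Summable.of_nonneg_of_le (fun _ => by positivity)
        (fun j => norm_kraus_fockProj_le e hq0 hq1 N j.2 (v j.1)) hs)
    have h5 := (h.hasSum.mapL (ContinuousLinearMap.mulLeftRight ℂ (H →L[ℂ] H) (fockProj e N)
      (fockProj e N))).mapL (NormedSpace.exp ((t : ℂ) • generator e N))
    have h6 : NormedSpace.exp ((t : ℂ) • generator e N) (fockProj e N * X * fockProj e N) =
      ∑' i, NormedSpace.exp ((t : ℂ) • generator e N)
        (fockProj e N * rankOne ℂ (v i) (v i) * fockProj e N) := h5.tsum_eq.symm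
    rw [h6, h4.tsum_prod]
    refine tsum_congr fun i => ?_
    rw [fockProj_rankOne_fockProj, exp_generator_rankOne e N ht]
    refine tsum_eq_sum fun k hk => ?_
    rw [kraus_fockProj_eq_zero e hq0 hq1 (by simpa using hk)]
    simp
  rw [OneMode.attenuator, hlim.limUnder_eq]
  exact isFrame_tsum hs

end Semigroup

/-! ### Two-sided bounds on the trace of a power of the output -/

section FiniteRank

variable {H : Type*} [NormedAddCommGroup H] [InnerProductSpace ℂ H] [CompleteSpace H]

/-- The overlap with `x` of the state obtained from `y` by losing at least one photon. -/
noncomputable def lossOverlap (e : HilbertBasis ℕ ℂ H) (q : ℝ) (x y : H) : ℝ :=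
  ∑' k, ‖inner ℂ x (kraus e q (k + 1) y)‖ ^ 2

theorem hasSum_lossOverlap (e : HilbertBasis ℕ ℂ H) {q : ℝ} (hq0 : 0 ≤ q) (hq1 : q ≤ 1) (x y : H) :
    HasSum (fun k => ‖inner ℂ x (kraus e q (k + 1) y)‖ ^ 2) (lossOverlap e q x y) := by
  refine Summable.hasSum (Summable.of_nonneg_of_le (fun _ => by positivity) (fun k => ?_)
    ((hasSum_norm_kraus_succ_sq e hq0 hq1 y).summable.mul_left (‖x‖ ^ 2)))
  rw [← mul_pow]
  exact pow_le_pow_left₀ (norm_nonneg _) (norm_inner_le_norm _ _) 2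

theorem lossOverlap_nonneg (e : HilbertBasis ℕ ℂ H) (q : ℝ) (x y : H) : 0 ≤ lossOverlap e q x y :=
  tsum_nonneg fun _ => by positivity

theorem expect_smul_vector (V : H →L[ℂ] H) (c : ℝ) (x : H) :
    expect V ((c : ℂ) • x) = c ^ 2 * expect V x := by
  rw [expect, map_smul, inner_smul_left, inner_smul_right, Complex.conj_ofReal, ← mul_assoc,
    ← Complex.ofReal_mul, Complex.re_ofReal_mul, pow_two, expect]

theorem expect_sqrt_smul (V : H →L[ℂ] H) {c : ℝ} (hc : 0 ≤ c) (x : H) :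
    expect V ((Real.sqrt c : ℂ) • x) = c * expect V x := by
  rw [expect_smul_vector, Real.sq_sqrt hc]

theorem isFrame_apply_basis (e : HilbertBasis ℕ ℂ H) {S : H →L[ℂ] H}
    (hS : Summable fun n => ‖S (e n)‖ ^ 2) : IsFrame (fun n => S (e n)) (S * star S) := by
  have h := isFrame_tsum hS
  have hEq : ∑' n, rankOne ℂ (S (e n)) (S (e n)) = S * star S := by
    ext y
    refine ext_inner_left ℂ fun x => ?_
    have h1 := (h.hasSum.mapL (ContinuousLinearMap.apply ℂ H y)).mapL (innerSL ℂ x)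
    have h2 := e.hasSum_inner_mul_inner (star S x) (star S y)
    have h3 : inner ℂ (star S x) (star S y) = inner ℂ x ((S * star S) y) := by
      rw [ContinuousLinearMap.star_eq_adjoint, ContinuousLinearMap.adjoint_inner_left]; rfl
    rw [← h3]
    refine HasSum.unique h1 (h2.congr_fun fun n => ?_)
    simp only [ContinuousLinearMap.apply_apply, rankOne_apply, innerSL_apply_apply,
      inner_smul_right, ContinuousLinearMap.star_eq_adjoint, ContinuousLinearMap.adjoint_inner_left,
      ContinuousLinearMap.adjoint_inner_right]
    ring
  rwa [hEq] at h

variable {r : ℕ} {φ : Fin r → H} {c : Fin r → ℝ}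

theorem diagonal_sqrt_mul_self (hφ : Orthonormal ℂ φ) (hc : ∀ i, 0 ≤ c i) :
    diagonal φ (fun i => Real.sqrt (c i)) * diagonal φ (fun i => Real.sqrt (c i)) =
      diagonal φ c := by
  refine ext_of_orthonormal hφ (fun i => ?_) fun x hx => ?_
  · rw [mul_apply_eq_comp, diagonal_apply_self hφ, map_smul, diagonal_apply_self hφ,
      diagonal_apply_self hφ, smul_smul, ← Complex.ofReal_mul, Real.mul_self_sqrt (hc i)]
  · rw [mul_apply_eq_comp, diagonal_apply φ (fun i => Real.sqrt (c i)) x, diagonal_apply φ c x]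
    simp [hx]

theorem inner_diagonal_apply (hφ : Orthonormal ℂ φ) (i : Fin r) (x : H) :
    inner ℂ (φ i) (diagonal φ c x) = c i * inner ℂ (φ i) x := by
  classical
  rw [diagonal_apply, inner_sum]
  simp only [inner_smul_right, orthonormal_iff_ite.1 hφ]
  simp

theorem norm_diagonal_sqrt_apply_sq (hφ : Orthonormal ℂ φ) (hc : ∀ i, 0 ≤ c i) (x : H) :
    ‖diagonal φ (fun i => Real.sqrt (c i)) x‖ ^ 2 = ∑ i, c i * ‖inner ℂ (φ i) x‖ ^ 2 := by
  rw [← expect_star_mul, (isSelfAdjoint_diagonal φ _).star_eq, diagonal_sqrt_mul_self hφ hc,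
    expect_diagonal]

theorem hasSum_norm_diagonal_sqrt_basis_sq (e : HilbertBasis ℕ ℂ H) (hφ : Orthonormal ℂ φ)
    (hc : ∀ i, 0 ≤ c i) :
    HasSum (fun n => ‖diagonal φ (fun i => Real.sqrt (c i)) (e n)‖ ^ 2) (∑ i, c i) := by
  simp_rw [norm_diagonal_sqrt_apply_sq hφ hc]
  have h := hasSum_sum (s := Finset.univ) fun i _ =>
    (hasSum_norm_inner_sq e (φ i)).mul_left (c i)
  simp only [hφ.1, one_pow, mul_one] at h
  simpa only [norm_inner_symm] using h

/-- A second decomposition of the same operator, indexed by Fock states. There damping multiplies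
the `n`-th vector by `q^n`, so `dampedGram` can be compared with `diagonal φ c` term by term. -/
theorem isFrame_diagonal_sqrt_basis (e : HilbertBasis ℕ ℂ H) (hφ : Orthonormal ℂ φ)
    (hc : ∀ i, 0 ≤ c i) :
    IsFrame (fun n => diagonal φ (fun i => Real.sqrt (c i)) (e n)) (diagonal φ c) := by
  have h := isFrame_apply_basis e (hasSum_norm_diagonal_sqrt_basis_sq e hφ hc).summable
  rwa [(isSelfAdjoint_diagonal φ _).star_eq, diagonal_sqrt_mul_self hφ hc] at h

theorem toReal_trace_power_diagonal (hφ : Orthonormal ℂ φ) (hc : ∀ i, 0 ≤ c i)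
    (e : HilbertBasis ℕ ℂ H) {p : ℝ} (hp : 0 < p) :
    (trace e (power (diagonal φ c) p)).toReal = ∑ i, c i ^ p := by
  rw [power_diagonal hφ c hp, trace_diagonal hφ (fun i => Real.rpow_nonneg (hc i) p),
    ENNReal.toReal_ofReal (Finset.sum_nonneg fun i _ => Real.rpow_nonneg (hc i) p)]

/-- The operator `X ^ (1/2) K₀ ^ 2 X ^ (1/2)`, for `X = ∑ i, c i |φ i⟩⟨φ i|`. -/
noncomputable def dampedGram (e : HilbertBasis ℕ ℂ H) (φ : Fin r → H) (c : Fin r → ℝ) (q : ℝ) :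
    H →L[ℂ] H :=
  star (kraus e q 0 * diagonal φ fun i => Real.sqrt (c i)) *
    (kraus e q 0 * diagonal φ fun i => Real.sqrt (c i))

theorem isFrame_dampedGram (e : HilbertBasis ℕ ℂ H) (hφ : Orthonormal ℂ φ) (hc : ∀ i, 0 ≤ c i)
    {q : ℝ} (hq0 : 0 ≤ q) (hq1 : q ≤ 1) :
    IsFrame (fun n => ((q ^ n : ℝ) : ℂ) • diagonal φ (fun i => Real.sqrt (c i)) (e n))
      (dampedGram e φ c q) := by
  set S := diagonal φ fun i => Real.sqrt (c i) with hS
  have hSs : star S = S := (isSelfAdjoint_diagonal φ _).star_eq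
  have hK : star (kraus e q 0) = kraus e q 0 := (isSelfAdjoint_kraus_zero e hq0 hq1).star_eq
  have h1 : ∀ n, star (kraus e q 0 * S) (e n) = ((q ^ n : ℝ) : ℂ) • S (e n) := fun n => by
    rw [star_mul, hK, hSs, mul_apply_eq_comp, kraus_basis e hq0 hq1, lossAmp_zero, map_smul,
      Nat.sub_zero]
  have h2 : Summable fun n => ‖star (kraus e q 0 * S) (e n)‖ ^ 2 := by
    refine Summable.of_nonneg_of_le (fun _ => by positivity) (fun n => ?_)
      (hasSum_norm_diagonal_sqrt_basis_sq e hφ hc).summable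
    rw [h1, norm_smul, Complex.norm_real, Real.norm_eq_abs, abs_of_nonneg (by positivity)]
    exact pow_le_pow_left₀ (by positivity)
      (mul_le_of_le_one_left (norm_nonneg _) (pow_le_one₀ hq0 hq1)) 2
  have h3 := isFrame_apply_basis e h2
  rw [star_star] at h3
  simp only [h1] at h3
  exact h3

theorem sum_mul_lossProb (e : HilbertBasis ℕ ℂ H) {q : ℝ} (hq0 : 0 ≤ q) (hq1 : q ≤ 1)
    (b : Fin r → ℝ) : HasSum (fun n => (1 - (q ^ 2) ^ n) * ∑ i, b i * ‖inner ℂ (φ i) (e n)‖ ^ 2)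
      (∑ i, b i * lossProb e q (φ i)) := by
  have h := hasSum_sum (s := Finset.univ) fun i _ =>
    (hasSum_lossProb e hq0 hq1 (φ i)).mul_left (b i)
  refine h.congr_fun fun n => ?_
  rw [Finset.mul_sum]
  refine Finset.sum_congr rfl fun i _ => ?_
  rw [norm_inner_symm]
  ring

/-- With `B` the damped operator and `X = diagonal φ c`, write `Tr B^p = Tr B^{p-1} X - Tr B^{p-1}
(X - B)`. Hölder bounds `p Tr B^{p-1} X` by `Tr X^p + (p - 1) Tr B^p`, and the last trace is
absorbed on the left. In the other term `B^{p-1}` is replaced by `X^{p-1}`, at the cost of a norm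
difference times the loss. -/
theorem toReal_trace_power_dampedGram_le (e : HilbertBasis ℕ ℂ H) (hφ : Orthonormal ℂ φ)
    (hc : ∀ i, 0 < c i) {q : ℝ} (hq0 : 0 ≤ q) (hq1 : q ≤ 1) {p : ℝ} (hp : 1 < p) :
    (trace e (power (dampedGram e φ c q) p)).toReal ≤ ∑ i, c i ^ p -
      p * (∑ i, c i ^ p * lossProb e q (φ i) -
        ‖power (diagonal φ c) (p - 1) - power (dampedGram e φ c q) (p - 1)‖ *
          ∑ i, c i * lossProb e q (φ i)) := by
  set B := dampedGram e φ c q with hB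
  set S := diagonal φ fun i => Real.sqrt (c i) with hS
  set δ := ‖power (diagonal φ c) (p - 1) - power B (p - 1)‖ with hδ
  have hp' : 0 < p - 1 := sub_pos.2 hp
  have hc0 : ∀ i, 0 ≤ c i := fun i => (hc i).le
  have fB := isFrame_dampedGram e hφ hc0 hq0 hq1
  have fX := isFrame_diagonal_sqrt_basis e hφ hc0
  have hB0 : 0 ≤ B := fB.nonneg
  have hV0 := power_nonneg hB0 (p - 1)
  have h1 := sum_expect_power_sub_one_le hφ e hB0 hp (fB.trace_power_ne_top e hp) hc0
  have h2 : ∑ i, c i * expect (power B (p - 1)) (φ i) =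
      ∑' n, expect (power B (p - 1)) (S (e n)) := by
    rw [← (isFrame_diagonal φ hc0).tsum_expect_power_eq fX e hB0 hp', tsum_fintype]
    exact Finset.sum_congr rfl fun i _ => (expect_sqrt_smul _ (hc0 i) _).symm
  have h3 : (trace e (power B p)).toReal =
      ∑' n, (q ^ 2) ^ n * expect (power B (p - 1)) (S (e n)) := by
    rw [fB.toReal_trace_power e hp]
    refine tsum_congr fun n => ?_
    rw [expect_smul_vector, ← pow_mul, ← pow_mul, mul_comm n 2]
  have hs1 : Summable fun n => expect (power B (p - 1)) (S (e n)) := fX.summable_expect hV0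
  have hs2 : Summable fun n => (q ^ 2) ^ n * expect (power B (p - 1)) (S (e n)) :=
    (fB.summable_expect hV0).congr fun n => by
      rw [expect_smul_vector, ← pow_mul, ← pow_mul, mul_comm n 2]
  have h4 : ∑' n, expect (power B (p - 1)) (S (e n)) - (trace e (power B p)).toReal =
      ∑' n, (1 - (q ^ 2) ^ n) * expect (power B (p - 1)) (S (e n)) := by
    rw [h3, ← hs1.tsum_sub hs2]
    exact tsum_congr fun n => by ring
  have hXpow : ∀ n, expect (power (diagonal φ c) (p - 1)) (S (e n)) =
      ∑ i, c i ^ p * ‖inner ℂ (φ i) (e n)‖ ^ 2 := fun n => by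
    rw [power_diagonal hφ c hp', expect_diagonal]
    refine Finset.sum_congr rfl fun i _ => ?_
    rw [inner_diagonal_apply hφ, norm_mul, mul_pow, Complex.norm_real, Real.norm_eq_abs, sq_abs,
      Real.sq_sqrt (hc0 i), ← mul_assoc, ← Real.rpow_add_one (hc i).ne', sub_add_cancel]
  have h5 : ∑ i, c i ^ p * lossProb e q (φ i) - δ * ∑ i, c i * lossProb e q (φ i) ≤
      ∑' n, (1 - (q ^ 2) ^ n) * expect (power B (p - 1)) (S (e n)) := by
    have hl := (sum_mul_lossProb (φ := φ) e hq0 hq1 fun i => c i ^ p).sub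
      ((sum_mul_lossProb (φ := φ) e hq0 hq1 c).mul_left δ)
    refine hasSum_le (fun n => ?_) hl ((hs1.sub hs2).congr fun n => by ring).hasSum
    have hq : (q ^ 2) ^ n ≤ 1 := pow_le_one₀ (by positivity) (pow_le_one₀ hq0 hq1)
    have hexp := expect_le_add (power (diagonal φ c) (p - 1)) (power B (p - 1)) (S (e n))
    rw [hXpow, norm_diagonal_sqrt_apply_sq hφ hc0, ← hδ] at hexp
    nlinarith [mul_le_mul_of_nonneg_left hexp (sub_nonneg.2 hq)]
  rw [h2] at h1
  nlinarith

theorem dampedOperator_eq (e : HilbertBasis ℕ ℂ H) (hφ : Orthonormal ℂ φ) (hc : ∀ i, 0 ≤ c i)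
    (q : ℝ) :
    (kraus e q 0 * diagonal φ fun i => Real.sqrt (c i)) *
        star (kraus e q 0 * diagonal φ fun i => Real.sqrt (c i)) =
      kraus e q 0 * diagonal φ c * star (kraus e q 0) := by
  rw [star_mul, (isSelfAdjoint_diagonal φ _).star_eq, mul_assoc, ← mul_assoc (diagonal φ _),
    diagonal_sqrt_mul_self hφ hc, mul_assoc]

theorem finiteDimensional_range_conj {X : H →L[ℂ] H} (K L : H →L[ℂ] H)
    [FiniteDimensional ℂ (LinearMap.range X.toLinearMap)] :
    FiniteDimensional ℂ (LinearMap.range (K * X * L).toLinearMap) := by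
  have h : LinearMap.range (K * X * L).toLinearMap ≤
      (LinearMap.range X.toLinearMap).map K.toLinearMap := by
    rintro _ ⟨x, rfl⟩
    exact ⟨X (L x), ⟨L x, rfl⟩, rfl⟩
  exact Submodule.finiteDimensional_of_le h

theorem finiteDimensional_range_diagonal (φ : Fin r → H) (c : Fin r → ℝ) :
    FiniteDimensional ℂ (LinearMap.range (diagonal φ c).toLinearMap) := by
  have h : LinearMap.range (diagonal φ c).toLinearMap ≤ Submodule.span ℂ (Set.range φ) := by
    rintro _ ⟨x, rfl⟩
    change diagonal φ c x ∈ _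
    rw [diagonal_apply]
    exact Submodule.sum_mem _ fun i _ =>
      Submodule.smul_mem _ _ (Submodule.subset_span (Set.mem_range_self i))
  have := FiniteDimensional.span_of_finite ℂ (Set.finite_range φ)
  exact Submodule.finiteDimensional_of_le h

/-- `Tr [Y ^ (p - 1) K₀ X K₀]` is bounded by Hölder's inequality. -/
theorem sum_expect_kraus_zero_le (e : HilbertBasis ℕ ℂ H) (hφ : Orthonormal ℂ φ)
    (hc : ∀ i, 0 < c i) {q : ℝ} (hq0 : 0 ≤ q) (hq1 : q ≤ 1) {p : ℝ} (hp : 1 < p)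
    {Y : H →L[ℂ] H} (hY : 0 ≤ Y) (hT : trace e (power Y p) ≠ ⊤) :
    p * ∑ j, c j * expect (power Y (p - 1)) (kraus e q 0 (φ j)) ≤
      (trace e (power (dampedGram e φ c q) p)).toReal +
        (p - 1) * (trace e (power Y p)).toReal := by
  set S := diagonal φ fun i => Real.sqrt (c i) with hS
  set K := kraus e q 0 with hK
  have hp' : 0 < p - 1 := sub_pos.2 hp
  have hc0 : ∀ i, 0 ≤ c i := fun i => (hc i).le
  have hCv : ∀ j, (K * S) (φ j) = K ((Real.sqrt (c j) : ℂ) • φ j) := fun j => by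
    rw [mul_apply_eq_comp, diagonal_apply_self hφ]
  have fA := (isFrame_diagonal φ hc0).map K
  set A := K * diagonal φ c * star K with hA
  -- With `C = K₀ X^{1/2}`, `A = C C†` and `B = C† C`. Hölder is applied in the eigenbasis of `A`;
  -- then `C B^{p-1} = A^{p-1} C` passes from `Tr A^p` to `B`.
  have hAC : (K * S) * star (K * S) = A := dampedOperator_eq e hφ hc0 q
  have hA0 : 0 ≤ A := fA.nonneg
  have := finiteDimensional_range_diagonal φ c
  have : FiniteDimensional ℂ (LinearMap.range A.toLinearMap) :=
    finiteDimensional_range_conj K (star K)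
  obtain ⟨s, χ, α, hχ, hα, -, hAd⟩ := exists_eq_diagonal hA0
  have hα0 : ∀ i, 0 ≤ α i := fun i => (hα i).le
  have fA' := isFrame_diagonal χ hα0
  rw [← hAd] at fA'
  have h1 : ∑ j, c j * expect (power Y (p - 1)) (K (φ j)) =
      ∑ m, α m * expect (power Y (p - 1)) (χ m) := by
    have := fA.tsum_expect_power_eq fA' e hY hp'
    simpa only [tsum_fintype, map_smul, expect_sqrt_smul _ (hc0 _), expect_sqrt_smul _ (hα0 _)]
      using this
  have h2 : ∑ m, α m ^ p = ∑ j, expect (power A (p - 1)) (K ((Real.sqrt (c j) : ℂ) • φ j)) := by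
    rw [← toReal_trace_power_diagonal hχ hα0 e (by linarith), ← hAd, fA.toReal_trace_power e hp,
      tsum_fintype]
  have fB := isFrame_dampedGram e hφ hc0 hq0 hq1
  set B := dampedGram e φ c q with hB
  have hB0 : 0 ≤ B := fB.nonneg
  have hint : (K * S) * power B (p - 1) = power A (p - 1) * (K * S) := by
    refine cfc_intertwine (continuous_rpow_of_pos hp') (IsSelfAdjoint.of_nonneg hB0)
      (IsSelfAdjoint.of_nonneg hA0) ?_
    have hBK : B = star (K * S) * (K * S) := rfl
    rw [← hAC, hBK, ← mul_assoc]
  have h3 : ∀ j, expect (power A (p - 1)) (K ((Real.sqrt (c j) : ℂ) • φ j)) =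
      expect (power B p) (φ j) := fun j => by
    have hpow : power B p = B * power B (p - 1) := by
      conv_lhs => rw [show p = 1 + (p - 1) by ring]
      rw [power_add hB0 one_pos hp', power_one hB0]
    have hBK : ∀ x, B x = star (K * S) ((K * S) x) := fun x => rfl
    rw [← hCv, expect, ← mul_apply_eq_comp (power A (p - 1)), ← hint, hpow, expect,
      mul_apply_eq_comp B, hBK, mul_apply_eq_comp (K * S), ContinuousLinearMap.star_eq_adjoint,
      ContinuousLinearMap.adjoint_inner_right]
  have h4 := sum_expect_power_sub_one_le hχ e hY hp hT hα0
  have h5 := sum_expect_power_le_toReal_trace hφ e hB0 (zero_lt_one.trans hp)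
    (fB.trace_power_ne_top e hp)
  rw [h1]
  refine h4.trans ?_
  rw [h2, Finset.sum_congr rfl fun j _ => h3 j]
  linarith

/-- The Kraus vectors of the output `Y` give `Tr Y^p = ∑ ⟨v, Y^{p-1} v⟩`, split here into the
no-loss term and the rest. -/
theorem toReal_trace_power_attenuator (e : HilbertBasis ℕ ℂ H) (hc : ∀ i, 0 ≤ c i)
    {t : ℝ} (ht : 0 ≤ t) {p : ℝ} (hp : 1 < p) :
    (trace e (power (attenuator e t (diagonal φ c)) p)).toReal =
      ∑ j, c j * expect (power (attenuator e t (diagonal φ c)) (p - 1))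
        (kraus e (Real.exp (-t / 2)) 0 (φ j)) +
      ∑ j, c j * ∑' k, expect (power (attenuator e t (diagonal φ c)) (p - 1))
        (kraus e (Real.exp (-t / 2)) (k + 1) (φ j)) := by
  have fY := (isFrame_diagonal φ hc).attenuator (e := e) ht
  set Y := attenuator e t (diagonal φ c)
  have hV := power_nonneg fY.nonneg (p - 1)
  have hs := fY.summable_expect hV
  rw [fY.toReal_trace_power e hp, hs.tsum_prod, tsum_fintype, ← Finset.sum_add_distrib]
  refine Finset.sum_congr rfl fun j _ => ?_
  rw [(hs.prod_factor j).tsum_eq_zero_add]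
  simp only [map_smul, expect_sqrt_smul _ (hc _)]
  rw [tsum_mul_left]

/-- The terms `k ≥ 1` already have total weight `lossProb`, so replacing `V` by `X^{p-1}` costs only
a norm difference times that weight. -/
theorem tsum_expect_kraus_succ_le (e : HilbertBasis ℕ ℂ H) (hφ : Orthonormal ℂ φ)
    {q : ℝ} (hq0 : 0 ≤ q) (hq1 : q ≤ 1) {p : ℝ} (hp : 1 < p) {V : H →L[ℂ] H} (hV : 0 ≤ V) (x : H) :
    ∑' k, expect V (kraus e q (k + 1) x) ≤
      ∑ i, c i ^ (p - 1) * lossOverlap e q (φ i) x +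
        ‖V - power (diagonal φ c) (p - 1)‖ * lossProb e q x := by
  have hr := (hasSum_sum (s := Finset.univ) fun i _ =>
    (hasSum_lossOverlap e hq0 hq1 (φ i) x).mul_left (c i ^ (p - 1))).add
      ((hasSum_norm_kraus_succ_sq e hq0 hq1 x).mul_left ‖V - power (diagonal φ c) (p - 1)‖)
  have hle : ∀ k, expect V (kraus e q (k + 1) x) ≤
      ∑ i, c i ^ (p - 1) * ‖inner ℂ (φ i) (kraus e q (k + 1) x)‖ ^ 2 +
        ‖V - power (diagonal φ c) (p - 1)‖ * ‖kraus e q (k + 1) x‖ ^ 2 := fun k => by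
    refine (expect_le_add V (power (diagonal φ c) (p - 1)) _).trans (le_of_eq ?_)
    rw [power_diagonal hφ c (sub_pos.2 hp), expect_diagonal]
  have hs : Summable fun k => expect V (kraus e q (k + 1) x) :=
    Summable.of_nonneg_of_le (fun _ => expect_nonneg hV _) hle hr.summable
  exact hasSum_le hle hs.hasSum hr

/-- The upper bound on the output trace, up to an error of smaller order. -/
theorem toReal_trace_power_attenuator_le (e : HilbertBasis ℕ ℂ H) (hφ : Orthonormal ℂ φ)
    (hc : ∀ i, 0 < c i) {t : ℝ} (ht : 0 ≤ t) {p : ℝ} (hp : 1 < p) {q : ℝ}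
    (hq : q = Real.exp (-t / 2)) :
    (trace e (power (attenuator e t (diagonal φ c)) p)).toReal ≤ ∑ i, c i ^ p +
      p * (∑ i, ∑ j, c i ^ (p - 1) * c j * lossOverlap e q (φ i) (φ j) -
        ∑ j, c j ^ p * lossProb e q (φ j) +
        (‖power (attenuator e t (diagonal φ c)) (p - 1) - power (diagonal φ c) (p - 1)‖ +
          ‖power (diagonal φ c) (p - 1) - power (dampedGram e φ c q) (p - 1)‖) *
            ∑ j, c j * lossProb e q (φ j)) := by
  have hq0 : 0 ≤ q := hq ▸ (Real.exp_pos _).le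
  have hq1 : q ≤ 1 := hq ▸ Real.exp_le_one_iff.2 (by linarith)
  have hc0 : ∀ i, 0 ≤ c i := fun i => (hc i).le
  have fY := (isFrame_diagonal φ hc0).attenuator (e := e) ht
  have h1 := toReal_trace_power_attenuator (φ := φ) e hc0 ht hp
  have h2 := sum_expect_kraus_zero_le e hφ hc hq0 hq1 hp fY.nonneg (fY.trace_power_ne_top e hp)
  have h3 := toReal_trace_power_dampedGram_le e hφ hc hq0 hq1 hp
  rw [← hq] at h1
  set Y := attenuator e t (diagonal φ c)
  set δ := ‖power Y (p - 1) - power (diagonal φ c) (p - 1)‖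
  have h4 : ∑ j, c j * ∑' k, expect (power Y (p - 1)) (kraus e q (k + 1) (φ j)) ≤
      ∑ i, ∑ j, c i ^ (p - 1) * c j * lossOverlap e q (φ i) (φ j) +
        δ * ∑ j, c j * lossProb e q (φ j) := by
    rw [Finset.sum_comm, Finset.mul_sum, ← Finset.sum_add_distrib]
    refine Finset.sum_le_sum fun j _ => ?_
    refine (mul_le_mul_of_nonneg_left (tsum_expect_kraus_succ_le (c := c) e hφ hq0 hq1 hp
      (power_nonneg fY.nonneg (p - 1)) (φ j)) (hc0 j)).trans (le_of_eq ?_)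
    rw [mul_add, Finset.mul_sum]
    congr 1
    · exact Finset.sum_congr rfl fun i _ => by ring
    · ring
  -- `p Tr Y^p` on the left meets `(p - 1) Tr Y^p` from Hölder on the right, so exactly one copy of
  -- `Tr Y^p` remains.
  have hp0 : 0 < p := by linarith
  nlinarith [mul_le_mul_of_nonneg_left h4 hp0.le]

/-- `K₀` at time `t` multiplies `|n⟩` by `e^{-nt/2}`, the probability that no photon is lost up to
time `t / 2`. -/
theorem re_inner_kraus_zero (e : HilbertBasis ℕ ℂ H) {t : ℝ} (ht : 0 ≤ t) {x : H} (hx : ‖x‖ = 1) :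
    expect (kraus e (Real.exp (-t / 2)) 0) x = 1 - lossProb e (Real.exp (-(t / 2) / 2)) x := by
  have hq0 : 0 ≤ Real.exp (-t / 2) := (Real.exp_pos _).le
  have hq1 : Real.exp (-t / 2) ≤ 1 := Real.exp_le_one_iff.2 (by linarith)
  have hq : Real.exp (-(t / 2) / 2) ^ 2 = Real.exp (-t / 2) := by
    rw [← Real.exp_nat_mul]; congr 1; push_cast; ring
  have h1 := (e.hasSum_inner_mul_inner x (kraus e (Real.exp (-t / 2)) 0 x)).mapL Complex.reCLM
  have h2 := (hasSum_norm_inner_sq e x).sub (hasSum_lossProb e (q := Real.exp (-(t / 2) / 2))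
    (Real.exp_pos _).le (Real.exp_le_one_iff.2 (by linarith)) x)
  rw [hx, one_pow] at h2
  refine HasSum.unique h1 (h2.congr_fun fun n => ?_)
  rw [inner_kraus_zero e hq0 hq1, hq, Complex.reCLM_apply, mul_left_comm, Complex.re_ofReal_mul,
    ← inner_conj_symm x (e n), ← Complex.normSq_eq_conj_mul_self, Complex.ofReal_re,
    Complex.normSq_eq_norm_sq]
  ring

/-- The lower bound on the output trace. -/
theorem le_toReal_trace_power_attenuator (e : HilbertBasis ℕ ℂ H) (hφ : Orthonormal ℂ φ)
    (hc : ∀ i, 0 < c i) {t : ℝ} (ht : 0 ≤ t) {p : ℝ} (hp : 1 < p) :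
    ∑ i, c i ^ p + p * (∑ i, ∑ j, c i ^ (p - 1) * c j *
        lossOverlap e (Real.exp (-t / 2)) (φ i) (φ j) -
        ∑ j, c j ^ p * (2 * lossProb e (Real.exp (-(t / 2) / 2)) (φ j))) ≤
      (trace e (power (attenuator e t (diagonal φ c)) p)).toReal := by
  have hc0 : ∀ i, 0 ≤ c i := fun i => (hc i).le
  have fY := (isFrame_diagonal φ hc0).attenuator (e := e) ht
  have h1 := sum_tangent_le_toReal_trace hφ e fY.nonneg hp (fY.trace_power_ne_top e hp) hc0
  refine le_trans ?_ h1
  have hp0 : 0 < p := by linarith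
  set q := Real.exp (-t / 2) with hq
  have hq0 : 0 ≤ q := (Real.exp_pos _).le
  have hq1 : q ≤ 1 := Real.exp_le_one_iff.2 (by linarith)
  gcongr
  rw [← Finset.sum_sub_distrib]
  refine Finset.sum_le_sum fun i _ => ?_
  have hcp : c i ^ p = c i ^ (p - 1) * c i := by
    rw [← Real.rpow_add_one (hc i).ne', sub_add_cancel]
  have h2 := fY.hasSum_expect (φ i)
  have h3 : expect (attenuator e t (diagonal φ c)) (φ i) =
      ∑ j, c j * (‖inner ℂ (φ i) (kraus e q 0 (φ j))‖ ^ 2 + lossOverlap e q (φ i) (φ j)) := by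
    rw [← h2.tsum_eq, h2.summable.tsum_prod, tsum_fintype]
    refine Finset.sum_congr rfl fun j _ => ?_
    rw [(h2.summable.prod_factor j).tsum_eq_zero_add]
    simp only [map_smul, inner_smul_right, norm_mul, Complex.norm_real, Real.norm_eq_abs, mul_pow,
      sq_abs, Real.sq_sqrt (hc0 j)]
    rw [tsum_mul_left, mul_add]
    rfl
  -- Keep only `j = i` and use `(1 - u)² ≥ 1 - 2u`, with `u` the loss at time `t / 2`. At finite
  -- energy, `2u` agrees to first order with the loss at time `t`.
  have h4 : c i * (1 - 2 * lossProb e (Real.exp (-(t / 2) / 2)) (φ i)) ≤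
      ∑ j, c j * ‖inner ℂ (φ i) (kraus e q 0 (φ j))‖ ^ 2 := by
    refine le_trans ?_ (Finset.single_le_sum (f := fun j =>
      c j * ‖inner ℂ (φ i) (kraus e q 0 (φ j))‖ ^ 2)
      (fun j _ => mul_nonneg (hc0 j) (by positivity)) (Finset.mem_univ i))
    refine mul_le_mul_of_nonneg_left ?_ (hc0 i)
    have h5 := re_inner_kraus_zero e ht (hφ.1 i)
    have h6 := Complex.abs_re_le_norm (inner ℂ (φ i) (kraus e q 0 (φ i)))
    have h7 : (expect (kraus e q 0) (φ i)) ^ 2 ≤ ‖inner ℂ (φ i) (kraus e q 0 (φ i))‖ ^ 2 := by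
      rw [← sq_abs]
      exact pow_le_pow_left₀ (abs_nonneg _) h6 2
    rw [h5] at h7
    nlinarith [sq_nonneg (lossProb e (Real.exp (-(t / 2) / 2)) (φ i))]
  have h8 : 0 ≤ c i ^ (p - 1) := Real.rpow_nonneg (hc0 i) _
  rw [h3, hcp]
  simp only [mul_add, Finset.sum_add_distrib]
  have h9 : ∑ j, c i ^ (p - 1) * c j * lossOverlap e q (φ i) (φ j) =
      c i ^ (p - 1) * ∑ j, c j * lossOverlap e q (φ i) (φ j) := by
    rw [Finset.mul_sum]
    exact Finset.sum_congr rfl fun j _ => by ring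
  rw [h9]
  nlinarith [mul_le_mul_of_nonneg_left h4 h8]

end FiniteRank

/-! ### Rearrangement and the scalar logarithmic Sobolev inequality -/

theorem sum_mul_by_parts (b g : ℕ → ℝ) (n : ℕ) :
    ∑ i ∈ Finset.range n, b i * g i =
      ∑ k ∈ Finset.range n, (b k - b (k + 1)) * ∑ i ∈ Finset.range (k + 1), g i +
        b n * ∑ i ∈ Finset.range n, g i := by
  induction n with
  | zero => simp
  | succ n ih =>
    rw [Finset.sum_range_succ, ih, Finset.sum_range_succ (fun k => (b k - b (k + 1)) * _),
      Finset.sum_range_succ g]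
    ring

/-- Summation by parts in `i`, with `b` decreasing to `b r = 0`, reduces the claim to the rows `i ≤
k`. There `y = x (k + 1)` is subtracted from each `x j`: the terms with `j > k` become nonpositive,
those with `j ≤ k` are bounded by column sums, and `y` times the first `k + 1` row sums contributes
the excess `(k + 1) δ y`. -/
theorem sum_rearrangement_le {r : ℕ} {b x E : ℕ → ℝ} {M : ℕ → ℕ → ℝ} {δ : ℝ}
    (hb : Antitone b) (hbr : b r = 0) (hx : Antitone x) (hx0 : ∀ i, 0 ≤ x i)
    (hM : ∀ i j, 0 ≤ M i j) (hcol : ∀ j, ∑ i ∈ Finset.range r, M i j ≤ E j)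
    (hrow : ∀ i, ∑ j ∈ Finset.range r, M i j ≤ E i + δ) :
    ∑ i ∈ Finset.range r, ∑ j ∈ Finset.range r, b i * x j * M i j -
        ∑ j ∈ Finset.range r, b j * x j * E j ≤
      δ * ∑ k ∈ Finset.range r, (k + 1) * (x (k + 1) * (b k - b (k + 1))) := by
  set g : ℕ → ℝ := fun i => ∑ j ∈ Finset.range r, x j * M i j - x i * E i with hg
  have h1 : ∑ i ∈ Finset.range r, ∑ j ∈ Finset.range r, b i * x j * M i j -
      ∑ j ∈ Finset.range r, b j * x j * E j = ∑ i ∈ Finset.range r, b i * g i := by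
    rw [← Finset.sum_sub_distrib]
    refine Finset.sum_congr rfl fun i _ => ?_
    rw [hg, mul_sub, Finset.mul_sum]
    simp only [mul_assoc]
  rw [h1, sum_mul_by_parts, hbr, zero_mul, add_zero, Finset.mul_sum]
  refine Finset.sum_le_sum fun k hk => ?_
  have hkr : k < r := Finset.mem_range.1 hk
  have hG : ∑ i ∈ Finset.range (k + 1), g i ≤ (k + 1) * δ * x (k + 1) := by
    set y := x (k + 1) with hy
    have hsub : Finset.range (k + 1) ⊆ Finset.range r := Finset.range_subset_range.2 hkr
    have h2 : ∑ i ∈ Finset.range (k + 1), ∑ j ∈ Finset.range r, x j * M i j =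
        ∑ j ∈ Finset.range r, (x j - y) * ∑ i ∈ Finset.range (k + 1), M i j +
          y * ∑ i ∈ Finset.range (k + 1), ∑ j ∈ Finset.range r, M i j := by
      rw [Finset.sum_comm, Finset.sum_comm (f := fun i j => M i j), Finset.mul_sum,
        ← Finset.sum_add_distrib]
      refine Finset.sum_congr rfl fun j _ => ?_
      rw [← Finset.mul_sum]
      ring
    have hE : ∀ j, 0 ≤ E j := fun j => (Finset.sum_nonneg fun i _ => hM i j).trans (hcol j)
    have h3 : ∑ j ∈ Finset.range r, (x j - y) * ∑ i ∈ Finset.range (k + 1), M i j ≤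
        ∑ j ∈ Finset.range (k + 1), (x j - y) * E j := by
      rw [← Finset.sum_sdiff hsub]
      have h4 : ∑ j ∈ Finset.range r \ Finset.range (k + 1),
          (x j - y) * ∑ i ∈ Finset.range (k + 1), M i j ≤ 0 := by
        refine Finset.sum_nonpos fun j hj => ?_
        have : k + 1 ≤ j := by
          simp only [Finset.mem_sdiff, Finset.mem_range] at hj; omega
        exact mul_nonpos_of_nonpos_of_nonneg (sub_nonpos.2 (hx this))
          (Finset.sum_nonneg fun i _ => hM i j)
      have h5 : ∑ j ∈ Finset.range (k + 1), (x j - y) * ∑ i ∈ Finset.range (k + 1), M i j ≤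
          ∑ j ∈ Finset.range (k + 1), (x j - y) * E j := by
        refine Finset.sum_le_sum fun j hj => ?_
        have : j ≤ k + 1 := by simp at hj; omega
        refine mul_le_mul_of_nonneg_left (le_trans ?_ (hcol j)) (sub_nonneg.2 (hx this))
        exact Finset.sum_le_sum_of_subset_of_nonneg hsub fun i _ _ => hM i j
      linarith
    have h6 : y * ∑ i ∈ Finset.range (k + 1), ∑ j ∈ Finset.range r, M i j ≤
        y * ∑ i ∈ Finset.range (k + 1), (E i + δ) :=
      mul_le_mul_of_nonneg_left (Finset.sum_le_sum fun i _ => hrow i) (hx0 _)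
    have h7 : ∑ j ∈ Finset.range (k + 1), (x j - y) * E j + y * ∑ i ∈ Finset.range (k + 1), (E i + δ) =
        ∑ j ∈ Finset.range (k + 1), x j * E j + (k + 1) * δ * y := by
      rw [Finset.sum_add_distrib, mul_add, Finset.mul_sum, ← add_assoc, ← Finset.sum_add_distrib,
        Finset.sum_const, Finset.card_range, nsmul_eq_mul]
      push_cast
      congr 1
      · exact Finset.sum_congr rfl fun j _ => by ring
      · ring
    rw [hg, Finset.sum_sub_distrib, h2]
    linarith
  calc _ ≤ (b k - b (k + 1)) * ((k + 1) * δ * x (k + 1)) :=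
        mul_le_mul_of_nonneg_left hG (sub_nonneg.2 (hb (Nat.le_succ k)))
    _ = _ := by ring

/-- The right-hand side of the logarithmic Sobolev inequality for the distribution `y`. -/
noncomputable def diagFlux (a : ℝ) (r : ℕ) (y : ℕ → ℝ) : ℝ :=
  ∑ k ∈ Finset.range r, (k + 1) * (y (k + 1) ^ a * y k ^ (1 - a) - y (k + 1))

/-- Weighted AM-GM bounds each summand by `(1 - a) (k + 1) (y k - y (k + 1))`, which is then summed
by parts. -/
theorem diagFlux_le {a : ℝ} (ha0 : 0 < a) (ha1 : a < 1) {r : ℕ} {y : ℕ → ℝ} (hy : ∀ k, 0 ≤ y k) :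
    diagFlux a r y ≤ (1 - a) * ∑ k ∈ Finset.range r, y k := by
  have h1 : diagFlux a r y ≤ ∑ k ∈ Finset.range r, (1 - a) * ((k + 1) * (y k - y (k + 1))) := by
    refine Finset.sum_le_sum fun k _ => ?_
    have := Real.geom_mean_le_arith_mean2_weighted ha0.le (sub_nonneg.2 ha1.le) (hy (k + 1)) (hy k)
      (by ring)
    have hk : (0 : ℝ) ≤ k + 1 := by positivity
    nlinarith
  have h2 : ∀ n, ∑ k ∈ Finset.range n, ((k : ℝ) + 1) * (y k - y (k + 1)) =
      ∑ k ∈ Finset.range n, y k - n * y n := fun n => by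
    induction n with
    | zero => simp
    | succ n ih =>
      rw [Finset.sum_range_succ, ih, Finset.sum_range_succ]
      push_cast
      ring
  rw [← Finset.mul_sum, h2] at h1
  refine h1.trans (mul_le_mul_of_nonneg_left ?_ (sub_nonneg.2 ha1.le))
  have : 0 ≤ (r : ℝ) * y r := mul_nonneg (Nat.cast_nonneg r) (hy r)
  linarith

/-- Hölder with exponents `1/a` and `1/(1-a)`. Applied to a sequence and its shift, it leaves only
the total mass and the tail mass. -/
theorem sum_rpow_mul_rpow_le {a : ℝ} (ha0 : 0 < a) (ha1 : a < 1) {ι : Type*} (s : Finset ι)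
    {f g : ι → ℝ} (hf : ∀ i, 0 ≤ f i) (hg : ∀ i, 0 ≤ g i) :
    ∑ i ∈ s, f i ^ a * g i ^ (1 - a) ≤ (∑ i ∈ s, f i) ^ a * (∑ i ∈ s, g i) ^ (1 - a) := by
  have hpq : (1 / a).HolderConjugate (1 / (1 - a)) := by
    rw [Real.holderConjugate_iff]
    constructor
    · rw [lt_div_iff₀ ha0]; linarith
    · rw [one_div, one_div, inv_inv, inv_inv]; ring
  have ha1' : 1 - a ≠ 0 := by linarith
  have h := Real.inner_le_Lp_mul_Lq_of_nonneg s hpq (f := fun i => f i ^ a)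
    (g := fun i => g i ^ (1 - a)) (fun i _ => Real.rpow_nonneg (hf i) _)
    (fun i _ => Real.rpow_nonneg (hg i) _)
  have h1 : ∀ i, (f i ^ a) ^ (1 / a) = f i := fun i => by
    rw [← Real.rpow_mul (hf i), mul_one_div_cancel ha0.ne', Real.rpow_one]
  have h2 : ∀ i, (g i ^ (1 - a)) ^ (1 / (1 - a)) = g i := fun i => by
    rw [← Real.rpow_mul (hg i), mul_one_div_cancel ha1', Real.rpow_one]
  simpa only [h1, h2, one_div_one_div] using h

/-- The value of `-μ` at `w = z ^ (1 / a)`. -/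
noncomputable def entropyWeight (a w : ℝ) : ℝ :=
  (a * w ^ (a - 1) - 1 + (1 - a) * w ^ a) / -Real.log w

/-- The value of the functional at the geometric distribution of ratio `w`. -/
noncomputable def geomValue (a w : ℝ) : ℝ :=
  (1 - a) * w ^ a + entropyWeight a w * Real.log (1 - w)

/-- In the variable `log w` the numerator is convex and vanishes at `0`, so the slope of its chord
to the origin is monotone. -/
theorem entropyWeight_antitone {a : ℝ} (ha0 : 0 < a) (ha1 : a < 1) {r w : ℝ} (hr0 : 0 < r)
    (hrw : r ≤ w) (hw1 : w < 1) : entropyWeight a w ≤ entropyWeight a r := by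
  have hw0 : 0 < w := hr0.trans_le hrw
  have hlw : Real.log w < 0 := Real.log_neg hw0 hw1
  have hlr : Real.log r ≤ Real.log w := Real.log_le_log hr0 hrw
  have hlr0 : Real.log r < 0 := hlr.trans_lt hlw
  set θ := Real.log w / Real.log r with hθ
  have hθ0 : 0 ≤ θ := div_nonneg_of_nonpos hlw.le hlr0.le
  have hθ1 : θ ≤ 1 := by rw [hθ, div_le_one_of_neg hlr0]; exact hlr
  have hθl : Real.log w = θ * Real.log r := by rw [hθ, div_mul_cancel₀ _ hlr0.ne]
  have hpow : ∀ s : ℝ, w ^ s ≤ θ * r ^ s + (1 - θ) := fun s => by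
    rw [Real.rpow_def_of_pos hw0, Real.rpow_def_of_pos hr0, hθl]
    have := convexOn_exp.2 (Set.mem_univ (Real.log r * s)) (Set.mem_univ 0) hθ0
      (sub_nonneg.2 hθ1) (by ring)
    simp only [smul_eq_mul, mul_zero, add_zero, Real.exp_zero, mul_one] at this
    rwa [mul_assoc]
  have h1 := hpow (a - 1)
  have h2 := hpow a
  rw [entropyWeight, entropyWeight, div_le_div_iff₀ (by linarith) (by linarith)]
  have h3 : a * w ^ (a - 1) - 1 + (1 - a) * w ^ a ≤
      θ * (a * r ^ (a - 1) - 1 + (1 - a) * r ^ a) := by nlinarith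
  calc _ ≤ θ * (a * r ^ (a - 1) - 1 + (1 - a) * r ^ a) * -Real.log r :=
        mul_le_mul_of_nonneg_right h3 (by linarith)
    _ = _ := by rw [hθl]; ring

/-- The function whose maximum at `w` is `geomValue a w`. -/
noncomputable def geomRatio (a ν r : ℝ) : ℝ :=
  (r ^ a - r + ν * (r * Real.log r + (1 - r) * Real.log (1 - r))) / (1 - r)

theorem hasDerivAt_geomRatio {a ν r : ℝ} (hr0 : 0 < r) (hr1 : r < 1) :
    HasDerivAt (geomRatio a ν)
      ((a * r ^ (a - 1) - 1 + (1 - a) * r ^ a + ν * Real.log r) / (1 - r) ^ 2) r := by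
  have h1r : 1 - r ≠ 0 := by linarith
  have h1 : HasDerivAt (fun r : ℝ => 1 - r) (-1) r := by simpa using (hasDerivAt_id r).const_sub 1
  have h2 := Real.hasDerivAt_rpow_const (x := r) (p := a) (Or.inl hr0.ne')
  have h3 := (hasDerivAt_id r).mul (Real.hasDerivAt_log hr0.ne')
  have h4 := h1.mul (h1.log h1r)
  have h5 := ((h2.sub (hasDerivAt_id r)).add ((h3.add h4).const_mul ν)).div h1 h1r
  refine HasDerivAt.congr_deriv (f := geomRatio a ν) h5 ?_
  have hra : r ^ a = r ^ (a - 1) * r := by rw [← Real.rpow_add_one hr0.ne', sub_add_cancel]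
  simp only [Pi.add_apply, Pi.sub_apply, Pi.mul_apply, id, hra]
  field_simp
  ring

theorem geomRatio_self {a w : ℝ} (hw0 : 0 < w) (hw1 : w < 1) :
    geomRatio a (entropyWeight a w) w = geomValue a w := by
  have hl : Real.log w ≠ 0 := (Real.log_neg hw0 hw1).ne
  have hlw : entropyWeight a w * Real.log w = -(a * w ^ (a - 1) - 1 + (1 - a) * w ^ a) := by
    rw [entropyWeight]; field_simp
  have hra : w ^ a = w ^ (a - 1) * w := by rw [← Real.rpow_add_one hw0.ne', sub_add_cancel]
  have h1w : 1 - w ≠ 0 := by linarith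
  rw [geomRatio, geomValue, div_eq_iff h1w]
  rw [hra] at hlw ⊢
  linear_combination w * hlw

theorem geomRatio_le {a : ℝ} (ha0 : 0 < a) (ha1 : a < 1) {w r : ℝ} (hw0 : 0 < w) (hw1 : w < 1)
    (hr0 : 0 ≤ r) (hr1 : r < 1) : geomRatio a (entropyWeight a w) r ≤ geomValue a w := by
  rw [← geomRatio_self hw0 hw1]
  set ν := entropyWeight a w with hν
  -- The endpoint `r = 0` is included for the case of an empty tail; `r ^ a` and `r log r` are
  -- continuous there.
  have hcont : ContinuousOn (geomRatio a ν) (Set.Ico 0 1) := by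
    have h2 : Continuous fun r : ℝ => (1 - r) * Real.log (1 - r) :=
      Real.continuous_mul_log.comp (continuous_const.sub continuous_id)
    have h1 : Continuous fun r : ℝ =>
        r ^ a - r + ν * (r * Real.log r + (1 - r) * Real.log (1 - r)) :=
      ((Real.continuous_rpow_const ha0.le).sub continuous_id).add
        (continuous_const.mul (Real.continuous_mul_log.add h2))
    refine h1.continuousOn.div (by fun_prop) fun x hx => ?_
    linarith [hx.2]
  -- The derivative has the sign of `entropyWeight a x - ν`, and `ν` is the value at `w`. By
  -- monotonicity of `entropyWeight`, the function increases up to `w` and decreases after it.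
  have hsign : ∀ x, 0 < x → x < 1 →
      a * x ^ (a - 1) - 1 + (1 - a) * x ^ a + ν * Real.log x =
        (entropyWeight a x - ν) * -Real.log x := fun x hx0 hx1 => by
    have hl : Real.log x ≠ 0 := (Real.log_neg hx0 hx1).ne
    rw [entropyWeight]
    field_simp
    ring
  rcases le_total r w with hrw | hrw
  · have hmono : MonotoneOn (geomRatio a ν) (Set.Icc 0 w) := by
      refine monotoneOn_of_deriv_nonneg (convex_Icc 0 w)
        (hcont.mono fun x hx => ⟨hx.1, hx.2.trans_lt hw1⟩) ?_ ?_
      · intro x hx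
        rw [interior_Icc] at hx
        exact (hasDerivAt_geomRatio hx.1 (hx.2.trans hw1)).differentiableAt.differentiableWithinAt
      · intro x hx
        rw [interior_Icc] at hx
        rw [(hasDerivAt_geomRatio hx.1 (hx.2.trans hw1)).deriv, hsign x hx.1 (hx.2.trans hw1)]
        have h1 := entropyWeight_antitone ha0 ha1 hx.1 hx.2.le hw1
        have h2 := Real.log_neg hx.1 (hx.2.trans hw1)
        exact div_nonneg (mul_nonneg (sub_nonneg.2 h1) (by linarith)) (sq_nonneg _)
    exact hmono ⟨hr0, hrw⟩ ⟨hw0.le, le_rfl⟩ hrw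
  · have hanti : AntitoneOn (geomRatio a ν) (Set.Ico w 1) := by
      refine antitoneOn_of_deriv_nonpos (convex_Ico w 1)
        (hcont.mono fun x hx => ⟨hw0.le.trans hx.1, hx.2⟩) ?_ ?_
      · intro x hx
        rw [interior_Ico] at hx
        exact (hasDerivAt_geomRatio (hw0.trans hx.1)
          hx.2).differentiableAt.differentiableWithinAt
      · intro x hx
        rw [interior_Ico] at hx
        rw [(hasDerivAt_geomRatio (hw0.trans hx.1) hx.2).deriv, hsign x (hw0.trans hx.1) hx.2]
        have h1 := entropyWeight_antitone ha0 ha1 hw0 hx.1.le hx.2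
        have h2 := Real.log_neg (hw0.trans hx.1) hx.2
        exact div_nonpos_of_nonpos_of_nonneg
          (mul_nonpos_of_nonpos_of_nonneg (sub_nonpos.2 h1) (by linarith)) (sq_nonneg _)
    exact hanti ⟨le_rfl, hw1⟩ ⟨hrw, hr1⟩ hrw

/-- One step of the recursion for tail sums `s = y + s'`. -/
theorem tail_step_le {a : ℝ} (ha0 : 0 < a) (ha1 : a < 1) {w : ℝ} (hw0 : 0 < w) (hw1 : w < 1)
    {y s : ℝ} (hy : 0 ≤ y) (hs : 0 ≤ s) :
    s ^ a * (y + s) ^ (1 - a) - s + geomValue a w * s +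
        entropyWeight a w * (s * Real.log s + y * Real.log y) ≤
      geomValue a w * (y + s) + entropyWeight a w * ((y + s) * Real.log (y + s)) := by
  -- For `y = 0` and `s > 0` the ratio `s / (y + s)` equals `1`, outside the range of
  -- `geomRatio_le`; the two sides then coincide.
  rcases hy.eq_or_lt with rfl | hy
  · rcases hs.eq_or_lt with rfl | hs
    · simp [Real.zero_rpow ha0.ne']
    · rw [zero_add, ← Real.rpow_add hs]
      simp
  have hT : 0 < y + s := by linarith
  have hr1 : s / (y + s) < 1 := (div_lt_one hT).2 (by linarith)
  have key := geomRatio_le ha0 ha1 hw0 hw1 (div_nonneg hs hT.le) hr1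
  have h1r : 1 - s / (y + s) = y / (y + s) := by field_simp; ring
  have hyT : 0 < y / (y + s) := div_pos hy hT
  rw [geomRatio, h1r, div_le_iff₀ hyT, Real.div_rpow hs hT.le, Real.log_div hy.ne' hT.ne'] at key
  have key2 := mul_le_mul_of_nonneg_right key hT.le
  have e1 : geomValue a w * (y / (y + s)) * (y + s) = geomValue a w * y := by field_simp
  have hpow : s ^ a / (y + s) ^ a * (y + s) = s ^ a * (y + s) ^ (1 - a) := by
    rw [Real.rpow_sub hT, Real.rpow_one]
    field_simp
  have hlog : s / (y + s) * Real.log (s / (y + s)) * (y + s) =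
      s * Real.log s - s * Real.log (y + s) := by
    rcases hs.eq_or_lt with rfl | hs
    · simp
    · rw [Real.log_div hs.ne' hT.ne']
      field_simp
  have e2 : (s ^ a / (y + s) ^ a - s / (y + s) + entropyWeight a w *
      (s / (y + s) * Real.log (s / (y + s)) + y / (y + s) * (Real.log y - Real.log (y + s)))) *
        (y + s) = s ^ a / (y + s) ^ a * (y + s) - s + entropyWeight a w *
          (s / (y + s) * Real.log (s / (y + s)) * (y + s) + y * (Real.log y - Real.log (y + s))) := by
    field_simp
  rw [e1, e2, hpow, hlog] at key2
  linarith

/-- The weight `k + 1` splits into `1` for the sequence itself and `k` for its shift. -/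
theorem diagFlux_succ (a : ℝ) (r : ℕ) (y : ℕ → ℝ) :
    diagFlux a (r + 1) y =
      ∑ k ∈ Finset.range (r + 1), (y (k + 1) ^ a * y k ^ (1 - a) - y (k + 1)) +
        diagFlux a r (fun k => y (k + 1)) := by
  have h : ∑ k ∈ Finset.range (r + 1), (k : ℝ) * (y (k + 1) ^ a * y k ^ (1 - a) - y (k + 1)) =
      diagFlux a r (fun k => y (k + 1)) := by
    rw [Finset.sum_range_succ', diagFlux]
    simp
  rw [← h, ← Finset.sum_add_distrib, diagFlux]
  exact Finset.sum_congr rfl fun k _ => by ring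

/-- The logarithmic Sobolev inequality for finitely supported distributions. -/
theorem diagFlux_add_entropy_le {a : ℝ} (ha0 : 0 < a) (ha1 : a < 1) {w : ℝ} (hw0 : 0 < w)
    (hw1 : w < 1) (r : ℕ) {y : ℕ → ℝ} (hy : ∀ k, 0 ≤ y k) (hyr : ∀ k, r ≤ k → y k = 0) :
    diagFlux a r y + entropyWeight a w * ∑ k ∈ Finset.range r, y k * Real.log (y k) ≤
      geomValue a w * ∑ k ∈ Finset.range r, y k + entropyWeight a w *
        ((∑ k ∈ Finset.range r, y k) * Real.log (∑ k ∈ Finset.range r, y k)) := by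
  induction r generalizing y with
  | zero => simp [diagFlux]
  | succ r ih =>
    have h1 := ih (y := fun k => y (k + 1)) (fun k => hy _) (fun k hk => hyr _ (by omega))
    rw [diagFlux_succ, Finset.sum_range_succ' (fun k => y k * Real.log (y k)),
      Finset.sum_range_succ' y]
    set s := ∑ k ∈ Finset.range r, y (k + 1) with hs
    have hs0 : 0 ≤ s := Finset.sum_nonneg fun k _ => hy _
    -- `h1` leaves the term `s log s` of the unnormalised tail; this step trades it, with `y 0 log
    -- (y 0)`, for the term of the total mass.
    have h2 := tail_step_le ha0 ha1 hw0 hw1 (hy 0) hs0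
    have h3 := sum_rpow_mul_rpow_le ha0 ha1 (Finset.range (r + 1)) (f := fun k => y (k + 1))
      (g := y) (fun k => hy _) hy
    -- The extra last term `y (r + 1)` is zero, so Hölder involves exactly the tail `s` and the
    -- total `y 0 + s`.
    have h4 : ∑ k ∈ Finset.range (r + 1), y (k + 1) = s := by
      rw [Finset.sum_range_succ, hyr (r + 1) le_rfl, add_zero]
    rw [h4, Finset.sum_range_succ' y, ← hs, add_comm s] at h3
    rw [Finset.sum_sub_distrib, h4, add_comm s]
    linarith

/-! ### First-order behaviour of losses as `t → 0⁺` -/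

theorem exp_neg_half_sq_pow (t : ℝ) (n : ℕ) : (Real.exp (-t / 2) ^ 2) ^ n = Real.exp (-(n * t)) := by
  rw [← pow_mul, ← Real.exp_nat_mul]
  congr 1
  push_cast
  ring

theorem exp_neg_half_nonneg (t : ℝ) : 0 ≤ Real.exp (-t / 2) := (Real.exp_pos _).le

theorem exp_neg_half_le_one {t : ℝ} (ht : 0 ≤ t) : Real.exp (-t / 2) ≤ 1 :=
  Real.exp_le_one_iff.2 (by linarith)

theorem tendsto_one_sub_exp_div (s : ℝ) :
    Tendsto (fun t : ℝ => (1 - Real.exp (-(s * t))) / t) (𝓝[>] 0) (𝓝 s) := by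
  have h : HasDerivAt (fun t : ℝ => 1 - Real.exp (-(s * t))) s 0 := by
    have h1 := (((hasDerivAt_id (0 : ℝ)).const_mul s).neg.exp).const_sub 1
    exact HasDerivAt.congr_deriv (f := fun t : ℝ => 1 - Real.exp (-(s * t))) h1 (by simp)
  have h2 := (hasDerivAt_iff_tendsto_slope.1 h).mono_left (nhdsGT_le_nhdsNE 0)
  refine h2.congr fun t => ?_
  simp [slope_def_field]

theorem one_sub_exp_div_le (s : ℝ) {t : ℝ} (ht : 0 < t) : (1 - Real.exp (-(s * t))) / t ≤ s := by
  rw [div_le_iff₀ ht]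
  linarith [Real.add_one_le_exp (-(s * t))]

theorem tendsto_exp_neg_half : Tendsto (fun t : ℝ => Real.exp (-t / 2)) (𝓝[>] 0) (𝓝 1) := by
  have h : Continuous fun t : ℝ => Real.exp (-t / 2) := by fun_prop
  have := h.tendsto 0
  simp only [neg_zero, zero_div, Real.exp_zero] at this
  exact this.mono_left nhdsWithin_le_nhds

section Limits

variable {H : Type*} [NormedAddCommGroup H] [InnerProductSpace ℂ H] [CompleteSpace H]

theorem tendsto_lossProb (e : HilbertBasis ℕ ℂ H) (x : H) :
    Tendsto (fun t : ℝ => lossProb e (Real.exp (-t / 2)) x) (𝓝[>] 0) (𝓝 0) := by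
  have h := tendsto_tsum_of_dominated_convergence (𝓕 := 𝓝[>] (0 : ℝ))
    (f := fun t n => (1 - (Real.exp (-t / 2) ^ 2) ^ n) * ‖inner ℂ (e n) x‖ ^ 2)
    (g := fun _ => (0 : ℝ)) (hasSum_norm_inner_sq e x).summable (fun n => ?_) ?_
  · simpa [lossProb] using h
  · have h1 := ((tendsto_exp_neg_half.pow 2).pow n).const_sub 1 |>.mul_const (‖inner ℂ (e n) x‖ ^ 2)
    simpa using h1
  · filter_upwards [self_mem_nhdsWithin] with t ht n
    have hq := exp_neg_half_le_one (le_of_lt ht)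
    have hq2 : (Real.exp (-t / 2) ^ 2) ^ n ≤ 1 := pow_le_one₀ (by positivity)
      (pow_le_one₀ (exp_neg_half_nonneg t) hq)
    have hq3 : 0 ≤ (Real.exp (-t / 2) ^ 2) ^ n := by positivity
    rw [Real.norm_eq_abs, abs_of_nonneg (mul_nonneg (by linarith) (by positivity))]
    exact mul_le_of_le_one_left (by positivity) (by linarith)

/-- The mean photon number of a pure state. -/
noncomputable def energy (e : HilbertBasis ℕ ℂ H) (x : H) : ℝ :=
  ∑' n : ℕ, n * ‖inner ℂ (e n) x‖ ^ 2

/-- Dominated convergence: `(1 - e^{-nt}) / t` never exceeds its limit `n`. -/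
theorem tendsto_lossProb_div (e : HilbertBasis ℕ ℂ H) {x : H}
    (hx : Summable fun n : ℕ => n * ‖inner ℂ (e n) x‖ ^ 2) :
    Tendsto (fun t : ℝ => lossProb e (Real.exp (-t / 2)) x / t) (𝓝[>] 0) (𝓝 (energy e x)) := by
  have h := tendsto_tsum_of_dominated_convergence (𝓕 := 𝓝[>] (0 : ℝ))
    (f := fun t (n : ℕ) => (1 - Real.exp (-(n * t))) / t * ‖inner ℂ (e n) x‖ ^ 2) hx
    (fun n => (tendsto_one_sub_exp_div n).mul_const _) ?_
  · refine h.congr fun t => ?_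
    rw [lossProb, ← tsum_div_const]
    refine tsum_congr fun n => ?_
    rw [exp_neg_half_sq_pow]
    ring
  · filter_upwards [self_mem_nhdsWithin] with t ht n
    have ht : 0 < t := ht
    have h1 : Real.exp (-(n * t)) ≤ 1 := Real.exp_le_one_iff.2 (by
      have : 0 ≤ n * t := by positivity
      linarith)
    rw [Real.norm_eq_abs, abs_of_nonneg
      (mul_nonneg (div_nonneg (by linarith) ht.le) (by positivity))]
    exact mul_le_mul_of_nonneg_right (one_sub_exp_div_le n ht) (by positivity)

theorem tendsto_half_nhdsGT_zero : Tendsto (fun t : ℝ => t / 2) (𝓝[>] 0) (𝓝[>] 0) := by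
  refine tendsto_nhdsWithin_iff.2 ⟨?_, ?_⟩
  · have h : Continuous fun t : ℝ => t / 2 := by fun_prop
    simpa using (h.tendsto 0).mono_left nhdsWithin_le_nhds
  · filter_upwards [self_mem_nhdsWithin] with t ht
    exact half_pos (Set.mem_Ioi.1 ht)

theorem tendsto_two_mul_lossProb_half_div (e : HilbertBasis ℕ ℂ H) {x : H}
    (hx : Summable fun n : ℕ => n * ‖inner ℂ (e n) x‖ ^ 2) :
    Tendsto (fun t : ℝ => 2 * lossProb e (Real.exp (-(t / 2) / 2)) x / t) (𝓝[>] 0)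
      (𝓝 (energy e x)) := by
  refine ((tendsto_lossProb_div e hx).comp tendsto_half_nhdsGT_zero).congr fun t => ?_
  simp only [Function.comp]
  rw [div_div_eq_mul_div, mul_comm]

/-- Some partial sum of the energy exceeds `K`, and finitely many terms pass to the limit. -/
theorem tendsto_lossProb_div_atTop (e : HilbertBasis ℕ ℂ H) {x : H}
    (hx : ¬ Summable fun n : ℕ => n * ‖inner ℂ (e n) x‖ ^ 2) :
    Tendsto (fun t : ℝ => lossProb e (Real.exp (-t / 2)) x / t) (𝓝[>] 0) atTop := by
  refine tendsto_atTop.2 fun K => ?_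
  obtain ⟨N, hN⟩ := (((not_summable_iff_tendsto_nat_atTop_of_nonneg
    fun n => by positivity).1 hx).eventually_gt_atTop K).exists
  have h1 : Tendsto (fun t : ℝ => ∑ n ∈ Finset.range N, (1 - Real.exp (-(n * t))) / t *
      ‖inner ℂ (e n) x‖ ^ 2) (𝓝[>] 0) (𝓝 (∑ n ∈ Finset.range N, n * ‖inner ℂ (e n) x‖ ^ 2)) :=
    tendsto_finsetSum _ fun n _ => (tendsto_one_sub_exp_div n).mul_const _
  filter_upwards [h1.eventually_const_lt hN, self_mem_nhdsWithin] with t h2 ht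
  have ht : 0 < t := ht
  refine h2.le.trans ?_
  have hs := hasSum_lossProb e (exp_neg_half_nonneg t) (exp_neg_half_le_one ht.le) x
  have h3 := sum_le_hasSum (Finset.range N) (fun n _ => ?_) hs
  · rw [le_div_iff₀ ht, Finset.sum_mul]
    refine le_trans (le_of_eq ?_) h3
    refine Finset.sum_congr rfl fun n _ => ?_
    rw [exp_neg_half_sq_pow]
    field_simp
  · have : (Real.exp (-t / 2) ^ 2) ^ n ≤ 1 := pow_le_one₀ (by positivity)
      (pow_le_one₀ (exp_neg_half_nonneg t) (exp_neg_half_le_one ht.le))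
    exact mul_nonneg (by linarith) (by positivity)

theorem tendsto_one_sub_sq_div :
    Tendsto (fun t : ℝ => (1 - Real.exp (-t / 2) ^ 2) / t) (𝓝[>] 0) (𝓝 1) := by
  refine (tendsto_one_sub_exp_div 1).congr fun t => ?_
  have := exp_neg_half_sq_pow t 1
  simp only [pow_one, Nat.cast_one] at this
  rw [this]

theorem one_sub_sq_div_le {t : ℝ} (ht : 0 < t) : (1 - Real.exp (-t / 2) ^ 2) / t ≤ 1 := by
  have := exp_neg_half_sq_pow t 1
  simp only [pow_one, Nat.cast_one] at this
  rw [this]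
  exact one_sub_exp_div_le 1 ht

/-- Losing exactly one photon already exhausts the rate of loss, so `k ≥ 2` is negligible at first
order. -/
theorem tendsto_norm_kraus_one_sq_div (e : HilbertBasis ℕ ℂ H) {x : H}
    (hx : Summable fun n : ℕ => n * ‖inner ℂ (e n) x‖ ^ 2) :
    Tendsto (fun t : ℝ => ‖kraus e (Real.exp (-t / 2)) 1 x‖ ^ 2 / t) (𝓝[>] 0)
      (𝓝 (energy e x)) := by
  have h := tendsto_tsum_of_dominated_convergence (𝓕 := 𝓝[>] (0 : ℝ))
    (f := fun t (n : ℕ) => n * ((1 - Real.exp (-t / 2) ^ 2) / t) *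
      (Real.exp (-t / 2) ^ 2) ^ (n - 1) * ‖inner ℂ (e n) x‖ ^ 2)
    (g := fun n : ℕ => n * ‖inner ℂ (e n) x‖ ^ 2) hx (fun n => ?_) ?_
  · refine h.congr' ?_
    filter_upwards [self_mem_nhdsWithin] with t ht
    have ht : 0 < t := ht
    rw [← (hasSum_norm_kraus_sq e (exp_neg_half_nonneg t)
      (exp_neg_half_le_one ht.le) 1 x).tsum_eq, ← tsum_div_const]
    refine tsum_congr fun n => ?_
    rw [lossAmp_sq (exp_neg_half_nonneg t) (exp_neg_half_le_one ht.le), Nat.choose_one_right]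
    ring
  · have h1 := ((tendsto_one_sub_sq_div.const_mul (n : ℝ)).mul
      ((tendsto_exp_neg_half.pow 2).pow (n - 1))).mul_const (‖inner ℂ (e n) x‖ ^ 2)
    simpa using h1
  · filter_upwards [self_mem_nhdsWithin] with t ht n
    have ht : 0 < t := ht
    have hq : Real.exp (-t / 2) ^ 2 ≤ 1 :=
      pow_le_one₀ (exp_neg_half_nonneg t) (exp_neg_half_le_one ht.le)
    have h0 : 0 ≤ (1 - Real.exp (-t / 2) ^ 2) / t := div_nonneg (by linarith) ht.le
    rw [Real.norm_eq_abs, abs_of_nonneg (by positivity)]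
    refine mul_le_mul_of_nonneg_right ?_ (by positivity)
    rw [mul_assoc]
    refine mul_le_of_le_one_right (by positivity) ?_
    exact mul_le_one₀ (one_sub_sq_div_le ht) (by positivity) (pow_le_one₀ (by positivity) hq)

/-- The matrix element `⟨x, a y⟩`. -/
noncomputable def ladderElement (e : HilbertBasis ℕ ℂ H) (x y : H) : ℂ :=
  ∑' m : ℕ, inner ℂ x (e m) * ((Real.sqrt (m + 1) : ℂ) * inner ℂ (e (m + 1)) y)

/-- The factor `√(1 - q²)` of `K₁` accounts for `t` after squaring, and the rest of `K₁` tends to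
`a`. Finite energy of `y` alone dominates the series; `x` is arbitrary. -/
theorem tendsto_inner_kraus_one_div (e : HilbertBasis ℕ ℂ H) (x : H) {y : H}
    (hy : Summable fun n : ℕ => n * ‖inner ℂ (e n) y‖ ^ 2) :
    Tendsto (fun t : ℝ => ‖inner ℂ x (kraus e (Real.exp (-t / 2)) 1 y)‖ ^ 2 / t) (𝓝[>] 0)
      (𝓝 (‖ladderElement e x y‖ ^ 2)) := by
  have hy1 : Summable fun m : ℕ => ((m + 1 : ℕ) : ℝ) * ‖inner ℂ (e (m + 1)) y‖ ^ 2 :=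
    (summable_nat_add_iff (f := fun n : ℕ => (n : ℝ) * ‖inner ℂ (e n) y‖ ^ 2) 1).2 hy
  have hbound : ∀ (m : ℕ) (b : ℝ), 0 ≤ b → b ≤ 1 → ‖(b : ℂ) * (inner ℂ x (e m) *
      ((Real.sqrt (m + 1) : ℂ) * inner ℂ (e (m + 1)) y))‖ ≤
      ‖inner ℂ (e m) x‖ ^ 2 + ((m + 1 : ℕ) : ℝ) * ‖inner ℂ (e (m + 1)) y‖ ^ 2 := fun m b hb0 hb1 => by
    rw [norm_mul, norm_mul, norm_mul, Complex.norm_real, Complex.norm_real, Real.norm_eq_abs,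
      abs_of_nonneg hb0, Real.norm_eq_abs, abs_of_nonneg (Real.sqrt_nonneg _), norm_inner_symm]
    have h1 : ‖inner ℂ (e m) x‖ * (Real.sqrt (m + 1) * ‖inner ℂ (e (m + 1)) y‖) ≤
        ‖inner ℂ (e m) x‖ ^ 2 + ((m + 1 : ℕ) : ℝ) * ‖inner ℂ (e (m + 1)) y‖ ^ 2 := by
      have h2 : ((m + 1 : ℕ) : ℝ) * ‖inner ℂ (e (m + 1)) y‖ ^ 2 =
          (Real.sqrt (m + 1) * ‖inner ℂ (e (m + 1)) y‖) ^ 2 := by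
        rw [mul_pow, Real.sq_sqrt (by positivity)]; push_cast; ring
      rw [h2]
      have h3 := two_mul_le_add_sq ‖inner ℂ (e m) x‖ (Real.sqrt (m + 1) * ‖inner ℂ (e (m + 1)) y‖)
      have h4 : 0 ≤ ‖inner ℂ (e m) x‖ * (Real.sqrt (m + 1) * ‖inner ℂ (e (m + 1)) y‖) := by
        positivity
      linarith
    exact (mul_le_of_le_one_left (by positivity) hb1).trans h1
  have h := tendsto_tsum_of_dominated_convergence (𝓕 := 𝓝[>] (0 : ℝ))
    (f := fun t (m : ℕ) => ((Real.exp (-t / 2) ^ m : ℝ) : ℂ) * (inner ℂ x (e m) *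
      ((Real.sqrt (m + 1) : ℂ) * inner ℂ (e (m + 1)) y)))
    (g := fun m : ℕ => inner ℂ x (e m) * ((Real.sqrt (m + 1) : ℂ) * inner ℂ (e (m + 1)) y))
    ((hasSum_norm_inner_sq e x).summable.add hy1) (fun m => ?_) ?_
  · have h2 := tendsto_one_sub_sq_div.mul (h.norm.pow 2)
    rw [one_mul] at h2
    refine h2.congr' ?_
    filter_upwards [self_mem_nhdsWithin] with t ht
    have ht : 0 < t := ht
    have hq : Real.exp (-t / 2) ^ 2 ≤ 1 :=
      pow_le_one₀ (exp_neg_half_nonneg t) (exp_neg_half_le_one ht.le)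
    have h3 : inner ℂ x (kraus e (Real.exp (-t / 2)) 1 y) =
        (Real.sqrt (1 - Real.exp (-t / 2) ^ 2) : ℂ) * ∑' m : ℕ, ((Real.exp (-t / 2) ^ m : ℝ) : ℂ) *
          (inner ℂ x (e m) * ((Real.sqrt (m + 1) : ℂ) * inner ℂ (e (m + 1)) y)) := by
      rw [← (e.hasSum_inner_mul_inner x _).tsum_eq, ← tsum_mul_left]
      refine tsum_congr fun m => ?_
      rw [inner_kraus e (exp_neg_half_nonneg t) (exp_neg_half_le_one ht.le), lossAmp,
        Nat.choose_one_right, Nat.add_sub_cancel, pow_one]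
      push_cast
      ring
    rw [h3, norm_mul, mul_pow, Complex.norm_real, Real.norm_eq_abs, sq_abs,
      Real.sq_sqrt (by linarith)]
    ring
  · have h1 : Tendsto (fun t : ℝ => ((Real.exp (-t / 2) ^ m : ℝ) : ℂ)) (𝓝[>] 0) (𝓝 1) := by
      have := (Complex.continuous_ofReal.tendsto _).comp (tendsto_exp_neg_half.pow m)
      simpa [Function.comp_def] using this
    simpa using h1.mul_const (inner ℂ x (e m) *
      ((Real.sqrt (m + 1) : ℂ) * inner ℂ (e (m + 1)) y))
  · filter_upwards [self_mem_nhdsWithin] with t ht m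
    have ht : 0 < t := ht
    exact hbound m _ (pow_nonneg (exp_neg_half_nonneg t) m)
      (pow_le_one₀ (exp_neg_half_nonneg t) (exp_neg_half_le_one ht.le))

/-- The `k = 1` term carries the limit; the others are at most `‖x‖²` times the probability of
losing two or more photons. -/
theorem tendsto_lossOverlap_div (e : HilbertBasis ℕ ℂ H) (x : H) {y : H}
    (hy : Summable fun n : ℕ => n * ‖inner ℂ (e n) y‖ ^ 2) :
    Tendsto (fun t : ℝ => lossOverlap e (Real.exp (-t / 2)) x y / t) (𝓝[>] 0)
      (𝓝 (‖ladderElement e x y‖ ^ 2)) := by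
  have h1 := tendsto_inner_kraus_one_div e x hy
  have h2 := ((tendsto_lossProb_div e hy).sub (tendsto_norm_kraus_one_sq_div e hy)).const_mul
    (‖x‖ ^ 2)
  rw [sub_self, mul_zero] at h2
  have h3 := h1.add h2
  rw [add_zero] at h3
  refine tendsto_of_tendsto_of_tendsto_of_le_of_le' h1 h3 ?_ ?_
  · filter_upwards [self_mem_nhdsWithin] with t ht
    have ht : 0 < t := ht
    have h4 := hasSum_lossOverlap e (exp_neg_half_nonneg t) (exp_neg_half_le_one ht.le) x y
    exact div_le_div_of_nonneg_right (le_hasSum h4 0 fun _ _ => by positivity) ht.le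
  · filter_upwards [self_mem_nhdsWithin] with t ht
    have ht : 0 < t := ht
    have h4 := hasSum_lossOverlap e (exp_neg_half_nonneg t) (exp_neg_half_le_one ht.le) x y
    have h5 := hasSum_norm_kraus_succ_sq e (exp_neg_half_nonneg t) (exp_neg_half_le_one ht.le) y
    have h6 := (hasSum_nat_add_iff' 1).2 h4
    have h7 := ((hasSum_nat_add_iff' 1).2 h5).mul_left (‖x‖ ^ 2)
    have h8 := hasSum_le (fun k => ?_) h6 h7
    · simp only [Finset.sum_range_one, zero_add] at h8
      rw [← sub_div, ← mul_div_assoc, ← add_div]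
      exact div_le_div_of_nonneg_right (by linarith) ht.le
    · rw [← mul_pow]
      exact pow_le_pow_left₀ (norm_nonneg _) (norm_inner_le_norm _ _) 2

/-- The column sums of the overlap matrix: Bessel for each `k`, then `∑ K_k† K_k`. -/
theorem sum_lossOverlap_le_lossProb {r : ℕ} {φ : Fin r → H} (e : HilbertBasis ℕ ℂ H)
    (hφ : Orthonormal ℂ φ) {q : ℝ} (hq0 : 0 ≤ q) (hq1 : q ≤ 1) (y : H) :
    ∑ i, lossOverlap e q (φ i) y ≤ lossProb e q y :=
  hasSum_le (fun _ => hφ.sum_inner_products_le _)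
    (hasSum_sum fun i _ => hasSum_lossOverlap e hq0 hq1 (φ i) y)
    (hasSum_norm_kraus_succ_sq e hq0 hq1 y)

theorem norm_inner_kraus_eq (e : HilbertBasis ℕ ℂ H) (q : ℝ) (k : ℕ) (x y : H) :
    ‖inner ℂ x (kraus e q k y)‖ = ‖inner ℂ y (star (kraus e q k) x)‖ := by
  rw [ContinuousLinearMap.star_eq_adjoint, ContinuousLinearMap.adjoint_inner_right,
    norm_inner_symm]

/-- The row sums: with the Kraus operators moved to the other vector, Bessel leads to `∑ K_k K_k†`,
whose excess stands for the `1` in `a a† = a† a + 1`. -/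
theorem sum_lossOverlap_le {r : ℕ} {φ : Fin r → H} (e : HilbertBasis ℕ ℂ H)
    (hφ : Orthonormal ℂ φ) {q : ℝ} (hq0 : 0 < q) (hq1 : q ≤ 1) (x : H) :
    ∑ j, lossOverlap e q x (φ j) ≤ ((q ^ 2)⁻¹ - 1) * ‖x‖ ^ 2 + lossProb e q x := by
  refine hasSum_le (fun k => ?_) (hasSum_sum fun j _ => hasSum_lossOverlap e hq0.le hq1 x (φ j))
    (hasSum_norm_adjoint_kraus_succ_sq e hq0 hq1 x)
  simp_rw [norm_inner_kraus_eq]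
  exact hφ.sum_inner_products_le _

/-- The bound involves the loss of `x` only, so it is `O(t)` when `x` has boundedly many photons,
even if `y` has infinite energy. -/
theorem lossOverlap_le (e : HilbertBasis ℕ ℂ H) {q : ℝ} (hq0 : 0 < q) (hq1 : q ≤ 1) (x y : H) :
    lossOverlap e q x y ≤ ‖y‖ ^ 2 * (((q ^ 2)⁻¹ - 1) * ‖x‖ ^ 2 + lossProb e q x) := by
  refine hasSum_le (fun k => ?_) (hasSum_lossOverlap e hq0.le hq1 x y)
    ((hasSum_norm_adjoint_kraus_succ_sq e hq0 hq1 x).mul_left (‖y‖ ^ 2))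
  rw [norm_inner_kraus_eq, ← mul_pow]
  exact pow_le_pow_left₀ (norm_nonneg _) (norm_inner_le_norm _ _) 2

theorem lossOverlap_le_norm_mul_lossProb (e : HilbertBasis ℕ ℂ H) {q : ℝ} (hq0 : 0 ≤ q)
    (hq1 : q ≤ 1) (x y : H) : lossOverlap e q x y ≤ ‖x‖ ^ 2 * lossProb e q y := by
  refine hasSum_le (fun k => ?_) (hasSum_lossOverlap e hq0 hq1 x y)
    ((hasSum_norm_kraus_succ_sq e hq0 hq1 y).mul_left (‖x‖ ^ 2))
  rw [← mul_pow]
  exact pow_le_pow_left₀ (norm_nonneg _) (norm_inner_le_norm _ _) 2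

theorem lossOverlap_add_le (e : HilbertBasis ℕ ℂ H) {q : ℝ} (hq0 : 0 ≤ q) (hq1 : q ≤ 1)
    (x x' y : H) : lossOverlap e q (x + x') y ≤
      2 * lossOverlap e q x y + 2 * lossOverlap e q x' y := by
  refine hasSum_le (fun k => ?_) (hasSum_lossOverlap e hq0 hq1 (x + x') y)
    (((hasSum_lossOverlap e hq0 hq1 x y).mul_left 2).add
      ((hasSum_lossOverlap e hq0 hq1 x' y).mul_left 2))
  rw [inner_add_left]
  have h1 := norm_add_le (inner ℂ x (kraus e q (k + 1) y)) (inner ℂ x' (kraus e q (k + 1) y))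
  have h2 := pow_le_pow_left₀ (norm_nonneg _) h1 2
  have h3 := two_mul_le_add_sq ‖inner ℂ x (kraus e q (k + 1) y)‖ ‖inner ℂ x' (kraus e q (k + 1) y)‖
  nlinarith

theorem lossProb_fockProj_le (e : HilbertBasis ℕ ℂ H) (N : ℕ) (x : H) {t : ℝ} (ht : 0 ≤ t) :
    lossProb e (Real.exp (-t / 2)) (fockProj e N x) ≤ N * t * ‖fockProj e N x‖ ^ 2 := by
  refine hasSum_le (fun n => ?_)
    (hasSum_lossProb e (exp_neg_half_nonneg t) (exp_neg_half_le_one ht) _)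
    ((hasSum_norm_inner_sq e (fockProj e N x)).mul_left (N * t))
  rw [inner_fockProj]
  split_ifs with hn
  · refine mul_le_mul_of_nonneg_right ?_ (by positivity)
    rw [exp_neg_half_sq_pow]
    have h1 := Real.add_one_le_exp (-(n * t))
    have h2 : (n : ℝ) * t ≤ N * t := mul_le_mul_of_nonneg_right (by exact_mod_cast hn) ht
    linarith
  · simp

/-- A fixed state catches only a small fraction of the output that has lost photons. -/
theorem exists_lossOverlap_le (e : HilbertBasis ℕ ℂ H) (x y : H) {ε : ℝ} (hε : 0 < ε) :
    ∃ C : ℝ, ∀ t : ℝ, 0 < t → t ≤ 1 → lossOverlap e (Real.exp (-t / 2)) x y ≤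
      ε * lossProb e (Real.exp (-t / 2)) y + C * t := by
  -- Split `x` into `P_N x`, which contributes `O(t)`, and a tail with twice its squared norm below
  -- `ε`.
  have hlim : Tendsto (fun N => 2 * ‖x - fockProj e N x‖ ^ 2) atTop (𝓝 0) := by
    have h1 := (((tendsto_fockProj e x).const_sub x).norm.pow 2).const_mul 2
    simpa using h1
  obtain ⟨N, hN⟩ := (hlim.eventually_lt_const hε).exists
  refine ⟨2 * (‖y‖ ^ 2 * ((2 + N) * ‖fockProj e N x‖ ^ 2)), fun t ht ht1 => ?_⟩
  have hq0 : 0 < Real.exp (-t / 2) := Real.exp_pos _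
  have hq1 := exp_neg_half_le_one ht.le
  have hu := lossProb_nonneg e hq0.le hq1 y
  have h1 := lossOverlap_add_le e hq0.le hq1 (fockProj e N x) (x - fockProj e N x) y
  rw [add_sub_cancel] at h1
  have h2 := lossOverlap_le e hq0 hq1 (fockProj e N x) y
  have h3 := lossOverlap_le_norm_mul_lossProb e hq0.le hq1 (x - fockProj e N x) y
  have h4 := lossProb_fockProj_le e N x ht.le
  have h5 : (Real.exp (-t / 2) ^ 2)⁻¹ - 1 ≤ 2 * t := by
    have h6 : (Real.exp (-t / 2) ^ 2)⁻¹ = Real.exp t := by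
      have := exp_neg_half_sq_pow t 1
      simp only [pow_one, Nat.cast_one, one_mul] at this
      rw [this, Real.exp_neg, inv_inv]
    rw [h6]
    have h7 := Real.abs_exp_sub_one_le (x := t) (by rw [abs_of_pos ht]; exact ht1)
    rw [abs_of_pos ht] at h7
    exact (le_abs_self _).trans h7
  have h8 : ((Real.exp (-t / 2) ^ 2)⁻¹ - 1) * ‖fockProj e N x‖ ^ 2 ≤
      2 * t * ‖fockProj e N x‖ ^ 2 := mul_le_mul_of_nonneg_right h5 (by positivity)
  have h9 : ‖y‖ ^ 2 * (((Real.exp (-t / 2) ^ 2)⁻¹ - 1) * ‖fockProj e N x‖ ^ 2 +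
      lossProb e (Real.exp (-t / 2)) (fockProj e N x)) ≤
      ‖y‖ ^ 2 * ((2 + N) * ‖fockProj e N x‖ ^ 2) * t := by
    rw [mul_assoc]
    refine mul_le_mul_of_nonneg_left ?_ (by positivity)
    linarith
  nlinarith [mul_le_mul_of_nonneg_right hN.le hu]

end Limits

/-! ### From the trace of a power to the logarithm of the norm -/

section LogNorm

variable {H : Type*} [NormedAddCommGroup H] [InnerProductSpace ℂ H] [CompleteSpace H]

theorem logNorm_eq (e : HilbertBasis ℕ ℂ H) {a : ℝ} (ha0 : 0 < a) {X : H →L[ℂ] H} {t : ℝ}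
    (hY : 0 ≤ attenuator e t X) : logNorm e a X t =
      a * Real.log (trace e (power (attenuator e t X) (1 / a))).toReal := by
  have hp : 0 < 1 / a := by positivity
  rw [logNorm, schattenNorm, power_star_mul_self hY hp, one_div_one_div, ← ENNReal.toReal_rpow]
  -- If `toReal` of the trace is zero, both sides are zero because `Real.log 0 = 0`.
  rcases ENNReal.toReal_nonneg.eq_or_lt (a := 0)
    (b := (trace e (power (attenuator e t X) (1 / a))).toReal) with h | h
  · rw [← h, Real.zero_rpow ha0.ne', Real.log_zero, mul_zero]
  · rw [Real.log_rpow h]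

theorem hasDerivWithinAt_logNorm (e : HilbertBasis ℕ ℂ H) {a : ℝ} (ha0 : 0 < a) {X : H →L[ℂ] H}
    (hY : ∀ t, 0 ≤ t → 0 ≤ attenuator e t X) {T : ℝ → ℝ} {T' : ℝ}
    (hT : ∀ t, 0 ≤ t → (trace e (power (attenuator e t X) (1 / a))).toReal = T t) (hT0 : 0 < T 0)
    (hd : HasDerivWithinAt T T' (Set.Ici 0) 0) :
    HasDerivWithinAt (logNorm e a X) (a * (T' / T 0)) (Set.Ici 0) 0 := by
  have h1 := (hd.log hT0.ne').const_mul a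
  refine h1.congr (fun t ht => ?_) ?_
  · rw [logNorm_eq e ha0 (hY t ht), hT t ht]
  · rw [logNorm_eq e ha0 (hY 0 le_rfl), hT 0 le_rfl]

theorem tendsto_logNormSlope (e : HilbertBasis ℕ ℂ H) {a : ℝ} {X : H →L[ℂ] H} {d : ℝ}
    (h : HasDerivWithinAt (logNorm e a X) d (Set.Ici 0) 0) :
    Tendsto (logNormSlope e a X) (𝓝[>] 0) (𝓝 d) := by
  have h1 := hasDerivWithinAt_iff_tendsto_slope.1 h
  rw [Set.Ici_sdiff_left] at h1
  refine h1.congr fun t => ?_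
  rw [slope_def_field, logNormSlope, sub_zero]

theorem Fa_eq_of_tendsto (e : HilbertBasis ℕ ℂ H) {a : ℝ} {X : H →L[ℂ] H} {d : EReal}
    (h : Tendsto (fun t : ℝ => ((logNormSlope e a X t : ℝ) : EReal)) (𝓝[>] 0) (𝓝 d)) :
    Fa e a X = d := h.limsup_eq

theorem Fa_eq_of_hasDerivWithinAt (e : HilbertBasis ℕ ℂ H) {a : ℝ} {X : H →L[ℂ] H} {d : ℝ}
    (h : HasDerivWithinAt (logNorm e a X) d (Set.Ici 0) 0) : Fa e a X = d :=
  Fa_eq_of_tendsto e ((continuous_coe_real_ereal.tendsto d).comp (tendsto_logNormSlope e h))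

end LogNorm

/-! ### The right derivative of the trace of a power -/

section FiniteRank

variable {H : Type*} [NormedAddCommGroup H] [InnerProductSpace ℂ H] [CompleteSpace H]
  {r : ℕ} {φ : Fin r → H} {c : Fin r → ℝ}

theorem tendsto_sum_mul_lossProb (e : HilbertBasis ℕ ℂ H) :
    Tendsto (fun t : ℝ => ∑ j, c j * lossProb e (Real.exp (-t / 2)) (φ j)) (𝓝[>] 0) (𝓝 0) := by
  have := tendsto_finsetSum Finset.univ fun j _ => (tendsto_lossProb e (φ j)).const_mul (c j)
  simpa using this

/-- In the Fock-indexed frames the difference is `∑ (1 - q^{2n}) |v_n⟩⟨v_n|`, so its norm is at most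
a weighted loss. -/
theorem norm_diagonal_sub_dampedGram_le (e : HilbertBasis ℕ ℂ H) (hφ : Orthonormal ℂ φ)
    (hc : ∀ i, 0 ≤ c i) {q : ℝ} (hq0 : 0 ≤ q) (hq1 : q ≤ 1) :
    ‖diagonal φ c - dampedGram e φ c q‖ ≤ ∑ j, c j * lossProb e q (φ j) := by
  have h1 := (isFrame_diagonal_sqrt_basis e hφ hc).hasSum.sub
    (isFrame_dampedGram e hφ hc hq0 hq1).hasSum
  rw [← h1.tsum_eq]
  refine tsum_of_norm_bounded (sum_mul_lossProb (φ := φ) e hq0 hq1 c) fun n => ?_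
  set v := diagonal φ (fun i => Real.sqrt (c i)) (e n) with hv
  have hq : (q ^ 2) ^ n ≤ 1 := pow_le_one₀ (by positivity) (pow_le_one₀ hq0 hq1)
  have h2 : rankOne ℂ v v - rankOne ℂ (((q ^ n : ℝ) : ℂ) • v) (((q ^ n : ℝ) : ℂ) • v) =
      ((1 - (q ^ 2) ^ n : ℝ) : ℂ) • rankOne ℂ v v := by
    simp only [map_smulₛₗ, smul_apply, smul_smul, Complex.conj_ofReal, RingHom.id_apply]
    rw [← pow_mul, mul_comm 2 n, pow_mul, pow_two]
    push_cast
    rw [sub_smul, one_smul]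
  rw [h2, norm_smul, norm_rankOne, Complex.norm_real, Real.norm_eq_abs,
    abs_of_nonneg (by linarith), ← pow_two, hv, norm_diagonal_sqrt_apply_sq hφ hc]

theorem tendsto_dampedGram (e : HilbertBasis ℕ ℂ H) (hφ : Orthonormal ℂ φ) (hc : ∀ i, 0 ≤ c i) :
    Tendsto (fun t : ℝ => dampedGram e φ c (Real.exp (-t / 2))) (𝓝[>] 0) (𝓝 (diagonal φ c)) := by
  rw [tendsto_iff_norm_sub_tendsto_zero]
  refine squeeze_zero' (Eventually.of_forall fun _ => norm_nonneg _) ?_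
    (tendsto_sum_mul_lossProb (φ := φ) (c := c) e)
  filter_upwards [self_mem_nhdsWithin] with t ht
  rw [norm_sub_rev]
  exact norm_diagonal_sub_dampedGram_le e hφ hc (exp_neg_half_nonneg t)
    (exp_neg_half_le_one (le_of_lt ht))

theorem tendsto_kraus_zero (e : HilbertBasis ℕ ℂ H) (x : H) :
    Tendsto (fun t : ℝ => kraus e (Real.exp (-t / 2)) 0 x) (𝓝[>] 0) (𝓝 x) := by
  rw [tendsto_iff_norm_sub_tendsto_zero]
  have h := (tendsto_lossProb e x).sqrt
  rw [Real.sqrt_zero] at h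
  refine squeeze_zero' (Eventually.of_forall fun _ => norm_nonneg _) ?_ h
  filter_upwards [self_mem_nhdsWithin] with t ht
  exact Real.le_sqrt_of_sq_le (norm_sub_kraus_zero_sq_le e (exp_neg_half_nonneg t)
    (exp_neg_half_le_one (le_of_lt ht)) x)

/-- The `k = 0` part converges vector by vector; the remaining terms have total norm at most the
weighted loss. No energy assumption enters. -/
theorem tendsto_attenuator (e : HilbertBasis ℕ ℂ H) (hc : ∀ i, 0 ≤ c i) :
    Tendsto (fun t : ℝ => attenuator e t (diagonal φ c)) (𝓝[>] 0) (𝓝 (diagonal φ c)) := by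
  set v : Fin r → H := fun j => (Real.sqrt (c j) : ℂ) • φ j with hv
  have fX := isFrame_diagonal φ hc
  have h1 : Tendsto (fun t : ℝ => ∑ j, rankOne ℂ (kraus e (Real.exp (-t / 2)) 0 (v j))
      (kraus e (Real.exp (-t / 2)) 0 (v j))) (𝓝[>] 0) (𝓝 (diagonal φ c)) := by
    have h2 := tendsto_finsetSum Finset.univ fun j _ =>
      tendsto_rankOne_self (tendsto_kraus_zero e (v j))
    rwa [← tsum_fintype (L := .unconditional _), fX.hasSum.tsum_eq] at h2
  have h3 : Tendsto (fun t : ℝ => attenuator e t (diagonal φ c) -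
      ∑ j, rankOne ℂ (kraus e (Real.exp (-t / 2)) 0 (v j))
        (kraus e (Real.exp (-t / 2)) 0 (v j))) (𝓝[>] 0) (𝓝 0) := by
    refine squeeze_zero_norm' ?_ (tendsto_sum_mul_lossProb (φ := φ) (c := c) e)
    filter_upwards [self_mem_nhdsWithin] with t ht
    have ht : 0 ≤ t := le_of_lt ht
    have hY := (fX.attenuator (e := e) ht).hasSum
    rw [← hY.tsum_eq, hY.summable.tsum_prod, tsum_fintype, ← Finset.sum_sub_distrib]
    refine norm_sum_le_of_le _ fun j _ => ?_
    rw [(hY.summable.prod_factor j).tsum_eq_zero_add, add_sub_cancel_left]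
    refine tsum_of_norm_bounded ((hasSum_norm_kraus_succ_sq e (exp_neg_half_nonneg t)
      (exp_neg_half_le_one ht) (φ j)).mul_left (c j)) fun k => ?_
    rw [norm_rankOne, ← pow_two, map_smul, norm_smul, mul_pow, Complex.norm_real,
      Real.norm_eq_abs, sq_abs, Real.sq_sqrt (hc j)]
  simpa using h3.add h1

/-- The sequence of eigenvalues, extended by zero. -/
noncomputable def eigenSeq (c : Fin r → ℝ) (k : ℕ) : ℝ := if h : k < r then c ⟨k, h⟩ else 0

theorem eigenSeq_coe (i : Fin r) : eigenSeq c i = c i := by simp [eigenSeq]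

theorem eigenSeq_of_le {k : ℕ} (h : r ≤ k) : eigenSeq c k = 0 := by
  simp [eigenSeq, not_lt.2 h]

theorem eigenSeq_nonneg (hc : ∀ i, 0 ≤ c i) (k : ℕ) : 0 ≤ eigenSeq c k := by
  unfold eigenSeq
  split_ifs
  · exact hc _
  · rfl

theorem eigenSeq_antitone (hc : ∀ i, 0 ≤ c i) (hanti : Antitone c) : Antitone (eigenSeq c) := by
  intro k l hkl
  by_cases hl : l < r
  · rw [eigenSeq, eigenSeq, dif_pos hl, dif_pos (hkl.trans_lt hl)]
    exact hanti hkl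
  · rw [eigenSeq_of_le (not_lt.1 hl)]
    exact eigenSeq_nonneg hc k

/-- The rearrangement with `b = x^{p-1}`, overlaps as `M`, loss probabilities as `E` and `δ = q⁻² -
1`, for a fixed `q` and without any energy assumption. -/
theorem sum_lossOverlap_sub_le (e : HilbertBasis ℕ ℂ H) (hφ : Orthonormal ℂ φ)
    (hc : ∀ i, 0 < c i) (hanti : Antitone c) {a : ℝ} (ha0 : 0 < a) (ha1 : a < 1) {q : ℝ}
    (hq0 : 0 < q) (hq1 : q ≤ 1) :
    ∑ i, ∑ j, c i ^ (1 / a - 1) * c j * lossOverlap e q (φ i) (φ j) -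
        ∑ j, c j ^ (1 / a) * lossProb e q (φ j) ≤
      ((q ^ 2)⁻¹ - 1) * diagFlux a r (fun k => eigenSeq c k ^ (1 / a)) := by
  have hc0 : ∀ i, 0 ≤ c i := fun i => (hc i).le
  have hp1 : 0 < 1 / a - 1 := by rw [sub_pos, lt_div_iff₀ ha0]; linarith
  have hx0 := eigenSeq_nonneg hc0
  have hx := eigenSeq_antitone hc0 hanti
  have hδ : 0 ≤ (q ^ 2)⁻¹ - 1 :=
    sub_nonneg.2 ((one_le_inv₀ (by positivity)).2 (pow_le_one₀ hq0.le hq1))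
  -- The data are extended by zero to all of `ℕ`; beyond `r` the row bound needs `δ ≥ 0`.
  obtain ⟨E, hE⟩ : ∃ E : ℕ → ℝ, ∀ k, E k =
      if h : k < r then lossProb e q (φ ⟨k, h⟩) else 0 := ⟨_, fun _ => rfl⟩
  obtain ⟨M, hM⟩ : ∃ M : ℕ → ℕ → ℝ, ∀ i j, M i j = if h : i < r ∧ j < r then
      lossOverlap e q (φ ⟨i, h.1⟩) (φ ⟨j, h.2⟩) else 0 := ⟨_, fun _ _ => rfl⟩
  have hM0 : ∀ i j, 0 ≤ M i j := fun i j => by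
    rw [hM]
    split_ifs
    · exact lossOverlap_nonneg _ _ _ _
    · rfl
  have hcol : ∀ j, ∑ i ∈ Finset.range r, M i j ≤ E j := fun j => by
    rw [Finset.sum_range, hE]
    by_cases hj : j < r
    · simp only [hM, hj, Fin.is_lt, and_self, dite_true, Fin.eta]
      exact sum_lossOverlap_le_lossProb e hφ hq0.le hq1 (φ ⟨j, hj⟩)
    · simp [hM, hj]
  have hrow : ∀ i, ∑ j ∈ Finset.range r, M i j ≤ E i + ((q ^ 2)⁻¹ - 1) := fun i => by
    rw [Finset.sum_range, hE]
    by_cases hi : i < r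
    · simp only [hM, hi, Fin.is_lt, and_self, dite_true, Fin.eta]
      have := sum_lossOverlap_le e hφ hq0 hq1 (φ ⟨i, hi⟩)
      simp only [hφ.1 ⟨i, hi⟩, one_pow, mul_one] at this
      linarith
    · simpa [hM, hi] using hδ
  have key := sum_rearrangement_le (r := r) (b := fun k => eigenSeq c k ^ (1 / a - 1))
    (fun k l hkl => Real.rpow_le_rpow (hx0 l) (hx hkl) hp1.le)
    (by simp only [eigenSeq_of_le le_rfl]; exact Real.zero_rpow hp1.ne') hx hx0 hM0 hcol hrow
  simp only [Finset.sum_range, hM, hE, eigenSeq_coe, Fin.is_lt, and_self, dite_true, Fin.eta] at key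
  have hpow : ∀ i, c i ^ (1 / a - 1) * c i = c i ^ (1 / a) := fun i => by
    rw [← Real.rpow_add_one (hc i).ne', sub_add_cancel]
  simp only [hpow] at key
  refine key.trans (le_of_eq ?_)
  congr 1
  rw [diagFlux, Finset.sum_range]
  refine Finset.sum_congr rfl fun k _ => ?_
  have e1 : (eigenSeq c (k + 1) ^ (1 / a)) ^ a = eigenSeq c (k + 1) := by
    rw [← Real.rpow_mul (hx0 _), one_div_mul_cancel ha0.ne', Real.rpow_one]
  have e2 : (eigenSeq c k ^ (1 / a)) ^ (1 - a) = eigenSeq c k ^ (1 / a - 1) := by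
    rw [← Real.rpow_mul (hx0 _)]
    congr 1
    field_simp
  have e3 : eigenSeq c (k + 1) * eigenSeq c (k + 1) ^ (1 / a - 1) = eigenSeq c (k + 1) ^ (1 / a) := by
    rcases (hx0 (k + 1)).eq_or_lt with h | h
    · rw [← h, zero_mul, Real.zero_rpow (by positivity)]
    · rw [mul_comm, ← Real.rpow_add_one h.ne', sub_add_cancel]
  rw [e1, e2, ← e3, ← eigenSeq_coe (c := c) k]
  ring

variable {p : ℝ}

/-- At `q = 1` nothing is lost, and the upper and lower bounds on the output trace coincide. -/
theorem toReal_trace_power_attenuator_zero (e : HilbertBasis ℕ ℂ H) (hφ : Orthonormal ℂ φ)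
    (hc : ∀ i, 0 < c i) (hp : 1 < p) :
    (trace e (power (attenuator e 0 (diagonal φ c)) p)).toReal = ∑ i, c i ^ p := by
  have hu : ∀ x, lossProb e 1 x = 0 := fun x => by simp [lossProb]
  have hM : ∀ x y, lossOverlap e 1 x y = 0 := fun x y => by
    refine le_antisymm ?_ (lossOverlap_nonneg e 1 x y)
    have := lossOverlap_le_norm_mul_lossProb e zero_le_one le_rfl x y
    rwa [hu, mul_zero] at this
  have h1 := toReal_trace_power_attenuator_le e hφ hc le_rfl hp (q := 1) (by simp)
  have h2 := le_toReal_trace_power_attenuator e hφ hc le_rfl hp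
  simp only [neg_zero, zero_div, Real.exp_zero, hu, hM, mul_zero, Finset.sum_const_zero, sub_zero,
    add_zero] at h1 h2
  exact le_antisymm h1 h2

theorem tendsto_norm_power_sub (e : HilbertBasis ℕ ℂ H) (hφ : Orthonormal ℂ φ)
    (hc : ∀ i, 0 ≤ c i) (hp : 1 < p) :
    Tendsto (fun t : ℝ =>
      ‖power (attenuator e t (diagonal φ c)) (p - 1) - power (diagonal φ c) (p - 1)‖ +
        ‖power (diagonal φ c) (p - 1) -
          power (dampedGram e φ c (Real.exp (-t / 2))) (p - 1)‖) (𝓝[>] 0) (𝓝 0) := by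
  have hX := diagonal_nonneg φ hc
  have h1 := tendsto_power (sub_pos.2 hp) (tendsto_attenuator (φ := φ) e hc)
    (by
      filter_upwards [self_mem_nhdsWithin] with t ht
      exact ((isFrame_diagonal φ hc).attenuator (le_of_lt ht)).nonneg) hX
  have h2 := tendsto_power (sub_pos.2 hp) (tendsto_dampedGram e hφ hc)
    (by
      filter_upwards [self_mem_nhdsWithin] with t ht
      exact (isFrame_dampedGram e hφ hc (exp_neg_half_nonneg t)
        (exp_neg_half_le_one (le_of_lt ht))).nonneg) hX
  have h3 := (h1.sub_const (power (diagonal φ c) (p - 1))).norm.add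
    (h2.const_sub (power (diagonal φ c) (p - 1))).norm
  simpa using h3

/-- The value of `Tr [X ^ (p - 1) ℒ(X)]`. -/
noncomputable def dissipation (e : HilbertBasis ℕ ℂ H) (φ : Fin r → H) (c : Fin r → ℝ) (p : ℝ) : ℝ :=
  ∑ i, ∑ j, c i ^ (p - 1) * c j * ‖ladderElement e (φ i) (φ j)‖ ^ 2 - ∑ j, c j ^ p * energy e (φ j)

theorem tendsto_sum_lossOverlap_div (e : HilbertBasis ℕ ℂ H)
    (hE : ∀ j, Summable fun n : ℕ => n * ‖inner ℂ (e n) (φ j)‖ ^ 2) :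
    Tendsto (fun t : ℝ => (∑ i, ∑ j, c i ^ (p - 1) * c j *
      lossOverlap e (Real.exp (-t / 2)) (φ i) (φ j)) / t) (𝓝[>] 0)
      (𝓝 (∑ i, ∑ j, c i ^ (p - 1) * c j * ‖ladderElement e (φ i) (φ j)‖ ^ 2)) := by
  have h := tendsto_finsetSum Finset.univ fun i _ => tendsto_finsetSum Finset.univ fun j _ =>
    (tendsto_lossOverlap_div e (φ i) (hE j)).const_mul (c i ^ (p - 1) * c j)
  refine h.congr fun t => ?_
  simp only [Finset.sum_div, mul_div_assoc]

theorem tendsto_sum_lossProb_div (e : HilbertBasis ℕ ℂ H) (b : Fin r → ℝ)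
    (hE : ∀ j, Summable fun n : ℕ => n * ‖inner ℂ (e n) (φ j)‖ ^ 2) :
    Tendsto (fun t : ℝ => (∑ j, b j * lossProb e (Real.exp (-t / 2)) (φ j)) / t) (𝓝[>] 0)
      (𝓝 (∑ j, b j * energy e (φ j))) := by
  have h := tendsto_finsetSum Finset.univ fun j _ =>
    (tendsto_lossProb_div e (hE j)).const_mul (b j)
  refine h.congr fun t => ?_
  simp only [Finset.sum_div, mul_div_assoc]

/-- A squeeze: the loss at time `t` and twice the loss at `t / 2` both have slope `energy`, while
the error is a norm tending to `0` times a convergent quotient. -/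
theorem hasDerivWithinAt_toReal_trace_power (e : HilbertBasis ℕ ℂ H) (hφ : Orthonormal ℂ φ)
    (hc : ∀ i, 0 < c i) (hp : 1 < p)
    (hE : ∀ j, Summable fun n : ℕ => n * ‖inner ℂ (e n) (φ j)‖ ^ 2) :
    HasDerivWithinAt (fun t => (trace e (power (attenuator e t (diagonal φ c)) p)).toReal)
      (p * dissipation e φ c p) (Set.Ici 0) 0 := by
  rw [hasDerivWithinAt_iff_tendsto_slope, Set.Ici_sdiff_left]
  have hM := tendsto_sum_lossOverlap_div (c := c) (p := p) e hE
  have hlow : Tendsto (fun t : ℝ => p * ((∑ i, ∑ j, c i ^ (p - 1) * c j *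
      lossOverlap e (Real.exp (-t / 2)) (φ i) (φ j)) / t -
      (∑ j, c j ^ p * (2 * lossProb e (Real.exp (-(t / 2) / 2)) (φ j))) / t)) (𝓝[>] 0)
      (𝓝 (p * dissipation e φ c p)) := by
    refine (hM.sub ?_).const_mul p
    have h := tendsto_finsetSum Finset.univ fun j _ =>
      (tendsto_two_mul_lossProb_half_div e (hE j)).const_mul (c j ^ p)
    refine h.congr fun t => ?_
    simp only [Finset.sum_div, mul_div_assoc]
  have hup : Tendsto (fun t : ℝ => p * ((∑ i, ∑ j, c i ^ (p - 1) * c j *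
      lossOverlap e (Real.exp (-t / 2)) (φ i) (φ j)) / t -
      (∑ j, c j ^ p * lossProb e (Real.exp (-t / 2)) (φ j)) / t +
      (‖power (attenuator e t (diagonal φ c)) (p - 1) - power (diagonal φ c) (p - 1)‖ +
        ‖power (diagonal φ c) (p - 1) -
          power (dampedGram e φ c (Real.exp (-t / 2))) (p - 1)‖) *
        ((∑ j, c j * lossProb e (Real.exp (-t / 2)) (φ j)) / t))) (𝓝[>] 0)
      (𝓝 (p * dissipation e φ c p)) := by
    have h := ((hM.sub (tendsto_sum_lossProb_div e (fun j => c j ^ p) hE)).add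
      ((tendsto_norm_power_sub e hφ (fun i => (hc i).le) hp).mul
        (tendsto_sum_lossProb_div e c hE))).const_mul p
    rwa [zero_mul, add_zero] at h
  refine tendsto_of_tendsto_of_tendsto_of_le_of_le' hlow hup ?_ ?_
  · filter_upwards [self_mem_nhdsWithin] with t ht
    have ht : 0 < t := ht
    have h := le_toReal_trace_power_attenuator e hφ hc ht.le hp
    rw [slope_def_field, sub_zero, toReal_trace_power_attenuator_zero e hφ hc hp, ← sub_div,
      ← mul_div_assoc]
    exact div_le_div_of_nonneg_right (by linarith) ht.le
  · filter_upwards [self_mem_nhdsWithin] with t ht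
    have ht : 0 < t := ht
    have h := toReal_trace_power_attenuator_le e hφ hc ht.le hp rfl
    rw [slope_def_field, sub_zero, toReal_trace_power_attenuator_zero e hφ hc hp, ← sub_div,
      ← mul_div_assoc, ← add_div, ← mul_div_assoc]
    exact div_le_div_of_nonneg_right (by linarith) ht.le

theorem tendsto_inv_sq_sub_one_div :
    Tendsto (fun t : ℝ => ((Real.exp (-t / 2) ^ 2)⁻¹ - 1) / t) (𝓝[>] 0) (𝓝 1) := by
  have h := (tendsto_one_sub_exp_div (-1)).neg
  rw [neg_neg] at h
  refine h.congr fun t => ?_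
  have := exp_neg_half_sq_pow t 1
  simp only [pow_one, Nat.cast_one, one_mul] at this
  rw [this, ← Real.exp_neg, neg_neg, ← neg_div]
  simp

theorem dissipation_le (e : HilbertBasis ℕ ℂ H) (hφ : Orthonormal ℂ φ)
    (hc : ∀ i, 0 < c i) (hanti : Antitone c) {a : ℝ} (ha0 : 0 < a) (ha1 : a < 1)
    (hE : ∀ j, Summable fun n : ℕ => n * ‖inner ℂ (e n) (φ j)‖ ^ 2) :
    dissipation e φ c (1 / a) ≤ diagFlux a r (fun k => eigenSeq c k ^ (1 / a)) := by
  have h1 := (tendsto_sum_lossOverlap_div (c := c) (p := 1 / a) e hE).sub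
    (tendsto_sum_lossProb_div e (fun j => c j ^ (1 / a)) hE)
  have h2 := tendsto_inv_sq_sub_one_div.mul_const
    (diagFlux a r (fun k => eigenSeq c k ^ (1 / a)))
  rw [one_mul] at h2
  refine le_of_tendsto_of_tendsto h1 h2 ?_
  filter_upwards [self_mem_nhdsWithin] with t ht
  have ht : 0 < t := ht
  have h := sum_lossOverlap_sub_le e hφ hc hanti ha0 ha1 (Real.exp_pos (-t / 2))
    (exp_neg_half_le_one ht.le)
  rw [← sub_div, div_mul_eq_mul_div]
  exact div_le_div_of_nonneg_right h ht.le

/-- At infinite energy the output trace decreases at infinite rate. -/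
theorem tendsto_toReal_trace_power_atBot (e : HilbertBasis ℕ ℂ H) (hφ : Orthonormal ℂ φ)
    (hc : ∀ i, 0 < c i) (hp : 1 < p) {j₀ : Fin r}
    (hE : ¬ Summable fun n : ℕ => n * ‖inner ℂ (e n) (φ j₀)‖ ^ 2) :
    Tendsto (fun t => ((trace e (power (attenuator e t (diagonal φ c)) p)).toReal -
      ∑ i, c i ^ p) / t) (𝓝[>] 0) atBot := by
  have hp0 : 0 < p := by linarith
  have hc0 : ∀ i, 0 ≤ c i := fun i => (hc i).le
  have : Nonempty (Fin r) := ⟨j₀⟩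
  obtain ⟨i₀, hi₀⟩ := Finite.exists_min fun i => c i ^ (p - 1)
  set m := c i₀ ^ (p - 1) with hm
  have hm0 : 0 < m := Real.rpow_pos_of_pos (hc i₀) _
  set s := ∑ i, c i ^ (p - 1) with hs
  have hs0 : 0 < s := Finset.sum_pos (fun i _ => Real.rpow_pos_of_pos (hc i) _) ⟨i₀, by simp⟩
  -- The loss term of the upper bound has coefficients at least `m` times `c j`. Overlaps and error
  -- may each consume `m / 4` of it, which leaves `m / 2`; the factor `s` in the denominator pays
  -- for the sum over `i`.
  choose C hC using fun i j => exists_lossOverlap_le e (φ i) (φ j) (div_pos hm0 (mul_pos four_pos hs0))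
  set D := ∑ i, ∑ j, c i ^ (p - 1) * c j * C i j with hD
  have hdelta := (tendsto_norm_power_sub e hφ hc0 hp).eventually_lt_const
    (show (0 : ℝ) < m / 4 by positivity)
  have hlim : Tendsto (fun t : ℝ => p * (D - m / 2 * c j₀ *
      (lossProb e (Real.exp (-t / 2)) (φ j₀) / t))) (𝓝[>] 0) atBot := by
    have h1 := (tendsto_lossProb_div_atTop e hE).const_mul_atTop
      (show 0 < m / 2 * c j₀ from mul_pos (by positivity) (hc j₀))
    have h2 := tendsto_atBot_add_const_left _ D (tendsto_neg_atTop_atBot.comp h1)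
    refine (h2.const_mul_atBot hp0).congr fun t => ?_
    simp [sub_eq_add_neg]
  refine tendsto_atBot_mono' _ ?_ hlim
  filter_upwards [hdelta, Ioc_mem_nhdsGT (zero_lt_one' ℝ)] with t hδ ht
  have ht0 : 0 < t := ht.1
  have hq0 := exp_neg_half_nonneg t
  have hq1 := exp_neg_half_le_one ht0.le
  have hup := toReal_trace_power_attenuator_le e hφ hc ht0.le hp rfl
  set δ := ‖power (attenuator e t (diagonal φ c)) (p - 1) - power (diagonal φ c) (p - 1)‖ +
    ‖power (diagonal φ c) (p - 1) - power (dampedGram e φ c (Real.exp (-t / 2))) (p - 1)‖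
  set q := Real.exp (-t / 2)
  have hu : ∀ j, 0 ≤ lossProb e q (φ j) := fun j => lossProb_nonneg e hq0 hq1 _
  have h1 : ∑ i, ∑ j, c i ^ (p - 1) * c j * lossOverlap e q (φ i) (φ j) ≤
      m / 4 * ∑ j, c j * lossProb e q (φ j) + D * t := by
    calc _ ≤ ∑ i, ∑ j, c i ^ (p - 1) * c j *
          (m / (4 * s) * lossProb e q (φ j) + C i j * t) := by
          refine Finset.sum_le_sum fun i _ => Finset.sum_le_sum fun j _ => ?_
          exact mul_le_mul_of_nonneg_left (hC i j t ht0 ht.2)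
            (mul_nonneg (Real.rpow_nonneg (hc0 i) _) (hc0 j))
      _ = m / (4 * s) * (s * ∑ j, c j * lossProb e q (φ j)) + D * t := by
          generalize m / (4 * s) = κ
          rw [show s * ∑ j, c j * lossProb e q (φ j) = ∑ i, ∑ j, c i ^ (p - 1) *
            (c j * lossProb e q (φ j)) from Finset.sum_mul_sum _ _ _ _, hD, Finset.mul_sum,
            Finset.sum_mul, ← Finset.sum_add_distrib]
          refine Finset.sum_congr rfl fun i _ => ?_
          rw [Finset.mul_sum, Finset.sum_mul, ← Finset.sum_add_distrib]
          exact Finset.sum_congr rfl fun j _ => by ring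
      _ = _ := by field_simp
  have h2 : m * ∑ j, c j * lossProb e q (φ j) ≤ ∑ j, c j ^ p * lossProb e q (φ j) := by
    rw [Finset.mul_sum]
    refine Finset.sum_le_sum fun j _ => ?_
    have hpow : c j ^ p = c j ^ (p - 1) * c j := by
      rw [← Real.rpow_add_one (hc j).ne', sub_add_cancel]
    rw [hpow, ← mul_assoc]
    exact mul_le_mul_of_nonneg_right (mul_le_mul_of_nonneg_right (hi₀ j) (hc0 j)) (hu j)
  have h3 : c j₀ * lossProb e q (φ j₀) ≤ ∑ j, c j * lossProb e q (φ j) :=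
    Finset.single_le_sum (f := fun j => c j * lossProb e q (φ j))
      (fun j _ => mul_nonneg (hc0 j) (hu j)) (Finset.mem_univ j₀)
  have h4 : 0 ≤ ∑ j, c j * lossProb e q (φ j) :=
    Finset.sum_nonneg fun j _ => mul_nonneg (hc0 j) (hu j)
  have h5 : δ * ∑ j, c j * lossProb e q (φ j) ≤ m / 4 * ∑ j, c j * lossProb e q (φ j) :=
    mul_le_mul_of_nonneg_right hδ.le h4
  rw [div_le_iff₀ ht0]
  have h6 : p * (D - m / 2 * c j₀ * (lossProb e q (φ j₀) / t)) * t =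
      p * (D * t - m / 2 * (c j₀ * lossProb e q (φ j₀))) := by
    field_simp
  rw [h6]
  have h7 : m / 2 * (c j₀ * lossProb e q (φ j₀)) ≤ m / 2 * ∑ j, c j * lossProb e q (φ j) :=
    mul_le_mul_of_nonneg_left h3 (by positivity)
  have h8 := mul_le_mul_of_nonneg_left (show
    ∑ i, ∑ j, c i ^ (p - 1) * c j * lossOverlap e q (φ i) (φ j) -
      ∑ j, c j ^ p * lossProb e q (φ j) + δ * ∑ j, c j * lossProb e q (φ j) ≤
      D * t - m / 2 * (c j₀ * lossProb e q (φ j₀)) by linarith) hp0.le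
  linarith

end FiniteRank

/-! ### The thermal state -/

section Thermal

variable {H : Type*} [NormedAddCommGroup H] [InnerProductSpace ℂ H] [CompleteSpace H]

/-- Serves the thermal states, whose rank is infinite, so that `cfc_diagonal` does not apply. -/
theorem trace_cfc_of_fock_diagonal (e : HilbertBasis ℕ ℂ H) {A : H →L[ℂ] H} (hA : IsSelfAdjoint A)
    {c : ℕ → ℝ} (h : ∀ m, A (e m) = (c m : ℂ) • e m) {f : ℝ → ℝ} (hf : Continuous f)
    (hf0 : ∀ m, 0 ≤ f (c m)) {s : ℝ} (hs : HasSum (fun m => f (c m)) s) :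
    trace e (cfc f A) = ENNReal.ofReal s := by
  rw [← hs.tsum_eq, ENNReal.ofReal_tsum_of_nonneg hf0 hs.summable, trace]
  refine tsum_congr fun m => ?_
  rw [cfc_apply_of_eigenvector hf hA (h m), inner_smul_right, inner_basis, if_pos rfl, mul_one,
    Complex.ofReal_re]

variable {z : ℝ}

theorem hasSum_geometric_weight (hz0 : 0 ≤ z) (hz1 : z < 1) :
    HasSum (fun n : ℕ => (1 - z) * z ^ n) 1 := by
  have h := (hasSum_geometric_of_lt_one hz0 hz1).mul_left (1 - z)
  rwa [mul_inv_cancel₀ (by linarith)] at h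

theorem isFrame_thermal (e : HilbertBasis ℕ ℂ H) (hz0 : 0 ≤ z) (hz1 : z < 1) :
    IsFrame (fun n : ℕ => ((Real.sqrt ((1 - z) * z ^ n) : ℝ) : ℂ) • e n) (thermal e z) := by
  have hp : ∀ n : ℕ, 0 ≤ (1 - z) * z ^ n := fun n => mul_nonneg (by linarith) (pow_nonneg hz0 n)
  have hs : Summable fun n : ℕ => ‖((Real.sqrt ((1 - z) * z ^ n) : ℝ) : ℂ) • e n‖ ^ 2 := by
    refine (hasSum_geometric_weight hz0 hz1).summable.congr fun n => ?_
    rw [norm_smul, e.orthonormal.1, mul_one, Complex.norm_real, Real.norm_eq_abs, sq_abs,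
      Real.sq_sqrt (hp n)]
  have h := isFrame_tsum hs
  have heq : ∑' n : ℕ, rankOne ℂ (((Real.sqrt ((1 - z) * z ^ n) : ℝ) : ℂ) • e n)
      (((Real.sqrt ((1 - z) * z ^ n) : ℝ) : ℂ) • e n) = thermal e z := by
    refine tsum_congr fun n => ?_
    simp only [map_smulₛₗ, smul_apply, smul_smul, Complex.conj_ofReal, RingHom.id_apply]
    rw [← Complex.ofReal_mul, Real.mul_self_sqrt (hp n)]
  rwa [heq] at h

/-- The parameter of the thermal state at the output of the attenuator. -/
noncomputable def outputParam (z t : ℝ) : ℝ := z * Real.exp (-t) / (1 - z + z * Real.exp (-t))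

theorem outputParam_zero (z : ℝ) : outputParam z 0 = z := by simp [outputParam]

theorem outputParam_pos (hz0 : 0 < z) (hz1 : z < 1) (t : ℝ) : 0 < outputParam z t := by
  have := mul_pos hz0 (Real.exp_pos (-t))
  exact div_pos this (by linarith)

theorem outputParam_lt_one (hz0 : 0 < z) (hz1 : z < 1) (t : ℝ) : outputParam z t < 1 := by
  have := mul_pos hz0 (Real.exp_pos (-t))
  exact (div_lt_one (by linarith)).2 (by linarith)

theorem hasDerivAt_outputParam (z : ℝ) : HasDerivAt (outputParam z) (-(z * (1 - z))) 0 := by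
  have h1 : HasDerivAt (fun t : ℝ => z * Real.exp (-t)) (-z) 0 := by
    simpa using ((hasDerivAt_id (0 : ℝ)).neg.exp).const_mul z
  have h2 := h1.div (h1.const_add (1 - z)) (by simp)
  refine h2.congr_deriv ?_
  simp
  ring

/-- Binomial thinning of a geometric distribution is geometric: a negative binomial series in `z (1
- e^{-t})`. -/
theorem hasSum_lossAmp_thermal (hz0 : 0 < z) (hz1 : z < 1) {t : ℝ} (ht : 0 ≤ t) (m : ℕ) :
    HasSum (fun k : ℕ => lossAmp (Real.exp (-t / 2)) (m + k) k ^ 2 * ((1 - z) * z ^ (m + k)))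
      ((1 - outputParam z t) * outputParam z t ^ m) := by
  have hη0 : 0 < Real.exp (-t) := Real.exp_pos _
  have hη1 : Real.exp (-t) ≤ 1 := Real.exp_le_one_iff.2 (by linarith)
  have hη : Real.exp (-t / 2) ^ 2 = Real.exp (-t) := by
    have := exp_neg_half_sq_pow t 1
    simpa using this
  simp only [lossAmp_sq (exp_neg_half_nonneg t) (exp_neg_half_le_one ht), hη, Nat.add_sub_cancel]
  rw [outputParam]
  generalize Real.exp (-t) = η at hη0 hη1
  have hr : ‖z * (1 - η)‖ < 1 := by
    rw [Real.norm_eq_abs, abs_of_nonneg (mul_nonneg hz0.le (by linarith))]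
    nlinarith
  have hzη := mul_pos hz0 hη0
  have h := (hasSum_choose_mul_geometric_of_norm_lt_one m hr).mul_right ((1 - z) * (z * η) ^ m)
  have hden : 1 - z * (1 - η) = 1 - z + z * η := by ring
  have hne : 1 - z + z * η ≠ 0 := by linarith
  rw [hden] at h
  have h1 : (1 - z * η / (1 - z + z * η)) * (z * η / (1 - z + z * η)) ^ m =
      1 / (1 - z + z * η) ^ (m + 1) * ((1 - z) * (z * η) ^ m) := by
    have h2 : 1 - z * η / (1 - z + z * η) = (1 - z) / (1 - z + z * η) := by
      rw [eq_div_iff hne, sub_mul, div_mul_cancel₀ _ hne]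
      ring
    rw [h2, div_pow, pow_succ]
    field_simp
  rw [h1]
  refine h.congr_fun fun k => ?_
  rw [add_comm k m, Nat.choose_symm_add, mul_pow, mul_pow, pow_add]
  ring

/-- Each `K_k` lowers the Fock index by `k`, so off-diagonal elements vanish, and only the pairs `(m
+ k, k)` contribute to the `m`-th diagonal one. -/
theorem attenuator_thermal_basis (e : HilbertBasis ℕ ℂ H) (hz0 : 0 < z) (hz1 : z < 1) {t : ℝ}
    (ht : 0 ≤ t) (m : ℕ) : attenuator e t (thermal e z) (e m) =
      (((1 - outputParam z t) * outputParam z t ^ m : ℝ) : ℂ) • e m := by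
  have fY := (isFrame_thermal e hz0.le hz1).attenuator (e := e) ht
  have hlam := hasSum_lossAmp_thermal hz0 hz1 ht m
  have hq0 := exp_neg_half_nonneg t
  have hq1 := exp_neg_half_le_one ht
  generalize Real.exp (-t / 2) = q at fY hlam hq0 hq1
  have hin : ∀ l n k : ℕ, inner ℂ (e l)
      (kraus e q k (((Real.sqrt ((1 - z) * z ^ n) : ℝ) : ℂ) • e n)) =
      if l + k = n then ((lossAmp q (l + k) k * Real.sqrt ((1 - z) * z ^ n) : ℝ) : ℂ) else 0 := by
    intro l n k
    rw [inner_kraus e hq0 hq1, inner_smul_right,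
      inner_basis]
    split_ifs <;> simp
  refine ext_inner_basis e fun l => ?_
  have h1 := (fY.hasSum.mapL (ContinuousLinearMap.apply ℂ H (e m))).mapL (innerSL ℂ (e l))
  have h2 : inner ℂ (e l) (attenuator e t (thermal e z) (e m)) = _ := h1.tsum_eq.symm
  rw [h2, inner_smul_right, inner_basis]
  have h3 : ∀ j : ℕ × ℕ, innerSL ℂ (e l) (ContinuousLinearMap.apply ℂ H (e m)
      (rankOne ℂ (kraus e q j.2 (((Real.sqrt ((1 - z) * z ^ j.1) : ℝ) : ℂ) • e j.1))
        (kraus e q j.2 (((Real.sqrt ((1 - z) * z ^ j.1) : ℝ) : ℂ) • e j.1)))) =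
      if l = m then (((if m + j.2 = j.1 then lossAmp q (m + j.2) j.2 ^ 2 * ((1 - z) * z ^ j.1)
        else 0 : ℝ)) : ℂ) else 0 := by
    rintro ⟨n, k⟩
    simp only [innerSL_apply_apply, ContinuousLinearMap.apply_apply, rankOne_apply,
      inner_smul_right, hin]
    rw [← inner_conj_symm, hin]
    by_cases hlm : l = m
    · subst hlm
      by_cases hn : l + k = n
      · simp only [hn, if_true, Complex.conj_ofReal]
        rw [← Complex.ofReal_mul]
        congr 1
        linear_combination lossAmp q n k ^ 2 *
          Real.mul_self_sqrt (mul_nonneg (sub_nonneg.2 hz1.le) (pow_nonneg hz0.le n))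
      · simp [hn]
    · have : ¬ (l + k = n ∧ m + k = n) := by omega
      by_cases hl : l + k = n
      · have hm : m + k ≠ n := by omega
        simp [hm, hlm]
      · simp [hl, hlm]
  rw [tsum_congr h3]
  by_cases hlm : l = m
  · simp only [hlm, if_true, mul_one]
    rw [← Complex.ofReal_tsum]
    congr 1
    have hinj : Function.Injective fun k : ℕ => (m + k, k) := fun k k' h => (Prod.ext_iff.1 h).2
    refine HasSum.tsum_eq ((hinj.hasSum_iff ?_).1 ?_)
    · rintro ⟨n, k⟩ hnk
      refine if_neg fun h => hnk ⟨k, ?_⟩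
      simp only at h
      rw [← h]
    · refine hlam.congr_fun fun k => ?_
      simp
  · simp [hlm]

theorem thermal_basis (e : HilbertBasis ℕ ℂ H) (hz0 : 0 ≤ z) (hz1 : z < 1) (m : ℕ) :
    thermal e z (e m) = (((1 - z) * z ^ m : ℝ) : ℂ) • e m := by
  have fX := isFrame_thermal e hz0 hz1
  have h : HasSum (fun n : ℕ => ((((1 - z) * z ^ n : ℝ) : ℂ) • rankOne ℂ (e n) (e n)) (e m))
      (thermal e z (e m)) := by
    have h1 := fX.hasSum.mapL (ContinuousLinearMap.apply ℂ H (e m))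
    refine h1.congr_fun fun n => ?_
    simp only [map_smulₛₗ, smul_apply, smul_smul, Complex.conj_ofReal, RingHom.id_apply,
      ContinuousLinearMap.apply_apply]
    rw [← Complex.ofReal_mul,
      Real.mul_self_sqrt (mul_nonneg (sub_nonneg.2 hz1.le) (pow_nonneg hz0 n))]
  refine h.unique ?_
  convert hasSum_single m fun n hn => ?_ using 1
  · rw [smul_apply, rankOne_apply, inner_basis, if_pos rfl, one_smul]
  · rw [smul_apply, rankOne_apply, inner_basis, if_neg hn, zero_smul, smul_zero]

/-- The value of `∑ n, ((1 - x) x ^ n) ^ p`. -/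
noncomputable def geomPowerSum (p x : ℝ) : ℝ := (1 - x) ^ p / (1 - x ^ p)

theorem geomPowerSum_pos {p x : ℝ} (hp : 0 < p) (hx0 : 0 < x) (hx1 : x < 1) :
    0 < geomPowerSum p x :=
  div_pos (Real.rpow_pos_of_pos (by linarith) p) (sub_pos.2 (Real.rpow_lt_one hx0.le hx1 hp))

theorem hasSum_geomPowerSum {p x : ℝ} (hp : 0 < p) (hx0 : 0 < x) (hx1 : x < 1) :
    HasSum (fun n : ℕ => ((1 - x) * x ^ n) ^ p) (geomPowerSum p x) := by
  have h := (hasSum_geometric_of_lt_one (Real.rpow_nonneg hx0.le p)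
    (Real.rpow_lt_one hx0.le hx1 hp)).mul_left ((1 - x) ^ p)
  refine h.congr_fun fun n => ?_
  rw [Real.mul_rpow (by linarith) (by positivity), Real.rpow_pow_comm hx0.le]

theorem hasDerivAt_geomPowerSum {p x : ℝ} (hp : 0 < p) (hx0 : 0 < x) (hx1 : x < 1) :
    HasDerivAt (geomPowerSum p)
      (geomPowerSum p x * (p * (x ^ p / (x * (1 - x ^ p)) - 1 / (1 - x)))) x := by
  have h1x : 1 - x ≠ 0 := by linarith
  have hxp : 1 - x ^ p ≠ 0 := (sub_pos.2 (Real.rpow_lt_one hx0.le hx1 hp)).ne'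
  have h1 : HasDerivAt (fun x : ℝ => (1 - x) ^ p) (-1 * p * (1 - x) ^ (p - 1)) x :=
    ((hasDerivAt_id x).const_sub 1).rpow_const (Or.inl h1x)
  have h2 : HasDerivAt (fun x : ℝ => 1 - x ^ p) (-(p * x ^ (p - 1))) x :=
    (Real.hasDerivAt_rpow_const (Or.inl hx0.ne')).const_sub 1
  refine (h1.div h2 hxp).congr_deriv ?_
  rw [geomPowerSum, Real.rpow_sub_one h1x, Real.rpow_sub_one hx0.ne']
  field_simp
  ring

theorem toReal_trace_power_attenuator_thermal (e : HilbertBasis ℕ ℂ H) (hz0 : 0 < z) (hz1 : z < 1)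
    {t : ℝ} (ht : 0 ≤ t) {p : ℝ} (hp : 0 < p) :
    (trace e (power (attenuator e t (thermal e z)) p)).toReal =
      geomPowerSum p (outputParam z t) := by
  have hx0 := outputParam_pos hz0 hz1 t
  have hx1 := outputParam_lt_one hz0 hz1 t
  rw [power, trace_cfc_of_fock_diagonal e
    (IsSelfAdjoint.of_nonneg ((isFrame_thermal e hz0.le hz1).attenuator ht).nonneg)
    (attenuator_thermal_basis e hz0 hz1 ht) (continuous_rpow_of_pos hp)
    (fun m => Real.rpow_nonneg (mul_nonneg (by linarith) (by positivity)) p)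
    (hasSum_geomPowerSum hp hx0 hx1),
    ENNReal.toReal_ofReal (geomPowerSum_pos hp hx0 hx1).le]

theorem hasDerivWithinAt_logNorm_thermal (e : HilbertBasis ℕ ℂ H) {a : ℝ} (ha0 : 0 < a)
    (hz0 : 0 < z) (hz1 : z < 1) :
    HasDerivWithinAt (logNorm e a (thermal e z))
      ((z - z ^ (1 / a)) / (1 - z ^ (1 / a))) (Set.Ici 0) 0 := by
  have hp : 0 < 1 / a := by positivity
  have hg : HasDerivAt (fun t => geomPowerSum (1 / a) (outputParam z t))
      (geomPowerSum (1 / a) z * (1 / a * (z ^ (1 / a) / (z * (1 - z ^ (1 / a))) - 1 / (1 - z))) *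
        -(z * (1 - z))) 0 :=
    HasDerivAt.comp (h₂ := geomPowerSum (1 / a)) (h := outputParam z) 0
      (by rw [outputParam_zero]; exact hasDerivAt_geomPowerSum hp hz0 hz1)
      (hasDerivAt_outputParam z)
  have h := hasDerivWithinAt_logNorm e ha0
    (fun t ht => ((isFrame_thermal e hz0.le hz1).attenuator ht).nonneg)
    (fun t ht => toReal_trace_power_attenuator_thermal e hz0 hz1 ht hp)
    (geomPowerSum_pos hp (outputParam_pos hz0 hz1 0) (outputParam_lt_one hz0 hz1 0))
    hg.hasDerivWithinAt
  refine h.congr_deriv ?_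
  rw [outputParam_zero]
  have hT := (geomPowerSum_pos hp hz0 hz1).ne'
  have hw : 1 - z ^ (1 / a) ≠ 0 := (sub_pos.2 (Real.rpow_lt_one hz0.le hz1 hp)).ne'
  have h1z : 1 - z ≠ 0 := by linarith
  generalize geomPowerSum (1 / a) z = T at hT
  generalize z ^ (1 / a) = w at hw
  field_simp
  ring

theorem hasSum_negMulLog_geometric {w : ℝ} (hw0 : 0 < w) (hw1 : w < 1) :
    HasSum (fun n : ℕ => Real.negMulLog ((1 - w) * w ^ n))
      (-(w * Real.log w + (1 - w) * Real.log (1 - w)) / (1 - w)) := by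
  have h1w : 1 - w ≠ 0 := by linarith
  have h1 := (hasSum_geometric_of_lt_one hw0.le hw1).mul_left ((1 - w) * Real.log (1 - w))
  have h2 := (hasSum_coe_mul_geometric_of_norm_lt_one (r := w)
    (by rwa [Real.norm_eq_abs, abs_of_pos hw0])).mul_left ((1 - w) * Real.log w)
  have h3 : -(w * Real.log w + (1 - w) * Real.log (1 - w)) / (1 - w) =
      -((1 - w) * Real.log (1 - w) * (1 - w)⁻¹ + (1 - w) * Real.log w * (w / (1 - w) ^ 2)) := by
    generalize Real.log (1 - w) = l
    field_simp
    ring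
  rw [h3]
  refine (h1.add h2).neg.congr_fun fun n => ?_
  rw [Real.negMulLog, Real.log_mul h1w (by positivity), Real.log_pow]
  ring

theorem Sa_thermal (e : HilbertBasis ℕ ℂ H) {a : ℝ} (ha0 : 0 < a) (hz0 : 0 < z) (hz1 : z < 1) :
    Sa e a (thermal e z) = -(z ^ (1 / a) * Real.log (z ^ (1 / a)) +
      (1 - z ^ (1 / a)) * Real.log (1 - z ^ (1 / a))) / (1 - z ^ (1 / a)) := by
  have hp : 0 < 1 / a := by positivity
  have hX := (isFrame_thermal e hz0.le hz1).nonneg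
  have hsa := IsSelfAdjoint.of_nonneg hX
  have hT0 := geomPowerSum_pos hp hz0 hz1
  have hw0 : 0 < z ^ (1 / a) := Real.rpow_pos_of_pos hz0 _
  have hw1 : z ^ (1 / a) < 1 := Real.rpow_lt_one hz0.le hz1 hp
  have hT : (trace e (power (thermal e z) (1 / a))).toReal = geomPowerSum (1 / a) z := by
    rw [power, trace_cfc_of_fock_diagonal e hsa (thermal_basis e hz0.le hz1)
      (continuous_rpow_of_pos hp)
      (fun m => Real.rpow_nonneg (mul_nonneg (by linarith) (by positivity)) _)
      (hasSum_geomPowerSum hp hz0 hz1), ENNReal.toReal_ofReal hT0.le]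
  have hS : IsSelfAdjoint ((((geomPowerSum (1 / a) z)⁻¹ : ℝ) : ℂ) • power (thermal e z) (1 / a)) :=
    IsSelfAdjoint.smul (by simp [isSelfAdjoint_iff]) (isSelfAdjoint_power _ _)
  have hsum := hasSum_negMulLog_geometric hw0 hw1
  have hnn : ∀ m : ℕ, 0 ≤ Real.negMulLog ((1 - z ^ (1 / a)) * (z ^ (1 / a)) ^ m) := fun m =>
    Real.negMulLog_nonneg (mul_nonneg (by linarith) (by positivity))
      (mul_le_one₀ (by linarith) (by positivity) (pow_le_one₀ hw0.le hw1.le))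
  rw [Sa, hT, entropy, trace_cfc_of_fock_diagonal e hS (fun m => ?_) Real.continuous_negMulLog hnn
    hsum, ENNReal.toReal_ofReal (hsum.nonneg hnn)]
  rw [smul_apply, power, cfc_apply_of_eigenvector (continuous_rpow_of_pos hp) hsa
    (thermal_basis e hz0.le hz1 m), smul_smul, ← Complex.ofReal_mul]
  congr 2
  rw [Real.mul_rpow (by linarith) (by positivity), ← Real.rpow_pow_comm hz0.le, geomPowerSum]
  have h1 : (1 - z) ^ (1 / a) ≠ 0 := (Real.rpow_pos_of_pos (by linarith) _).ne'
  rw [inv_div]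
  field_simp

theorem mu_eq_neg_entropyWeight {a : ℝ} (ha0 : 0 < a) (hz0 : 0 < z) :
    mu z a = -entropyWeight a (z ^ (1 / a)) := by
  have h1 : (z ^ (1 / a)) ^ a = z := by
    rw [← Real.rpow_mul hz0.le, one_div_mul_cancel ha0.ne', Real.rpow_one]
  have h2 : (z ^ (1 / a)) ^ (a - 1) = z ^ ((a - 1) / a) := by
    rw [← Real.rpow_mul hz0.le]
    congr 1
    ring
  rw [mu, entropyWeight, h1, h2, div_neg, neg_neg]

/-- With `w = z^{1/a}`, the normalised `ω_z^{1/a}` is geometric of ratio `w`, and the functional is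
`geomRatio` at its maximum point. -/
theorem calF_thermal (e : HilbertBasis ℕ ℂ H) {a : ℝ} (ha0 : 0 < a) (hz0 : 0 < z) (hz1 : z < 1) :
    calF e z a (thermal e z) = ((geomValue a (z ^ (1 / a)) : ℝ) : EReal) := by
  have hp : 0 < 1 / a := by positivity
  have h1 : (z ^ (1 / a)) ^ a = z := by
    rw [← Real.rpow_mul hz0.le, one_div_mul_cancel ha0.ne', Real.rpow_one]
  rw [calF, Fa_eq_of_hasDerivWithinAt e (hasDerivWithinAt_logNorm_thermal e ha0 hz0 hz1),
    ← EReal.coe_add, Sa_thermal e ha0 hz0 hz1, mu_eq_neg_entropyWeight ha0 hz0,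
    ← geomRatio_self (Real.rpow_pos_of_pos hz0 _) (Real.rpow_lt_one hz0.le hz1 hp), geomRatio, h1]
  congr 1
  ring

end Thermal

/-! ### The inequality for operators of finite rank -/

section Inequality

variable {H : Type*} [NormedAddCommGroup H] [InnerProductSpace ℂ H] [CompleteSpace H]
  {r : ℕ} {φ : Fin r → H} {c : Fin r → ℝ} {a : ℝ}

theorem sum_rpow_pos (hc : ∀ i, 0 < c i) (hX : diagonal φ c ≠ 0) (p : ℝ) : 0 < ∑ i, c i ^ p := by
  have : Nonempty (Fin r) := by
    by_contra h
    rw [not_nonempty_iff] at h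
    exact hX (by simp [diagonal])
  exact Finset.sum_pos (fun i _ => Real.rpow_pos_of_pos (hc i) p) Finset.univ_nonempty

theorem summable_energy_of_finiteEnergy (e : HilbertBasis ℕ ℂ H) (hc : ∀ i, 0 < c i)
    (hE : FiniteEnergy e (diagonal φ c)) (j : Fin r) :
    Summable fun n : ℕ => n * ‖inner ℂ (e n) (φ j)‖ ^ 2 := by
  refine Summable.of_nonneg_of_le (fun n => by positivity) (fun n => ?_)
    (hE.mul_left (c j)⁻¹)
  have h1 : (inner ℂ (e n) (diagonal φ c (e n))).re = ∑ i, c i * ‖inner ℂ (φ i) (e n)‖ ^ 2 :=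
    expect_diagonal φ c (e n)
  have h2 : c j * ‖inner ℂ (φ j) (e n)‖ ^ 2 ≤ ∑ i, c i * ‖inner ℂ (φ i) (e n)‖ ^ 2 :=
    Finset.single_le_sum (f := fun i => c i * ‖inner ℂ (φ i) (e n)‖ ^ 2)
      (fun i _ => mul_nonneg (hc i).le (by positivity)) (Finset.mem_univ j)
  rw [h1, norm_inner_symm, mul_left_comm]
  refine mul_le_mul_of_nonneg_left ?_ (Nat.cast_nonneg n)
  rwa [← div_eq_inv_mul, le_div_iff₀' (hc j)]

theorem one_lt_one_div_of_lt_one (ha0 : 0 < a) (ha1 : a < 1) : 1 < 1 / a := by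
  rwa [lt_div_iff₀ ha0, one_mul]

theorem hasDerivWithinAt_logNorm_diagonal (e : HilbertBasis ℕ ℂ H) (hφ : Orthonormal ℂ φ)
    (hc : ∀ i, 0 < c i) (hX : diagonal φ c ≠ 0) (ha0 : 0 < a) (ha1 : a < 1)
    (hE : ∀ j, Summable fun n : ℕ => n * ‖inner ℂ (e n) (φ j)‖ ^ 2) :
    HasDerivWithinAt (logNorm e a (diagonal φ c))
      (dissipation e φ c (1 / a) / ∑ i, c i ^ (1 / a)) (Set.Ici 0) 0 := by
  have hp := one_lt_one_div_of_lt_one ha0 ha1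
  have hT0 := toReal_trace_power_attenuator_zero e hφ hc hp
  have h := hasDerivWithinAt_logNorm e ha0
    (fun t ht => ((isFrame_diagonal φ fun i => (hc i).le).attenuator ht).nonneg)
    (fun t _ => rfl) (by rw [hT0]; exact sum_rpow_pos hc hX _)
    (hasDerivWithinAt_toReal_trace_power e hφ hc hp hE)
  refine h.congr_deriv ?_
  rw [hT0, mul_div_assoc', ← mul_assoc, mul_one_div_cancel ha0.ne', one_mul]

/-- The lower bound is positive for small `t`, since loss probabilities tend to `0` whatever the
energy. Positivity is required before logarithms are compared. -/
theorem eventually_toReal_trace_power_pos (e : HilbertBasis ℕ ℂ H) (hφ : Orthonormal ℂ φ)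
    (hc : ∀ i, 0 < c i) (hX : diagonal φ c ≠ 0) {p : ℝ} (hp : 1 < p) :
    ∀ᶠ t in 𝓝[>] (0 : ℝ), 0 < (trace e (power (attenuator e t (diagonal φ c)) p)).toReal := by
  have hp0 : 0 < p := by linarith
  have hS := sum_rpow_pos hc hX p
  have h1 := (((tendsto_sum_mul_lossProb (φ := φ) (c := fun j => c j ^ p) e).comp
    tendsto_half_nhdsGT_zero).const_mul (2 * p)).eventually_lt_const
    (show 2 * p * 0 < ∑ i, c i ^ p by rwa [mul_zero])
  filter_upwards [h1, self_mem_nhdsWithin] with t h1 ht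
  have ht : 0 ≤ t := le_of_lt ht
  refine lt_of_lt_of_le ?_ (le_toReal_trace_power_attenuator e hφ hc ht hp)
  have h2 : 0 ≤ ∑ i, ∑ j, c i ^ (p - 1) * c j *
      lossOverlap e (Real.exp (-t / 2)) (φ i) (φ j) :=
    Finset.sum_nonneg fun i _ => Finset.sum_nonneg fun j _ =>
      mul_nonneg (mul_nonneg (Real.rpow_nonneg (hc i).le _) (hc j).le) (lossOverlap_nonneg _ _ _ _)
  have h3 : ∑ j, c j ^ p * (2 * lossProb e (Real.exp (-(t / 2) / 2)) (φ j)) =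
      2 * ∑ j, c j ^ p * lossProb e (Real.exp (-(t / 2) / 2)) (φ j) := by
    rw [Finset.mul_sum]
    exact Finset.sum_congr rfl fun j _ => by ring
  rw [h3]
  simp only [Function.comp_apply] at h1
  nlinarith [mul_nonneg hp0.le h2]

/-- `log x ≤ x - 1` carries the divergence of the trace over to its logarithm. -/
theorem tendsto_logNormSlope_atBot (e : HilbertBasis ℕ ℂ H) (hφ : Orthonormal ℂ φ)
    (hc : ∀ i, 0 < c i) (hX : diagonal φ c ≠ 0) (ha0 : 0 < a) (ha1 : a < 1) {j₀ : Fin r}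
    (hE : ¬ Summable fun n : ℕ => n * ‖inner ℂ (e n) (φ j₀)‖ ^ 2) :
    Tendsto (logNormSlope e a (diagonal φ c)) (𝓝[>] 0) atBot := by
  have hp := one_lt_one_div_of_lt_one ha0 ha1
  have hS := sum_rpow_pos hc hX (1 / a)
  have fX := isFrame_diagonal φ fun i => (hc i).le
  refine tendsto_atBot_mono' _ ?_ ((tendsto_toReal_trace_power_atBot e hφ hc hp hE).const_mul_atBot
    (div_pos ha0 hS))
  filter_upwards [eventually_toReal_trace_power_pos e hφ hc hX hp, self_mem_nhdsWithin] with t hT ht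
  have ht : 0 < t := ht
  rw [logNormSlope, logNorm_eq e ha0 (fX.attenuator ht.le).nonneg,
    logNorm_eq e ha0 (fX.attenuator le_rfl).nonneg, toReal_trace_power_attenuator_zero e hφ hc hp,
    ← mul_sub, ← Real.log_div hT.ne' hS.ne', ← mul_div_assoc]
  refine div_le_div_of_nonneg_right ?_ ht.le
  rw [div_mul_eq_mul_div, mul_div_assoc]
  refine mul_le_mul_of_nonneg_left ?_ ha0.le
  rw [sub_div, div_self hS.ne']
  exact Real.log_le_sub_one_of_pos (div_pos hT hS)

theorem Sa_diagonal (e : HilbertBasis ℕ ℂ H) (hφ : Orthonormal ℂ φ) (hc : ∀ i, 0 < c i)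
    (hX : diagonal φ c ≠ 0) (ha0 : 0 < a) : Sa e a (diagonal φ c) =
      Real.log (∑ i, c i ^ (1 / a)) -
        (∑ i, c i ^ (1 / a) * Real.log (c i ^ (1 / a))) / ∑ i, c i ^ (1 / a) := by
  have hp : 0 < 1 / a := by positivity
  have hS := sum_rpow_pos hc hX (1 / a)
  have hy : ∀ i, 0 < c i ^ (1 / a) := fun i => Real.rpow_pos_of_pos (hc i) _
  rw [Sa, toReal_trace_power_diagonal hφ (fun i => (hc i).le) e hp, power_diagonal hφ c hp]
  set S := ∑ i, c i ^ (1 / a) with hSdef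
  have h1 : ((S⁻¹ : ℝ) : ℂ) • diagonal φ (fun i => c i ^ (1 / a)) =
      diagonal φ fun i => S⁻¹ * c i ^ (1 / a) := by
    rw [diagonal, diagonal, Finset.smul_sum]
    refine Finset.sum_congr rfl fun i _ => ?_
    rw [smul_smul, ← Complex.ofReal_mul]
  have hnn : ∀ i, 0 ≤ Real.negMulLog (S⁻¹ * c i ^ (1 / a)) := fun i => by
    refine Real.negMulLog_nonneg (mul_nonneg (inv_nonneg.2 hS.le) (hy i).le) ?_
    rw [← div_eq_inv_mul, div_le_one hS]
    exact Finset.single_le_sum (f := fun i => c i ^ (1 / a)) (fun i _ => (hy i).le)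
      (Finset.mem_univ i)
  rw [h1, entropy, cfc_diagonal hφ _ Real.continuous_negMulLog Real.negMulLog_zero,
    trace_diagonal hφ hnn, ENNReal.toReal_ofReal (Finset.sum_nonneg fun i _ => hnn i)]
  have h2 : ∀ i, Real.negMulLog (S⁻¹ * c i ^ (1 / a)) =
      S⁻¹ * Real.log S * c i ^ (1 / a) - S⁻¹ * (c i ^ (1 / a) * Real.log (c i ^ (1 / a))) := fun i => by
    rw [Real.negMulLog, Real.log_mul (inv_ne_zero hS.ne') (hy i).ne', Real.log_inv]
    ring
  simp only [h2]
  rw [Finset.sum_sub_distrib, ← Finset.mul_sum, ← Finset.mul_sum, ← hSdef, mul_right_comm,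
    inv_mul_cancel₀ hS.ne', one_mul, ← div_eq_inv_mul]

theorem dissipation_le_mul_sum (e : HilbertBasis ℕ ℂ H) (hφ : Orthonormal ℂ φ)
    (hc : ∀ i, 0 < c i) (hanti : Antitone c) (ha0 : 0 < a) (ha1 : a < 1)
    (hE : ∀ j, Summable fun n : ℕ => n * ‖inner ℂ (e n) (φ j)‖ ^ 2) :
    dissipation e φ c (1 / a) ≤ (1 - a) * ∑ i, c i ^ (1 / a) := by
  have h := (dissipation_le e hφ hc hanti ha0 ha1 hE).trans (diagFlux_le ha0 ha1 fun k =>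
    Real.rpow_nonneg (eigenSeq_nonneg (fun i => (hc i).le) k) _)
  simpa only [Finset.sum_range, eigenSeq_coe] using h

theorem dissipation_add_entropy_le (e : HilbertBasis ℕ ℂ H) (hφ : Orthonormal ℂ φ)
    (hc : ∀ i, 0 < c i) (hanti : Antitone c) (ha0 : 0 < a) (ha1 : a < 1)
    (hE : ∀ j, Summable fun n : ℕ => n * ‖inner ℂ (e n) (φ j)‖ ^ 2) {w : ℝ} (hw0 : 0 < w)
    (hw1 : w < 1) : dissipation e φ c (1 / a) +
        entropyWeight a w * ∑ i, c i ^ (1 / a) * Real.log (c i ^ (1 / a)) ≤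
      geomValue a w * ∑ i, c i ^ (1 / a) + entropyWeight a w *
        ((∑ i, c i ^ (1 / a)) * Real.log (∑ i, c i ^ (1 / a))) := by
  have hp : 1 / a ≠ 0 := (one_div_pos.2 ha0).ne'
  have h := diagFlux_add_entropy_le ha0 ha1 hw0 hw1 r (y := fun k => eigenSeq c k ^ (1 / a))
    (fun k => Real.rpow_nonneg (eigenSeq_nonneg (fun i => (hc i).le) k) _)
    (fun k hk => by rw [eigenSeq_of_le hk, Real.zero_rpow hp])
  have h1 := dissipation_le e hφ hc hanti ha0 ha1 hE
  simp only [Finset.sum_range, eigenSeq_coe] at h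
  linarith

theorem tendsto_logNormSlope_ereal (e : HilbertBasis ℕ ℂ H) (hφ : Orthonormal ℂ φ)
    (hc : ∀ i, 0 < c i) (hX : diagonal φ c ≠ 0) (ha0 : 0 < a) (ha1 : a < 1) {j₀ : Fin r}
    (hE : ¬ Summable fun n : ℕ => n * ‖inner ℂ (e n) (φ j₀)‖ ^ 2) :
    Tendsto (fun t : ℝ => ((logNormSlope e a (diagonal φ c) t : ℝ) : EReal)) (𝓝[>] 0) (𝓝 ⊥) := by
  rw [EReal.tendsto_nhds_bot_iff_real]
  intro x
  filter_upwards [(tendsto_logNormSlope_atBot e hφ hc hX ha0 ha1 hE).eventually_lt_atBot x] with t ht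
  exact EReal.coe_lt_coe_iff.2 ht

end Inequality

end OneMode

theorem theorem3p1 {H : Type*} [NormedAddCommGroup H] [InnerProductSpace ℂ H] [CompleteSpace H]
    (e : HilbertBasis ℕ ℂ H) (a z : ℝ) (ha0 : 0 < a) (ha1 : a < 1) (hz0 : 0 < z) (hz1 : z < 1) :
    (∃ r : ℝ, OneMode.Fa e a (OneMode.thermal e z) = (r : EReal) ∧
      HasDerivWithinAt (OneMode.logNorm e a (OneMode.thermal e z)) r (Set.Ici 0) 0) ∧
    ∀ X : H →L[ℂ] H, X.IsPositive → X ≠ 0 → FiniteDimensional ℂ (LinearMap.range X.toLinearMap) →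
      Tendsto (fun t : ℝ => ((OneMode.logNormSlope e a X t : ℝ) : EReal)) (𝓝[>] 0)
        (𝓝 (OneMode.Fa e a X)) ∧
      (OneMode.FiniteEnergy e X →
        ∃ r : ℝ, OneMode.Fa e a X = (r : EReal) ∧
          HasDerivWithinAt (OneMode.logNorm e a X) r (Set.Ici 0) 0) ∧
      OneMode.calF e z a X ≤ OneMode.calF e z a (OneMode.thermal e z) ∧
      OneMode.Fa e a X ≤ ((1 - a : ℝ) : EReal) := by
  refine ⟨⟨_, OneMode.Fa_eq_of_hasDerivWithinAt e
    (OneMode.hasDerivWithinAt_logNorm_thermal e ha0 hz0 hz1),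
    OneMode.hasDerivWithinAt_logNorm_thermal e ha0 hz0 hz1⟩, fun X hpos hX hfin => ?_⟩
  obtain ⟨r, φ, c, hφ, hc, hanti, rfl⟩ :=
    OneMode.exists_eq_diagonal ((ContinuousLinearMap.nonneg_iff_isPositive X).2 hpos)
  rw [OneMode.calF_thermal e ha0 hz0 hz1, OneMode.calF]
  by_cases hE : ∀ j, Summable fun n : ℕ => n * ‖inner ℂ (e n) (φ j)‖ ^ 2
  · have hS := OneMode.sum_rpow_pos hc hX (1 / a)
    have hd := OneMode.hasDerivWithinAt_logNorm_diagonal e hφ hc hX ha0 ha1 hE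
    have hF := OneMode.Fa_eq_of_hasDerivWithinAt e hd
    rw [hF]
    refine ⟨(continuous_coe_real_ereal.tendsto _).comp (OneMode.tendsto_logNormSlope e hd),
      fun _ => ⟨_, rfl, hd⟩, ?_, ?_⟩
    · rw [← EReal.coe_add, EReal.coe_le_coe_iff, OneMode.Sa_diagonal e hφ hc hX ha0,
        OneMode.mu_eq_neg_entropyWeight ha0 hz0]
      have h := OneMode.dissipation_add_entropy_le e hφ hc hanti ha0 ha1 hE
        (Real.rpow_pos_of_pos hz0 (1 / a)) (Real.rpow_lt_one hz0.le hz1 (one_div_pos.2 ha0))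
      -- After multiplication by `Tr X^p`, the normalisation inside the entropy becomes the
      -- total-mass logarithm in `h`.
      refine le_of_mul_le_mul_right ?_ hS
      refine le_trans (le_of_eq ?_) (sub_le_iff_le_add.2 h)
      field_simp
      ring
    · rw [EReal.coe_le_coe_iff, div_le_iff₀ hS]
      exact OneMode.dissipation_le_mul_sum e hφ hc hanti ha0 ha1 hE
  -- One eigenvector of infinite energy gives `F_a(X) = -∞`: both inequalities become trivial, and
  -- `FiniteEnergy` is contradicted.
  · obtain ⟨j₀, hj⟩ := not_forall.1 hE
    have ht := OneMode.tendsto_logNormSlope_ereal e hφ hc hX ha0 ha1 hj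
    rw [OneMode.Fa_eq_of_tendsto e ht, EReal.bot_add]
    exact ⟨ht, fun hfe => (hj (OneMode.summable_energy_of_finiteEnergy e hc hfe j₀)).elim,
      bot_le, bot_le⟩
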